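/- Let $\mathcal H$ be a complex Hilbert space, $h$ a selfadjoint operator on $\mathcal H$, $k$ a bounded selfadjoint operator, $h_0:=h+k^2$ with $D(h_0)=D(h)$. For a selfadjoint operator $S$ write $S>0$ if $S\ge 0$ and $\operatorname{Ker}S=\{0\}$, and then let $S^{-1/2}\mathcal H$ be the completion of $D(S^{1/2})$ for the norm $\|S^{1/2}u\|$; write $\langle S\rangle=(1+S^2)^{1/2}$. Commutators $[S,B]$ of an unbounded selfadjoint $S$ with a bounded selfadjoint $B$ are understood as forms on $D(S)$. **Assumptions.** (A1) $h_0>0$. (A2) $k\in\mathcal B(h_0^{-1/2}\mathcal H)$; for $z\notin\mathbb R$, $(k-z)^{-1}\in\mathcal B(h_0^{-1/2}\mathcal H)$; for some $n>0$, $\|(k-z)^{-1}\|_{\mathcal B(h_0^{-1/2}\mathcal H)}\lesssim|\operatorname{Im}z|^{-n}$ for $0<|\operatorname{Im}z|\le1$; and for some $m>0$, $\|(k-z)^{-1}\|_{\mathcal B(h_0^{-1/2}\mathcal H)}\lesssim(|z|-\|k\|)^{-1}$ whenever $|z|\ge m\|k\|$ and $|z|>\|k\|$. (TE1) $x$ is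 a selfadjoint operator on $\mathcal H$ with $\sigma(x)=\sigma_{ac}(x)=\mathbb R$ and $[x,k]=0$; $w=w(x)$ with $w\in C^\infty(\mathbb R)$ and $w\ge c$ for some constant $c>0$; $h_0$ is local in $x$, i.e. $\chi_1(x)h_0\chi_2(x)=0$ whenever $\chi_1,\chi_2\in C^\infty(\mathbb R)$ are bounded with all their derivatives and have disjoint supports. Fix $\chi_\pm\in C^\infty(\mathbb R;[0,1])$ with $\chi_+^2+\chi_-^2=1$, $\operatorname{supp}\chi_-\subset(-\infty,1)$, $\operatorname{supp}\chi_+\subset(-1,\infty)$, and $\tilde\chi\in C_0^\infty((-2,2))$ with $\tilde\chi=1$ on $[-1,1]$. For $\ell\in\mathbb R$ and $R>0$ put $i_\pm=\chi_\pm(R^{-1}x)$, $j_\pm=\chi_\pm(R^{-1}x\mp3)$, $\tilde i=\tilde\chi(R^{-1}x)$, $k_\pm=k\mp\ell j_\mp^2$, $h_+=h_0-k_+^2$, $\tilde h_-=h_0-(k_--\ell)^2$. (TE2) $(S,\kappa)=(h_+,k_+)$ and $(S,\kappa)=(\tilde h_-,k_--\ell)$ satisfy $S\ge c\,\kappa^2$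 for some $c>0$. (TE3) With the same $\ell,R$, and with $S_+:=h_+$, $S_-:=\tilde h_-$: a) $wi_+ki_+w$ and $wi_-(k-\ell)i_-w$ are bounded on $\mathcal H$; b) $[h,i_\pm]=\tilde i[h,i_\pm]\tilde i$; c) for $(S,\kappa)=(h_+,k_+)$ and $(\tilde h_-,k_--\ell)$: $w\kappa w$ is bounded, $[\kappa,w]=0$, $S^{-1/2}[S,w^{-\epsilon}]w^{\epsilon/2}$ is bounded for all $0<\epsilon\le1$, $\|w^{-\epsilon}u\|\lesssim\|S^{1/2}u\|$ on $D(S^{1/2})$ for all $\epsilon>0$, $w^{-1}\langle S\rangle^{-1}$ is compact, and for every $\epsilon>0$ there is $\delta_\epsilon>0$ such that $w^{-\epsilon}(S-z^2)^{-1}w^{-\epsilon}$ extends from $\operatorname{Im}z>0$ to $\operatorname{Im}z>-\delta_\epsilon$ as a finite meromorphic function with values in the compact operators; d) $S_\pm^{1/2}i_\pm S_\pm^{-1/2}$ and $h_0^{1/2}i_\pm h_0^{-1/2}$ are bounded on $\mathcal H$; e) $w[h,i_\pm]wS_\pm^{-1/2}$, $w[h,i_\pm]wh_0^{-1/2}$,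 $[h,i_\pm]S_\pm^{-1/2}$, $[h,i_\pm]h_0^{-1/2}$ and $h_0^{-1/2}[w^{-1},h_0]w^{1/2}$ are bounded on $\mathcal H$; f) for all $\epsilon>0$, $\|w^{-\epsilon}u\|\lesssim\|h_0^{1/2}u\|$ on $D(h_0^{1/2})$. Here an operator-valued function is *finite meromorphic* on an open set if near each point $z_0$ of it the function is, off $z_0$, the sum of a holomorphic function and of finitely many terms $(z-z_0)^{-j}A_j$, $j\ge1$, with $A_j$ of finite rank. **Operators.** Let $\mathcal E=D(h_0^{1/2})\oplus\mathcal H$ with $\|u\|_{\mathcal E}^2=\|u_1-ku_0\|^2+\|h_0^{1/2}u_0\|^2+\|u_0\|^2$, and let $\dot{\mathcal E}$ be the completion of $\mathcal E$ for $\|u\|_{\dot{\mathcal E}}^2=\|u_1-ku_0\|^2+\|h_0^{1/2}u_0\|^2$. Let $H$ and $\dot H$ be the operators induced on $\mathcal E$ and $\dot{\mathcal E}$ by $\hat H=\begin{pmatrix}0&1\\h&2k\end{pmatrix}$, i.e. $D(H)=\{u\in\mathcal E:\hat Hu\in\mathcal E\}=D(h)\oplus D(h_0^{1/2})$ and $D(\dot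 H)=\{u\in\dot{\mathcal E}:\hat Hu\in\dot{\mathcal E}\}$. **Statement.** Assume (A1), (A2), (TE1) and that (TE2), (TE3) hold for some $\ell\in\mathbb R$, $R>0$. Then there is a finite set $Z\subset\mathbb C\setminus\mathbb R$ with $\overline Z=Z$ such that $\sigma(H)\setminus\mathbb R=\sigma(\dot H)\setminus\mathbb R=Z$, and every point of $Z$ is an eigenvalue of $H$ and of $\dot H$ with finite-dimensional eigenspaces. The resolvents $z\mapsto(H-z)^{-1}$ and $z\mapsto(\dot H-z)^{-1}$ are finite meromorphic on $\mathbb C\setminus\mathbb R$. Moreover $\sigma_p(H)\subset\sigma_p(\dot H)$, and $\sigma_p(H)$ and $\sigma_p(\dot H)$ coincide outside $\{0,\ell\}$; if $\ell=0$ they coincide. -/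

import Mathlib

open Filter Topology
open scoped ContDiff InnerProductSpace

noncomputable section

namespace KG

/-! ### Unbounded operators: resolvent, spectrum, point spectrum -/

section Unbounded

variable {X : Type*} [NormedAddCommGroup X] [NormedSpace ℂ X]

/-- `B` is the bounded everywhere defined inverse of `A - z`. -/
def IsResolventAt (A : X →ₗ.[ℂ] X) (z : ℂ) (B : X →L[ℂ] X) : Prop :=
  (∀ f : X, ∃ hf : B f ∈ A.domain, A ⟨B f, hf⟩ - z • B f = f) ∧
    ∀ u : A.domain, B (A u - z • (u : X)) = u

/-- The resolvent set `ρ(A)`. -/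
def resolventSet (A : X →ₗ.[ℂ] X) : Set ℂ := {z | ∃ B : X →L[ℂ] X, IsResolventAt A z B}

/-- The spectrum `σ(A)`. -/
def opSpectrum (A : X →ₗ.[ℂ] X) : Set ℂ := (resolventSet A)ᶜ

open Classical in
/-- The resolvent `(A - z)⁻¹` (and `0` if `z` is in the spectrum). -/
def resolventOp (A : X →ₗ.[ℂ] X) (z : ℂ) : X →L[ℂ] X :=
  if hz : ∃ B : X →L[ℂ] X, IsResolventAt A z B then hz.choose else 0

/-- The eigenspace `Ker (A - z)`, as a subspace of `X`. -/
def eigenspace (A : X →ₗ.[ℂ] X) (z : ℂ) : Submodule ℂ X :=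
  (LinearMap.ker (A.toFun - z • A.domain.subtype)).map A.domain.subtype

/-- The point spectrum: the set of eigenvalues. -/
def pointSpectrum (A : X →ₗ.[ℂ] X) : Set ℂ := {z | eigenspace A z ≠ ⊥}

/-- `F` is finite meromorphic at `z₀`: near `z₀` (and off `z₀`) it is the sum of a holomorphic
function and a finite principal part whose coefficients are operators of finite rank. -/
def FinMeroAt (F : ℂ → X →L[ℂ] X) (z₀ : ℂ) : Prop :=
  ∃ (N : ℕ) (A : ℕ → X →L[ℂ] X) (G : ℂ → X →L[ℂ] X),
    (∀ n, FiniteDimensional ℂ (LinearMap.range (A n : X →ₗ[ℂ] X))) ∧ AnalyticAt ℂ G z₀ ∧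
      ∀ᶠ z in 𝓝[≠] z₀, F z = (∑ n ∈ Finset.range N, ((z - z₀) ^ (n + 1))⁻¹ • A n) + G z

/-- `F` is finite meromorphic on `U`. -/
def FinMeroOn (F : ℂ → X →L[ℂ] X) (U : Set ℂ) : Prop := ∀ z ∈ U, FinMeroAt F z

end Unbounded

section Hilbert

variable {H : Type*} [NormedAddCommGroup H] [InnerProductSpace ℂ H] [CompleteSpace H]

/-! ### Functional calculus of a selfadjoint operator -/

/-- `g(S)` for `S` selfadjoint and `g` continuous with compact support, through the continuous
functional calculus of the bounded normal operator `(S + i)⁻¹`: a spectral value `ζ = (s + i)⁻¹` of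
the latter corresponds to `s = ζ⁻¹ - i`, and `ζ = 0` corresponds to `s = ∞`, where `g` vanishes. -/
def ccFun (S : H →ₗ.[ℂ] H) (g : ℝ → ℝ) : H →L[ℂ] H :=
  cfc (fun ζ : ℂ => if ζ = 0 then 0 else ((g (ζ⁻¹ - Complex.I).re : ℝ) : ℂ))
    (resolventOp S (-Complex.I))

/-- The graph of `f(S)` for `f` continuous: `v = f(S) u` if and only if `g(S) v = (g f)(S) u` for
all continuous compactly supported `g`. -/
def funGraph (S : H →ₗ.[ℂ] H) (f : ℝ → ℝ) : Submodule ℂ (H × H) where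
  carrier := {q | ∀ g : ℝ → ℝ, Continuous g → HasCompactSupport g →
    ccFun S (fun t => g t * f t) q.1 = ccFun S g q.2}
  zero_mem' := by intro g _ _; simp
  add_mem' := by
    intro a b ha hb g hg hg'
    simp [ha g hg hg', hb g hg hg']
  smul_mem' := by
    intro c a ha g hg hg'
    simp [ha g hg hg']

/-- The (in general unbounded) operator `f(S)`. -/
def opFun (S : H →ₗ.[ℂ] H) (f : ℝ → ℝ) : H →ₗ.[ℂ] H := (funGraph S f).toLinearPMap

open Classical in
/-- The operator `f(S)` as a bounded operator, for `f` continuous and bounded (on the spectrum). -/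
def bddFun (S : H →ₗ.[ℂ] H) (f : ℝ → ℝ) : H →L[ℂ] H :=
  if hf : ∃ B : H →L[ℂ] H, ∀ u, (u, B u) ∈ funGraph S f then hf.choose else 0

/-- The square root `S^{1/2}` of a nonnegative selfadjoint operator. -/
def sqrtOp (S : H →ₗ.[ℂ] H) : H →ₗ.[ℂ] H := opFun S Real.sqrt

/-- `⟨S⟩⁻¹ = (1 + S²)^{-1/2}`. -/
def japaneseInv (S : H →ₗ.[ℂ] H) : H →L[ℂ] H := bddFun S (fun t => (Real.sqrt (1 + t ^ 2))⁻¹)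

/-- The absolutely continuous vectors of `S`: the spectral measure of `u` has a density `ρ`. -/
def IsACVector (S : H →ₗ.[ℂ] H) (u : H) : Prop :=
  ∃ ρ : ℝ → ℝ, MeasureTheory.Integrable ρ ∧ ∀ g : ℝ → ℝ, Continuous g → HasCompactSupport g →
    ⟪u, ccFun S g u⟫_ℂ = ((∫ t, g t * ρ t : ℝ) : ℂ)

/-- The absolutely continuous spectrum of `S`: the spectrum of the restriction of `S` to the
subspace of its absolutely continuous vectors. -/
def acSpectrum (S : H →ₗ.[ℂ] H) : Set ℝ :=
  {s | ∀ g : ℝ → ℝ, Continuous g → HasCompactSupport g → g s ≠ 0 →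
    ∃ u, IsACVector S u ∧ ccFun S g u ≠ 0}

/-- The operator `S + B` with domain `D(S)`, for `B` bounded. -/
def perturb (S : H →ₗ.[ℂ] H) (B : H →L[ℂ] H) : H →ₗ.[ℂ] H := (B : H →ₗ[ℂ] H) +ᵥ S

/-- The form `(y | [S, B] s)` on `D(S)`, for `S` selfadjoint and `B` bounded selfadjoint. -/
def commForm (S : H →ₗ.[ℂ] H) (B : H →L[ℂ] H) (y s : S.domain) : ℂ :=
  ⟪S y, B (s : H)⟫_ℂ - ⟪B (y : H), S s⟫_ℂ

/-- `S > 0`: `S ≥ 0` and `Ker S = {0}`. -/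
def IsPos (S : H →ₗ.[ℂ] H) : Prop :=
  (∀ u : S.domain, 0 ≤ (⟪(u : H), S u⟫_ℂ).re) ∧ ∀ u : S.domain, S u = 0 → (u : H) = 0

/-- The bounded operator `B` leaves `D(S^{1/2})` invariant and satisfies
`‖S^{1/2} B u‖ ≤ C ‖S^{1/2} u‖` there.  Equivalently `S^{1/2} B S^{-1/2}` is bounded by `C` on `H`,
or `B` is bounded by `C` on the homogeneous space `S^{-1/2} H`. -/
def HomBound (S : H →ₗ.[ℂ] H) (B : H →L[ℂ] H) (C : ℝ) : Prop :=
  ∀ u : (sqrtOp S).domain, ∃ hu : B (u : H) ∈ (sqrtOp S).domain,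
    ‖sqrtOp S ⟨B (u : H), hu⟩‖ ≤ C * ‖sqrtOp S u‖

open Classical in
/-- The bounded operator on `H` extending `S^{1/2} B S^{-1/2}`.  If `S^{-1/2} H` is identified with
`H` by `S^{1/2}`, this is the continuous extension of `B` to `S^{-1/2} H`. -/
def homExt (S : H →ₗ.[ℂ] H) (B : H →L[ℂ] H) : H →L[ℂ] H :=
  if hB : ∃ T : H →L[ℂ] H, ∀ u : (sqrtOp S).domain, ∃ hu : B (u : H) ∈ (sqrtOp S).domain,
    sqrtOp S ⟨B (u : H), hu⟩ = T (sqrtOp S u) then hB.choose else 0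

/-! ### Energy spaces -/

/-- `h₀ = h + k²`. -/
def hZero (h : H →ₗ.[ℂ] H) (k : H →L[ℂ] H) : H →ₗ.[ℂ] H := perturb h (k * k)

/-- The inhomogeneous energy space `D(h₀^{1/2}) ⊕ H`. -/
def Energy (h : H →ₗ.[ℂ] H) (k : H →L[ℂ] H) : Type _ := (sqrtOp (hZero h k)).domain × H

instance (h : H →ₗ.[ℂ] H) (k : H →L[ℂ] H) : AddCommGroup (Energy h k) :=
  inferInstanceAs (AddCommGroup ((sqrtOp (hZero h k)).domain × H))

instance (h : H →ₗ.[ℂ] H) (k : H →L[ℂ] H) : Module ℂ (Energy h k) :=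
  inferInstanceAs (Module ℂ ((sqrtOp (hZero h k)).domain × H))

/-- The first component `u₀`. -/
def Energy.c0 (h : H →ₗ.[ℂ] H) (k : H →L[ℂ] H) :
    Energy h k →ₗ[ℂ] (sqrtOp (hZero h k)).domain := LinearMap.fst ℂ _ H

/-- The second component `u₁`. -/
def Energy.c1 (h : H →ₗ.[ℂ] H) (k : H →L[ℂ] H) : Energy h k →ₗ[ℂ] H := LinearMap.snd ℂ _ H

/-- `u ↦ h₀^{1/2} u₀`. -/
def Energy.root (h : H →ₗ.[ℂ] H) (k : H →L[ℂ] H) : Energy h k →ₗ[ℂ] H :=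
  (sqrtOp (hZero h k)).toFun ∘ₗ Energy.c0 h k

/-- `u ↦ u₀`, as an element of `H`. -/
def Energy.pos (h : H →ₗ.[ℂ] H) (k : H →L[ℂ] H) : Energy h k →ₗ[ℂ] H :=
  (sqrtOp (hZero h k)).domain.subtype ∘ₗ Energy.c0 h k

/-- `u ↦ u₁ - k u₀`. -/
def Energy.cov (h : H →ₗ.[ℂ] H) (k : H →L[ℂ] H) : Energy h k →ₗ[ℂ] H :=
  Energy.c1 h k - (k : H →ₗ[ℂ] H) ∘ₗ Energy.pos h k

/-- The map `u ↦ (u₁ - k u₀, h₀^{1/2} u₀, u₀)` into the Hilbert sum of three copies of `H`. -/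
def Energy.emb (h : H →ₗ.[ℂ] H) (k : H →L[ℂ] H) :
    Energy h k →ₗ[ℂ] PiLp 2 (fun _ : Fin 3 => H) :=
  (WithLp.linearEquiv 2 ℂ (Fin 3 → H)).symm.toLinearMap ∘ₗ
    LinearMap.pi ![Energy.cov h k, Energy.root h k, Energy.pos h k]

theorem Energy.emb_injective (h : H →ₗ.[ℂ] H) (k : H →L[ℂ] H) :
    Function.Injective (Energy.emb h k) := by
  rw [← LinearMap.ker_eq_bot, LinearMap.ker_eq_bot']
  intro u hu
  have h2 : Energy.pos h k u = 0 := congrFun (congrArg WithLp.ofLp hu) 2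
  have h0 : Energy.cov h k u = 0 := congrFun (congrArg WithLp.ofLp hu) 0
  have h1 : Energy.c1 h k u = 0 := by
    have : Energy.c1 h k u - k (Energy.pos h k u) = 0 := h0
    simpa [h2] using this
  exact Prod.ext (Subtype.ext h2) h1

/-- The norm `‖u‖² = ‖u₁ - k u₀‖² + ‖h₀^{1/2} u₀‖² + ‖u₀‖²`. -/
instance (h : H →ₗ.[ℂ] H) (k : H →L[ℂ] H) : NormedAddCommGroup (Energy h k) :=
  NormedAddCommGroup.induced (Energy h k) (PiLp 2 (fun _ : Fin 3 => H)) (Energy.emb h k)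
    (Energy.emb_injective h k)

instance (h : H →ₗ.[ℂ] H) (k : H →L[ℂ] H) : NormedSpace ℂ (Energy h k) :=
  NormedSpace.induced ℂ (Energy h k) (PiLp 2 (fun _ : Fin 3 => H)) (Energy.emb h k)

/-- The vector space `D(h₀^{1/2}) ⊕ H`, to be equipped with the homogeneous energy norm. -/
def PreEnergy (h : H →ₗ.[ℂ] H) (k : H →L[ℂ] H) : Type _ := Energy h k

instance (h : H →ₗ.[ℂ] H) (k : H →L[ℂ] H) : AddCommGroup (PreEnergy h k) :=
  inferInstanceAs (AddCommGroup (Energy h k))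

instance (h : H →ₗ.[ℂ] H) (k : H →L[ℂ] H) : Module ℂ (PreEnergy h k) :=
  inferInstanceAs (Module ℂ (Energy h k))

/-- The map `u ↦ (u₁ - k u₀, h₀^{1/2} u₀)` into the Hilbert sum of two copies of `H`. -/
def PreEnergy.emb (h : H →ₗ.[ℂ] H) (k : H →L[ℂ] H) :
    PreEnergy h k →ₗ[ℂ] PiLp 2 (fun _ : Fin 2 => H) :=
  (WithLp.linearEquiv 2 ℂ (Fin 2 → H)).symm.toLinearMap ∘ₗ
    LinearMap.pi ![Energy.cov h k, Energy.root h k]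

/-- The norm `‖u‖² = ‖u₁ - k u₀‖² + ‖h₀^{1/2} u₀‖²`. -/
instance (h : H →ₗ.[ℂ] H) (k : H →L[ℂ] H) : SeminormedAddCommGroup (PreEnergy h k) :=
  SeminormedAddCommGroup.induced (PreEnergy h k) (PiLp 2 (fun _ : Fin 2 => H)) (PreEnergy.emb h k)

instance (h : H →ₗ.[ℂ] H) (k : H →L[ℂ] H) : NormedSpace ℂ (PreEnergy h k) :=
  NormedSpace.induced ℂ (PreEnergy h k) (PiLp 2 (fun _ : Fin 2 => H)) (PreEnergy.emb h k)

/-- The homogeneous energy space: the completion of `D(h₀^{1/2}) ⊕ H` for the homogeneous norm. -/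
abbrev HomEnergy (h : H →ₗ.[ℂ] H) (k : H →L[ℂ] H) : Type _ :=
  UniformSpace.Completion (PreEnergy h k)

/-- The isometry `u ↦ (u₁ - k u₀, h₀^{1/2} u₀)` as a continuous map. -/
def PreEnergy.embL (h : H →ₗ.[ℂ] H) (k : H →L[ℂ] H) :
    PreEnergy h k →L[ℂ] PiLp 2 (fun _ : Fin 2 => H) :=
  ⟨PreEnergy.emb h k, continuous_induced_dom⟩

/-- Its extension to the homogeneous energy space. -/
def HomEnergy.embL (h : H →ₗ.[ℂ] H) (k : H →L[ℂ] H) :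
    HomEnergy h k →L[ℂ] PiLp 2 (fun _ : Fin 2 => H) :=
  (PreEnergy.embL h k).extend (UniformSpace.Completion.toComplL (𝕜 := ℂ) (E := PreEnergy h k))

/-- The continuous extension of `u ↦ u₁ - k u₀` to the homogeneous energy space. -/
def HomEnergy.cov (h : H →ₗ.[ℂ] H) (k : H →L[ℂ] H) : HomEnergy h k →L[ℂ] H :=
  (PiLp.proj 2 (fun _ : Fin 2 => H) 0 : PiLp 2 (fun _ : Fin 2 => H) →L[ℂ] H) ∘L HomEnergy.embL h k

/-- The continuous extension of `u ↦ h₀^{1/2} u₀` to the homogeneous energy space. -/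
def HomEnergy.root (h : H →ₗ.[ℂ] H) (k : H →L[ℂ] H) : HomEnergy h k →L[ℂ] H :=
  (PiLp.proj 2 (fun _ : Fin 2 => H) 1 : PiLp 2 (fun _ : Fin 2 => H) →L[ℂ] H) ∘L HomEnergy.embL h k

/-! ### The Klein-Gordon operators -/

/-- The graph of the operator induced on the inhomogeneous energy space by the matrix with rows
`(0, 1)` and `(h, 2k)`: `u' = (u₁, h u₀ + 2 k u₁)` with `u₀ ∈ D(h)` and `u₁ ∈ D(h₀^{1/2})`. -/
def kgGraph (h : H →ₗ.[ℂ] H) (k : H →L[ℂ] H) : Submodule ℂ (Energy h k × Energy h k) where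
  carrier := {q | Energy.pos h k q.2 = Energy.c1 h k q.1 ∧
    ∃ hu : Energy.pos h k q.1 ∈ h.domain,
      Energy.c1 h k q.2 = h ⟨Energy.pos h k q.1, hu⟩ + (2 : ℂ) • k (Energy.c1 h k q.1)}
  zero_mem' := by
    refine ⟨by simp, by simp, ?_⟩
    have e : (⟨Energy.pos h k (0 : Energy h k × Energy h k).1, by simp⟩ : h.domain) = 0 :=
      Subtype.ext (by simp)
    rw [e]; simp
  add_mem' := by
    rintro a b ⟨ha, ha', ha''⟩ ⟨hb, hb', hb''⟩
    have hm : Energy.pos h k (a + b).1 ∈ h.domain := by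
      simpa using h.domain.add_mem ha' hb'
    refine ⟨by simp [ha, hb], hm, ?_⟩
    have e : (⟨Energy.pos h k (a + b).1, hm⟩ : h.domain) =
        ⟨Energy.pos h k a.1, ha'⟩ + ⟨Energy.pos h k b.1, hb'⟩ := Subtype.ext (by simp)
    rw [e, LinearPMap.map_add]
    simp only [Prod.fst_add, Prod.snd_add, map_add, ha'', hb'', smul_add]
    abel
  smul_mem' := by
    rintro c a ⟨ha, ha', ha''⟩
    have hm : Energy.pos h k (c • a).1 ∈ h.domain := by
      simpa using h.domain.smul_mem c ha'
    refine ⟨by simp [ha], hm, ?_⟩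
    have e : (⟨Energy.pos h k (c • a).1, hm⟩ : h.domain) =
        c • ⟨Energy.pos h k a.1, ha'⟩ := Subtype.ext (by simp)
    rw [e, LinearPMap.map_smul]
    simp only [Prod.smul_fst, Prod.smul_snd, map_smul, ha'', smul_add, smul_comm c (2 : ℂ)]

/-- The inhomogeneous energy Klein-Gordon operator. -/
def kgOp (h : H →ₗ.[ℂ] H) (k : H →L[ℂ] H) : Energy h k →ₗ.[ℂ] Energy h k :=
  (kgGraph h k).toLinearPMap

/-- The graph of the operator induced on the homogeneous energy space by the matrix with rows
`(0, 1)` and `(h, 2k)`.  With `v₀ = u₀`, `v₁ = u₁ - k u₀` (and `v'` likewise), the two equations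
`u'₀ = u₁` and `u'₁ = h u₀ + 2 k u₁` read `v'₀ = k v₀ + v₁` and `v'₁ = h₀ v₀ + k v₁`.  The first is
tested against `h₀^{1/2} φ`, the second against `φ`, for all `φ` in `D(h₀^{1/2})`; here
`(h₀^{1/2} φ | v₀)` means `(φ | h₀^{1/2} v₀)`, and `k v₀` is the extension of `k` to `h₀^{-1/2} H`. -/
def homKgGraph (h : H →ₗ.[ℂ] H) (k : H →L[ℂ] H) :
    Submodule ℂ (HomEnergy h k × HomEnergy h k) where
  carrier := {q | ∀ φ : (sqrtOp (hZero h k)).domain,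
    ⟪(φ : H), HomEnergy.root h k q.2⟫_ℂ =
        ⟪(φ : H), homExt (hZero h k) k (HomEnergy.root h k q.1)⟫_ℂ +
          ⟪sqrtOp (hZero h k) φ, HomEnergy.cov h k q.1⟫_ℂ ∧
    ⟪(φ : H), HomEnergy.cov h k q.2⟫_ℂ =
        ⟪sqrtOp (hZero h k) φ, HomEnergy.root h k q.1⟫_ℂ +
          ⟪(φ : H), k (HomEnergy.cov h k q.1)⟫_ℂ}
  zero_mem' := by intro φ; simp
  add_mem' := by
    intro a b ha hb φ
    obtain ⟨ha1, ha2⟩ := ha φ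
    obtain ⟨hb1, hb2⟩ := hb φ
    constructor
    · simp only [Prod.fst_add, Prod.snd_add, map_add, inner_add_right, ha1, hb1]; ring
    · simp only [Prod.fst_add, Prod.snd_add, map_add, inner_add_right, ha2, hb2]; ring
  smul_mem' := by
    intro c a ha φ
    obtain ⟨ha1, ha2⟩ := ha φ
    constructor
    · simp only [Prod.smul_fst, Prod.smul_snd, map_smul, inner_smul_right, ha1]; ring
    · simp only [Prod.smul_fst, Prod.smul_snd, map_smul, inner_smul_right, ha2]; ring

/-- The homogeneous energy Klein-Gordon operator. -/
def homKgOp (h : H →ₗ.[ℂ] H) (k : H →L[ℂ] H) : HomEnergy h k →ₗ.[ℂ] HomEnergy h k :=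
  (homKgGraph h k).toLinearPMap

/-! ### Hypotheses -/

/-- Regularity of `k` with respect to the homogeneous `h₀`-scale. -/
structure RegularCharge (h : H →ₗ.[ℂ] H) (k : H →L[ℂ] H) : Prop where
  bounded : ∃ C, HomBound (hZero h k) k C
  resolvent_bounded : ∀ z : ℂ, z.im ≠ 0 → ∃ C,
    HomBound (hZero h k) (Ring.inverse (k - algebraMap ℂ (H →L[ℂ] H) z)) C
  near_axis : ∃ (n : ℕ) (C : ℝ), 0 < n ∧ ∀ z : ℂ, z.im ≠ 0 → |z.im| ≤ 1 →
    HomBound (hZero h k) (Ring.inverse (k - algebraMap ℂ (H →L[ℂ] H) z)) (C * (|z.im| ^ n)⁻¹)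
  far : ∃ m C : ℝ, 0 < m ∧ ∀ z : ℂ, m * ‖k‖ ≤ ‖z‖ → ‖k‖ < ‖z‖ →
    HomBound (hZero h k) (Ring.inverse (k - algebraMap ℂ (H →L[ℂ] H) z)) (C * (‖z‖ - ‖k‖)⁻¹)

/-- The positivity condition `S ≥ c κ²` for some `c > 0`. -/
def DominatesSq (S : H →ₗ.[ℂ] H) (κ : H →L[ℂ] H) : Prop :=
  ∃ c : ℝ, 0 < c ∧ ∀ u : S.domain, c * ‖κ (u : H)‖ ^ 2 ≤ (⟪(u : H), S u⟫_ℂ).re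

/-- The bounded operator `w(x)^{-a}`, for `a > 0`. -/
def weight (x : H →ₗ.[ℂ] H) (w : ℝ → ℝ) (a : ℝ) : H →L[ℂ] H := bddFun x (fun t => (w t) ^ (-a))

/-- `w B w` is bounded on `H`, for `w = w(x)` and `B` bounded. -/
def SandwichBounded (x : H →ₗ.[ℂ] H) (w : ℝ → ℝ) (B : H →L[ℂ] H) : Prop :=
  ∃ T : H →L[ℂ] H, B = weight x w 1 * T * weight x w 1

/-- The Hardy type inequality `‖w^{-ε} u‖ ≲ ‖S^{1/2} u‖` for all `ε > 0`. -/
def HardyBound (S x : H →ₗ.[ℂ] H) (w : ℝ → ℝ) : Prop :=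
  ∀ ε : ℝ, 0 < ε → ∃ C : ℝ, ∀ u : (sqrtOp S).domain,
    ‖weight x w ε (u : H)‖ ≤ C * ‖sqrtOp S u‖

/-- Compatibility of the triple `(S, κ, w)`, where `w = w(x)`. Boundedness of
`S^{-1/2} [S, w^{-ε}] w^{ε/2}` is expressed for the form of the commutator on `D(S)`. -/
structure WeightCompatible (S : H →ₗ.[ℂ] H) (κ : H →L[ℂ] H) (x : H →ₗ.[ℂ] H) (w : ℝ → ℝ) :
    Prop where
  sandwich : SandwichBounded x w κ
  commutes : Commute κ (weight x w 1)
  commutator : ∀ ε : ℝ, 0 < ε → ε ≤ 1 → ∃ C : ℝ, ∀ (v y : S.domain)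
    (v' : (sqrtOp S).domain), (v' : H) = v →
    ‖commForm S (weight x w ε) v y‖ ≤ C * ‖sqrtOp S v'‖ * ‖weight x w (ε / 2) (y : H)‖
  hardy : HardyBound S x w
  compact : IsCompactOperator (weight x w 1 * japaneseInv S)

/-- For every `ε > 0` the weighted resolvent `w^{-ε} (S - z²)⁻¹ w^{-ε}` extends from `Im z > 0` to
some half plane `Im z > -δ`, `δ > 0`, as a finite meromorphic function with compact values. -/
def WeightedResolventExtends (S x : H →ₗ.[ℂ] H) (w : ℝ → ℝ) : Prop :=
  ∀ ε : ℝ, 0 < ε → ∃ δ : ℝ, 0 < δ ∧ ∃ F : ℂ → H →L[ℂ] H,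
    FinMeroOn F {z | -δ < z.im} ∧ (∀ z : ℂ, -δ < z.im → IsCompactOperator (F z)) ∧
    ∀ z : ℂ, 0 < z.im → F z = weight x w ε * resolventOp S (z ^ 2) * weight x w ε

/-- `χ` is smooth and bounded together with all its derivatives. -/
def SmoothBounded (χ : ℝ → ℝ) : Prop :=
  ContDiff ℝ ∞ χ ∧ ∀ n : ℕ, ∃ C : ℝ, ∀ t, |iteratedDeriv n χ t| ≤ C

/-- `S` is local in `x`: `χ₁(x) S χ₂(x) = 0` whenever `χ₁`, `χ₂` have disjoint supports. -/
def IsLocal (S x : H →ₗ.[ℂ] H) : Prop :=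
  ∀ χ₁ χ₂ : ℝ → ℝ, SmoothBounded χ₁ → SmoothBounded χ₂ →
    Disjoint (tsupport χ₁) (tsupport χ₂) → ∀ (u : H) (hu : bddFun x χ₂ u ∈ S.domain),
      bddFun x χ₁ (S ⟨bddFun x χ₂ u, hu⟩) = 0

/-- The position operator `x`: selfadjoint, `σ(x) = σ_ac(x) = ℝ`, `[x, k] = 0`, `h₀` is local in
`x`, and `w(x)` is a smooth positive function of `x` with bounded inverse. -/
structure PositionOperator (h : H →ₗ.[ℂ] H) (k : H →L[ℂ] H) (x : H →ₗ.[ℂ] H) (w : ℝ → ℝ) :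
    Prop where
  selfAdjoint : IsSelfAdjoint x
  spectrum_eq : opSpectrum x = Set.range (fun s : ℝ => (s : ℂ))
  acSpectrum_eq : acSpectrum x = Set.univ
  commutes : ∀ u : x.domain, ∃ hu : k (u : H) ∈ x.domain, x ⟨k (u : H), hu⟩ = k (x u)
  weight_smooth : ContDiff ℝ ∞ w
  weight_pos : ∃ c : ℝ, 0 < c ∧ ∀ t, c ≤ w t
  isLocal : IsLocal (hZero h k) x

/-- The cutoff functions. -/
structure IsCutoffTriple (χm χp χt : ℝ → ℝ) : Prop where
  smooth_m : ContDiff ℝ ∞ χm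
  smooth_p : ContDiff ℝ ∞ χp
  smooth_t : ContDiff ℝ ∞ χt
  sq_add_sq : ∀ t, χp t ^ 2 + χm t ^ 2 = 1
  mem_m : ∀ t, χm t ∈ Set.Icc (0 : ℝ) 1
  mem_p : ∀ t, χp t ∈ Set.Icc (0 : ℝ) 1
  supp_m : tsupport χm ⊆ Set.Iio 1
  supp_p : tsupport χp ⊆ Set.Ioi (-1)
  compact_t : HasCompactSupport χt
  supp_t : tsupport χt ⊆ Set.Ioo (-2) 2
  one_t : ∀ t ∈ Set.Icc (-1 : ℝ) 1, χt t = 1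

/-- `χ(x / R + a)`. -/
def cut (x : H →ₗ.[ℂ] H) (χ : ℝ → ℝ) (R a : ℝ) : H →L[ℂ] H := bddFun x (fun t => χ (t / R + a))

/-- `k₊ = k - ℓ j₋²` with `j₋ = χ₋(x / R + 3)`. -/
def kPlus (k : H →L[ℂ] H) (x : H →ₗ.[ℂ] H) (χm : ℝ → ℝ) (ℓ R : ℝ) : H →L[ℂ] H :=
  k - (ℓ : ℂ) • (cut x χm R 3 * cut x χm R 3)

/-- `k₋ = k + ℓ j₊²` with `j₊ = χ₊(x / R - 3)`. -/
def kMinus (k : H →L[ℂ] H) (x : H →ₗ.[ℂ] H) (χp : ℝ → ℝ) (ℓ R : ℝ) : H →L[ℂ] H :=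
  k + (ℓ : ℂ) • (cut x χp R (-3) * cut x χp R (-3))

/-- `k₋ - ℓ`. -/
def kMinusShift (k : H →L[ℂ] H) (x : H →ₗ.[ℂ] H) (χp : ℝ → ℝ) (ℓ R : ℝ) : H →L[ℂ] H :=
  kMinus k x χp ℓ R - (ℓ : ℂ) • (1 : H →L[ℂ] H)

/-- `h₊ = h₀ - k₊²`. -/
def hPlus (h : H →ₗ.[ℂ] H) (k : H →L[ℂ] H) (x : H →ₗ.[ℂ] H) (χm : ℝ → ℝ) (ℓ R : ℝ) :
    H →ₗ.[ℂ] H :=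
  perturb (hZero h k) (-(kPlus k x χm ℓ R * kPlus k x χm ℓ R))

/-- `h̃₋ = h₀ - (k₋ - ℓ)²`. -/
def hMinus (h : H →ₗ.[ℂ] H) (k : H →L[ℂ] H) (x : H →ₗ.[ℂ] H) (χp : ℝ → ℝ) (ℓ R : ℝ) :
    H →ₗ.[ℂ] H :=
  perturb (hZero h k) (-(kMinusShift k x χp ℓ R * kMinusShift k x χp ℓ R))

/-- The operators `w [h, B] w S^{-1/2}` and `[h, B] S^{-1/2}` are bounded on `H`, the commutator
being understood as a form on `D(h)`. -/
def CommutatorBounded (h : H →ₗ.[ℂ] H) (B : H →L[ℂ] H) (S x : H →ₗ.[ℂ] H) (w : ℝ → ℝ) : Prop :=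
  (∃ C : ℝ, ∀ (y s : h.domain) (s' : (sqrtOp S).domain), (s' : H) = weight x w 1 (s : H) →
    ‖commForm h B y s‖ ≤ C * ‖weight x w 1 (y : H)‖ * ‖sqrtOp S s'‖) ∧
  ∃ C : ℝ, ∀ (y s : h.domain) (s' : (sqrtOp S).domain), (s' : H) = s →
    ‖commForm h B y s‖ ≤ C * ‖(y : H)‖ * ‖sqrtOp S s'‖

/-- `[h, B] = T [h, B] T`, the commutator being understood as a form on `D(h)`. -/
def CommutatorLocalized (h : H →ₗ.[ℂ] H) (B T : H →L[ℂ] H) : Prop :=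
  ∀ (y s Ty Ts : h.domain), (Ty : H) = T y → (Ts : H) = T s →
    commForm h B y s = commForm h B Ty Ts

/-- The hypotheses on the two ends, for the gauge parameter `ℓ` and the scale `R`; here
`i₊ = χ₊(x / R)`, `i₋ = χ₋(x / R)`. -/
structure TwoEnds (h : H →ₗ.[ℂ] H) (k : H →L[ℂ] H) (x : H →ₗ.[ℂ] H) (w χm χp χt : ℝ → ℝ)
    (ℓ R : ℝ) : Prop where
  dominates_plus : DominatesSq (hPlus h k x χm ℓ R) (kPlus k x χm ℓ R)
  dominates_minus : DominatesSq (hMinus h k x χp ℓ R) (kMinusShift k x χp ℓ R)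
  decay_plus : SandwichBounded x w (cut x χp R 0 * k * cut x χp R 0)
  decay_minus : SandwichBounded x w
    (cut x χm R 0 * (k - (ℓ : ℂ) • (1 : H →L[ℂ] H)) * cut x χm R 0)
  localized_plus : CommutatorLocalized h (cut x χp R 0) (cut x χt R 0)
  localized_minus : CommutatorLocalized h (cut x χm R 0) (cut x χt R 0)
  compatible_plus : WeightCompatible (hPlus h k x χm ℓ R) (kPlus k x χm ℓ R) x w
  compatible_minus : WeightCompatible (hMinus h k x χp ℓ R) (kMinusShift k x χp ℓ R) x w
  extends_plus : WeightedResolventExtends (hPlus h k x χm ℓ R) x w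
  extends_minus : WeightedResolventExtends (hMinus h k x χp ℓ R) x w
  hom_plus : ∃ C, HomBound (hPlus h k x χm ℓ R) (cut x χp R 0) C
  hom_minus : ∃ C, HomBound (hMinus h k x χp ℓ R) (cut x χm R 0) C
  hom_zero_plus : ∃ C, HomBound (hZero h k) (cut x χp R 0) C
  hom_zero_minus : ∃ C, HomBound (hZero h k) (cut x χm R 0) C
  comm_plus : CommutatorBounded h (cut x χp R 0) (hPlus h k x χm ℓ R) x w
  comm_minus : CommutatorBounded h (cut x χm R 0) (hMinus h k x χp ℓ R) x w
  comm_zero_plus : CommutatorBounded h (cut x χp R 0) (hZero h k) x w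
  comm_zero_minus : CommutatorBounded h (cut x χm R 0) (hZero h k) x w
  /-- `h₀^{-1/2} [w⁻¹, h₀] w^{1/2}` is bounded on `H`. -/
  comm_weight : ∃ C : ℝ, ∀ (v y : (hZero h k).domain) (v' : (sqrtOp (hZero h k)).domain),
    (v' : H) = v → ‖commForm (hZero h k) (weight x w 1) v y‖ ≤
      C * ‖sqrtOp (hZero h k) v'‖ * ‖weight x w (1 / 2) (y : H)‖
  hardy_zero : HardyBound (hZero h k) x w

end Hilbert

end KG

end

open KG

noncomputable section

namespace KG

/-! ### Finite meromorphic operator valued functions -/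

section FinMero

variable {X Y Y' : Type*} [NormedAddCommGroup X] [NormedSpace ℂ X]
  [NormedAddCommGroup Y] [NormedSpace ℂ Y] [NormedAddCommGroup Y'] [NormedSpace ℂ Y']

/-! Everything is reduced to the quadratic pencil `h₀ - (k - z)² = h + 2zk - z²`. With `L = (1 +
h₀)^{-1/2}` and `C = h₀^{1/2} L`, multiplication by `L` on both sides turns it into the bounded
family `pencil`, a polynomial in `z`. Its kernel parametrizes the eigenvectors of `H`
(`mem_pointSpectrum_kgOp_iff`), and both resolvents are explicit in terms of its inverse
(`kgResolvent`, `homResolvent`). For the homogeneous operator the extension of `(k - z)⁻¹` to the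
homogeneous space enters as well; assumption (A2) makes it bounded.

Meromorphy off the real axis comes from a parametrix. Let `ℓ₊ = 0`, `ℓ₋ = ℓ`. On the support of `i±`
the pencil is `S± - (z - ℓ±)² + 2(z - ℓ±)κ±`, so the sum of `i± (S± - (z - ℓ±)²)⁻¹ i±` inverts it
from the right up to a remainder `K` made of the commutators `[h, i±]` and of charge terms
(`EndData.pencil_mul_Q`). Decaying weights make `K` compact, and `K` is small far out on the
imaginary axis. The meromorphic Fredholm theorem `finMero_inverse_one_add` then inverts `1 + K`.
Passing to adjoints at the conjugate point turns the right inverse of the pencil into a two-sided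
one (`finMero_inverse_pencil`). A singular point of an analytic family with meromorphic inverse has
a kernel, so nonreal spectrum consists of eigenvalues.

Finiteness of the nonreal spectrum: an energy identity confines the singular points to `|z| ≤ ‖k‖`,
so it remains to exclude accumulation at real points. With `V = w^{-1/2}` one has `K V = V Kw` for
`Im z > 0` (`EndData.K_mul_V`), where `Kw` involves only weighted resolvents and so continues
meromorphically to `Im z > -δ`. By Fredholm theory `1 + Kw` is invertible off a discrete subset of
that half plane, while every singular point of the pencil in the upper half plane is one of `1 + Kw`
(`not_isUnit_weighted_remainder`, `finite_singular_pencil`).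

Point spectra: a homogeneous eigenvector has coordinates `a = h₀^{1/2} u₀` and `b = u₁ - k u₀`, and
comes from the energy space when `a` lies in the range of `C`. At each end `k - ℓ±` decays, and the
Hardy inequality shows that `(z - ℓ±) i±² u₀` belongs to the inhomogeneous form domain
(`EndData.exists_localized`), which settles `z ≠ 0, ℓ`. If `ℓ = 0`, then `h₊ = h ≥ c k²` excludes
the eigenvalue `0` altogether (`hom_eq_zero_of_dominated`). -/

theorem analyticAt_clm_comp {A : ℂ → Y →L[ℂ] Y'} {B : ℂ → X →L[ℂ] Y} {z₀ : ℂ}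
    (hA : AnalyticAt ℂ A z₀) (hB : AnalyticAt ℂ B z₀) :
    AnalyticAt ℂ (fun z => A z ∘L B z) z₀ :=
  ((ContinuousLinearMap.compL ℂ X Y Y').analyticAt_bilinear (A z₀, B z₀)).comp₂ hA hB

theorem exists_analyticAt_slope {f : ℂ → Y} {z₀ : ℂ} (hf : AnalyticAt ℂ f z₀) :
    ∃ g : ℂ → Y, AnalyticAt ℂ g z₀ ∧ ∀ z, f z = f z₀ + (z - z₀) • g z := by
  refine ⟨dslope f z₀, ?_, fun z => ?_⟩
  · obtain ⟨p, hp⟩ := hf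
    exact hp.has_fpower_series_dslope_fslope.analyticAt
  · rw [sub_smul_dslope]; abel

theorem finiteDimensional_range_zero :
    FiniteDimensional ℂ (LinearMap.range ((0 : X →L[ℂ] Y) : X →ₗ[ℂ] Y)) := by
  have : LinearMap.range ((0 : X →L[ℂ] Y) : X →ₗ[ℂ] Y) = ⊥ := LinearMap.range_zero
  rw [this]
  infer_instance

theorem finiteDimensional_range_ite {p : Prop} [Decidable p] {A : X →L[ℂ] Y}
    (hA : FiniteDimensional ℂ (LinearMap.range (A : X →ₗ[ℂ] Y))) :
    FiniteDimensional ℂ (LinearMap.range ((if p then A else 0 : X →L[ℂ] Y) : X →ₗ[ℂ] Y)) := by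
  rcases ite_eq_or_eq p A 0 with e | e <;> rw [e]
  · exact hA
  · exact finiteDimensional_range_zero

/-- `F` is finite meromorphic at `z₀`, for a function with values in operators between two
spaces. -/
def FinMero (F : ℂ → X →L[ℂ] Y) (z₀ : ℂ) : Prop :=
  ∃ (N : ℕ) (A : ℕ → X →L[ℂ] Y) (G : ℂ → X →L[ℂ] Y),
    (∀ n, FiniteDimensional ℂ (LinearMap.range (A n : X →ₗ[ℂ] Y))) ∧ AnalyticAt ℂ G z₀ ∧
      ∀ᶠ z in 𝓝[≠] z₀, F z = (∑ n ∈ Finset.range N, ((z - z₀) ^ (n + 1))⁻¹ • A n) + G z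

namespace FinMero

variable {F F' : ℂ → X →L[ℂ] Y} {z₀ : ℂ}

theorem congr (hF : FinMero F z₀) (h : ∀ᶠ z in 𝓝[≠] z₀, F' z = F z) : FinMero F' z₀ := by
  obtain ⟨N, A, G, hA, hG, hE⟩ := hF
  refine ⟨N, A, G, hA, hG, ?_⟩
  filter_upwards [h, hE] with z h1 h2
  rw [h1, h2]

theorem of_analyticAt (hF : AnalyticAt ℂ F z₀) : FinMero F z₀ :=
  ⟨0, fun _ => 0, F, fun _ => finiteDimensional_range_zero, hF, by simp⟩

theorem exists_le (hF : FinMero F z₀) : ∃ N₀ : ℕ, ∀ N, N₀ ≤ N →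
    ∃ (A : ℕ → X →L[ℂ] Y) (G : ℂ → X →L[ℂ] Y),
    (∀ n, FiniteDimensional ℂ (LinearMap.range (A n : X →ₗ[ℂ] Y))) ∧ AnalyticAt ℂ G z₀ ∧
      ∀ᶠ z in 𝓝[≠] z₀, F z = (∑ n ∈ Finset.range N, ((z - z₀) ^ (n + 1))⁻¹ • A n) + G z := by
  obtain ⟨N₀, A, G, hA, hG, hE⟩ := hF
  refine ⟨N₀, fun N hN => ⟨fun n => if n < N₀ then A n else 0, G, fun n =>
    finiteDimensional_range_ite (hA n), hG, ?_⟩⟩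
  · filter_upwards [hE] with z hz
    rw [hz]
    congr 1
    rw [← Finset.sum_subset (Finset.range_subset_range.2 hN)]
    · refine Finset.sum_congr rfl fun n hn => ?_
      rw [if_pos (Finset.mem_range.1 hn)]
    · intro n _ hn
      rw [if_neg (by simpa using hn), smul_zero]

theorem add (hF : FinMero F z₀) (hF' : FinMero F' z₀) : FinMero (fun z => F z + F' z) z₀ := by
  obtain ⟨N, hN⟩ := hF.exists_le
  obtain ⟨N', hN'⟩ := hF'.exists_le
  obtain ⟨A, G, hA, hG, hE⟩ := hN (max N N') (le_max_left _ _)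
  obtain ⟨A', G', hA', hG', hE'⟩ := hN' (max N N') (le_max_right _ _)
  refine ⟨max N N', fun n => A n + A' n, fun z => G z + G' z, fun n => ?_, hG.add hG', ?_⟩
  · have := hA n
    have := hA' n
    refine Submodule.finiteDimensional_of_le (S₂ := LinearMap.range (A n : X →ₗ[ℂ] Y) ⊔
      LinearMap.range (A' n : X →ₗ[ℂ] Y)) ?_
    rintro _ ⟨x, rfl⟩
    exact Submodule.add_mem_sup ⟨x, rfl⟩ ⟨x, rfl⟩
  · filter_upwards [hE, hE'] with z h1 h2
    rw [h1, h2]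
    simp only [smul_add, Finset.sum_add_distrib]
    abel

theorem sum {ι : Type*} (s : Finset ι) {F : ι → ℂ → X →L[ℂ] Y}
    (hF : ∀ i ∈ s, FinMero (F i) z₀) : FinMero (fun z => ∑ i ∈ s, F i z) z₀ := by
  classical
  induction s using Finset.induction_on with
  | empty => simpa using of_analyticAt (F := fun _ => (0 : X →L[ℂ] Y)) analyticAt_const
  | insert i s hi ih =>
    simp only [Finset.sum_insert hi]
    exact (hF i (by simp)).add (ih fun j hj => hF j (by simp [hj]))

/-- Products through a finite dimensional space, divided by a power of `z - z₀`. -/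
theorem of_factor {V : Type*} [NormedAddCommGroup V] [NormedSpace ℂ V] [FiniteDimensional ℂ V]
    (N : ℕ) {A : ℂ → V →L[ℂ] Y} {B : ℂ → X →L[ℂ] V} (hA : AnalyticAt ℂ A z₀)
    (hB : AnalyticAt ℂ B z₀) : FinMero (fun z => ((z - z₀) ^ N)⁻¹ • (A z ∘L B z)) z₀ := by
  -- With `A = A(z₀) + (z - z₀) A'` and likewise for `B`, the product is `(z - z₀)(A' B + A(z₀) B')
  -- + A(z₀) B(z₀)`: two terms whose pole has lower order, and one constant coefficient of finite
  -- rank. The factors change in the recursion, hence the generalization.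
  induction N generalizing A B with
  | zero => simpa using of_analyticAt (analyticAt_clm_comp hA hB)
  | succ N ih =>
    obtain ⟨A', hA', eA⟩ := exists_analyticAt_slope hA
    obtain ⟨B', hB', eB⟩ := exists_analyticAt_slope hB
    have h1 := ih hA' hB
    have h2 := ih (A := fun _ => A z₀) analyticAt_const hB'
    have h3 : FinMero (fun z => ((z - z₀) ^ (N + 1))⁻¹ • (A z₀ ∘L B z₀)) z₀ := by
      refine ⟨N + 1, fun n => if n = N then A z₀ ∘L B z₀ else 0, 0, fun n => ?_,
        analyticAt_const, ?_⟩
      · refine finiteDimensional_range_ite ?_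
        refine Submodule.finiteDimensional_of_le
          (S₂ := LinearMap.range (A z₀ : V →ₗ[ℂ] Y)) ?_
        rintro _ ⟨x, rfl⟩
        exact ⟨B z₀ x, rfl⟩
      · refine Eventually.of_forall fun z => ?_
        rw [Finset.sum_eq_single N] <;> simp +contextual
    refine ((h1.add h2).add h3).congr ?_
    filter_upwards [self_mem_nhdsWithin] with z hz
    have hz' : z - z₀ ≠ 0 := sub_ne_zero.2 hz
    have e : A z ∘L B z = (z - z₀) • (A' z ∘L B z) + ((z - z₀) • (A z₀ ∘L B' z)
        + A z₀ ∘L B z₀) := by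
      ext x
      have h1 : A z (B z x) = A z₀ (B z x) + (z - z₀) • A' z (B z x) := by
        conv_lhs => rw [eA z]
        simp
      have h2 : A z₀ (B z x) = A z₀ (B z₀ x) + (z - z₀) • A z₀ (B' z x) := by
        conv_lhs => rw [eB z]
        simp
      simp only [add_apply, smul_apply,
        ContinuousLinearMap.comp_apply, h1, h2]
      abel
    have e' : ((z - z₀) ^ (N + 1))⁻¹ * (z - z₀) = ((z - z₀) ^ N)⁻¹ := by
      rw [pow_succ, mul_inv, mul_assoc, inv_mul_cancel₀ hz', mul_one]
    rw [e, smul_add, smul_add, smul_smul, smul_smul, e', add_assoc]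

/-- A product of a holomorphic family with a principal coefficient is no longer constant. Factoring
the coefficient through its finite dimensional range puts the term in the form of `of_factor`, which
re-expands it with coefficients of finite rank. -/
theorem clm_comp {L : ℂ → Y →L[ℂ] Y'} (hL : AnalyticAt ℂ L z₀) (hF : FinMero F z₀) :
    FinMero (fun z => L z ∘L F z) z₀ := by
  obtain ⟨N, A, G, hA, hG, hE⟩ := hF
  refine FinMero.congr (F := fun z => (∑ n ∈ Finset.range N,
    ((z - z₀) ^ (n + 1))⁻¹ • ((L z ∘L (LinearMap.range (A n : X →ₗ[ℂ] Y)).subtypeL) ∘L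
      (A n).codRestrict (LinearMap.range (A n : X →ₗ[ℂ] Y)) fun x => ⟨x, rfl⟩)) + L z ∘L G z)
    ?_ ?_
  · refine (FinMero.sum _ fun n _ => ?_).add (of_analyticAt (analyticAt_clm_comp hL hG))
    have := hA n
    exact of_factor (n + 1) (analyticAt_clm_comp hL analyticAt_const) analyticAt_const
  · filter_upwards [hE] with z hz
    rw [hz]
    ext x
    simp only [ContinuousLinearMap.comp_apply, add_apply, map_add,
      sum_apply, map_sum, smul_apply, map_smul]
    rfl

theorem comp_clm {X' : Type*} [NormedAddCommGroup X'] [NormedSpace ℂ X']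
    {L : ℂ → X' →L[ℂ] X} (hL : AnalyticAt ℂ L z₀) (hF : FinMero F z₀) :
    FinMero (fun z => F z ∘L L z) z₀ := by
  obtain ⟨N, A, G, hA, hG, hE⟩ := hF
  refine FinMero.congr (F := fun z => (∑ n ∈ Finset.range N,
    ((z - z₀) ^ (n + 1))⁻¹ • ((LinearMap.range (A n : X →ₗ[ℂ] Y)).subtypeL ∘L
      ((A n).codRestrict (LinearMap.range (A n : X →ₗ[ℂ] Y)) (fun x => ⟨x, rfl⟩) ∘L L z)))
        + G z ∘L L z) ?_ ?_
  · refine (FinMero.sum _ fun n _ => ?_).add (of_analyticAt (analyticAt_clm_comp hG hL))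
    have := hA n
    exact of_factor (n + 1) analyticAt_const (analyticAt_clm_comp analyticAt_const hL)
  · filter_upwards [hE] with z hz
    rw [hz]
    ext x
    simp

theorem meromorphicAt (hF : FinMero F z₀) : MeromorphicAt F z₀ := by
  obtain ⟨N, A, G, hA, hG, hE⟩ := hF
  have h1 : MeromorphicAt (fun z => (∑ n ∈ Finset.range N, ((z - z₀) ^ (n + 1))⁻¹ • A n) + G z)
      z₀ := by
    refine MeromorphicAt.add (f := fun z => ∑ n ∈ Finset.range N, ((z - z₀) ^ (n + 1))⁻¹ • A n)
      (MeromorphicAt.fun_sum fun n _ => ?_) hG.meromorphicAt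
    exact MeromorphicAt.smul (f := fun z => ((z - z₀) ^ (n + 1))⁻¹) (g := fun _ => A n)
      (by fun_prop) (MeromorphicAt.const _ _)
  exact h1.congr (by filter_upwards [hE] with z hz using hz.symm)

/-- Translation in the variable. -/
theorem comp_sub {a : ℂ} (hF : FinMero F (z₀ - a)) : FinMero (fun z => F (z - a)) z₀ := by
  obtain ⟨N, A, G, hA, hG, hE⟩ := hF
  refine ⟨N, A, fun z => G (z - a), hA, hG.comp_of_eq (by fun_prop) rfl, ?_⟩
  have ht : Tendsto (fun z : ℂ => z - a) (𝓝[≠] z₀) (𝓝[≠] (z₀ - a)) := by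
    refine tendsto_nhdsWithin_of_tendsto_nhds_of_eventually_within _ ?_ ?_
    · exact (Continuous.tendsto (by fun_prop) z₀).mono_left nhdsWithin_le_nhds
    · filter_upwards [self_mem_nhdsWithin] with z hz
      simpa using hz
  filter_upwards [ht.eventually hE] with z hz
  rw [hz]
  simp

end FinMero

end FinMero

/-! ### Fredholm theory of finite meromorphic families -/

section Fredholm

theorem ringInverse_eq {M : Type*} [MonoidWithZero M] {x y : M} (h1 : x * y = 1)
    (h2 : y * x = 1) : Ring.inverse x = y :=
  Ring.inverse_unit ⟨x, y, h1, h2⟩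

theorem isUnit_smul_iff_of_ne_zero {R : Type*} [Ring R] [Algebra ℂ R] {c : ℂ} (hc : c ≠ 0)
    {a : R} : IsUnit (c • a) ↔ IsUnit a :=
  isUnit_smul_iff (Units.mk0 c hc) a

/-- The formula `(1 + ab)⁻¹ = 1 - a (1 + ba)⁻¹ b` moves the inversion to `V`, which will be finite
dimensional. -/
theorem isUnit_one_add_swap {V X : Type*} [NormedAddCommGroup V] [NormedSpace ℂ V]
    [NormedAddCommGroup X] [NormedSpace ℂ X] (a : V →L[ℂ] X) (b : X →L[ℂ] V)
    (h : IsUnit (1 + b ∘L a : V →L[ℂ] V)) :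
    IsUnit (1 + a ∘L b : X →L[ℂ] X) ∧ Ring.inverse (1 + a ∘L b : X →L[ℂ] X) =
      1 - a ∘L Ring.inverse (1 + b ∘L a : V →L[ℂ] V) ∘L b := by
  set m : V →L[ℂ] V := 1 + b ∘L a with hm
  have h1 : m * Ring.inverse m = 1 := Ring.mul_inverse_cancel m h
  have h2 : Ring.inverse m * m = 1 := Ring.inverse_mul_cancel m h
  set n := Ring.inverse m
  have h1' : ∀ v, n v + b (a (n v)) = v := fun v => by
    simpa [hm] using DFunLike.congr_fun h1 v
  have h2' : ∀ v, n v + n (b (a v)) = v := fun v => by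
    simpa [hm] using DFunLike.congr_fun h2 v
  have e1 : (1 + a ∘L b : X →L[ℂ] X) * (1 - a ∘L n ∘L b) = 1 := by
    ext x
    have := congrArg a (h1' (b x))
    simp only [map_add] at this
    change x - a (n (b x)) + a (b (x - a (n (b x)))) = x
    simp only [map_sub]
    rw [← this]
    abel
  have e2 : (1 - a ∘L n ∘L b) * (1 + a ∘L b : X →L[ℂ] X) = 1 := by
    ext x
    have := congrArg a (h2' (b x))
    simp only [map_add] at this
    change x + a (b x) - a (n (b (x + a (b x)))) = x
    simp only [map_add]
    rw [this, add_sub_cancel_right]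
  exact ⟨⟨⟨_, _, e1, e2⟩, rfl⟩, Ring.inverse_unit ⟨_, _, e1, e2⟩⟩

theorem isUnit_one_add_swap_iff {V X : Type*} [NormedAddCommGroup V] [NormedSpace ℂ V]
    [NormedAddCommGroup X] [NormedSpace ℂ X] (a : V →L[ℂ] X) (b : X →L[ℂ] V) :
    IsUnit (1 + b ∘L a : V →L[ℂ] V) ↔ IsUnit (1 + a ∘L b : X →L[ℂ] X) :=
  ⟨fun h => (isUnit_one_add_swap a b h).1, fun h => (isUnit_one_add_swap b a h).1⟩

/-- Denominator and numerator of the inverse of an analytic family in finite dimension. -/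
theorem exists_analytic_adjugate {V : Type*} [NormedAddCommGroup V] [NormedSpace ℂ V]
    [FiniteDimensional ℂ V] {m : ℂ → V →L[ℂ] V} {z₀ : ℂ} (hm : AnalyticAt ℂ m z₀) :
    ∃ (d : ℂ → ℂ) (a : ℂ → V →L[ℂ] V), AnalyticAt ℂ d z₀ ∧ AnalyticAt ℂ a z₀ ∧
      (∀ z, m z * a z = d z • 1) ∧ (∀ z, a z * m z = d z • 1) ∧
      ∀ z, IsUnit (m z) ↔ d z ≠ 0 := by
  let b := Module.finBasis ℂ V
  let T : (V →L[ℂ] V) ≃ₐ[ℂ] Matrix (Fin (Module.finrank ℂ V)) (Fin (Module.finrank ℂ V)) ℂ :=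
    (Module.End.toContinuousLinearMap V).symm.trans (LinearMap.toMatrixAlgEquiv b)
  have hT : ∀ i j, AnalyticAt ℂ (fun z => T (m z) i j) z₀ := by
    intro i j
    let φ : (V →L[ℂ] V) →ₗ[ℂ] ℂ := Matrix.entryLinearMap ℂ ℂ i j ∘ₗ T.toLinearMap
    exact (LinearMap.toContinuousLinearMap φ).analyticAt _ |>.comp hm
  have hdet : ∀ M : ℂ → Matrix (Fin (Module.finrank ℂ V)) (Fin (Module.finrank ℂ V)) ℂ,
      (∀ i j, AnalyticAt ℂ (fun z => M z i j) z₀) → AnalyticAt ℂ (fun z => (M z).det) z₀ := by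
    intro M hM
    simp only [Matrix.det_apply]
    refine Finset.analyticAt_fun_sum _ fun σ _ => ?_
    simp only [Units.smul_def, zsmul_eq_mul]
    exact analyticAt_const.mul (Finset.analyticAt_fun_prod _ fun i _ => hM _ _)
  have hadj : ∀ i j, AnalyticAt ℂ (fun z => (T (m z)).adjugate i j) z₀ := by
    intro i j
    simp only [Matrix.adjugate_apply]
    refine hdet _ fun i' j' => ?_
    by_cases hi : i' = j
    · subst hi
      simp only [Matrix.updateRow_self]
      exact analyticAt_const
    · simp only [Matrix.updateRow_ne hi]
      exact hT i' j'
  refine ⟨fun z => (T (m z)).det, fun z => T.symm (T (m z)).adjugate, hdet _ hT, ?_, ?_, ?_, ?_⟩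
  · have e : (fun z => T.symm (T (m z)).adjugate) = fun z => ∑ i, ∑ j,
        (T (m z)).adjugate i j • T.symm (Matrix.single i j 1) := by
      funext z
      conv_lhs => rw [Matrix.matrix_eq_sum_single (T (m z)).adjugate]
      simp only [map_sum]
      refine Finset.sum_congr rfl fun i _ => Finset.sum_congr rfl fun j _ => ?_
      rw [← map_smul, Matrix.smul_single, smul_eq_mul, mul_one]
    rw [e]
    exact Finset.analyticAt_fun_sum _ fun i _ => Finset.analyticAt_fun_sum _ fun j _ =>
      (hadj i j).smul analyticAt_const
  · intro z
    apply T.injective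
    simp [Matrix.mul_adjugate]
  · intro z
    apply T.injective
    simp [Matrix.adjugate_mul]
  · intro z
    rw [← MulEquiv.isUnit_map T, Matrix.isUnit_iff_isUnit_det, isUnit_iff_ne_zero]

/-- Alternative for the inverse of the sum of an invertible holomorphic family and a meromorphic
family which factors through a finite dimensional space. -/
theorem eventually_isUnit_dichotomy {V X : Type*} [NormedAddCommGroup V] [NormedSpace ℂ V]
    [FiniteDimensional ℂ V] [NormedAddCommGroup X] [NormedSpace ℂ X] [CompleteSpace X]
    {E K : ℂ → X →L[ℂ] X} {z₀ : ℂ} (hEan : AnalyticAt ℂ E z₀) (hE₀ : IsUnit (E z₀))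
    (ι : V →L[ℂ] X) {Φ Φ' : ℂ → X →L[ℂ] V} {N : ℕ} (hΦ' : AnalyticAt ℂ Φ' z₀)
    (hΦΦ' : ∀ z, z ≠ z₀ → Φ' z = (z - z₀) ^ N • Φ z)
    (hK : ∀ᶠ z in 𝓝[≠] z₀, K z = E z + ι ∘L Φ z) :
    ((∀ᶠ z in 𝓝[≠] z₀, IsUnit (K z)) ∧ FinMero (fun z => Ring.inverse (K z)) z₀) ∨
      ∀ᶠ z in 𝓝[≠] z₀, ¬ IsUnit (K z) := by
  have hEu : ∀ᶠ z in 𝓝[≠] z₀, IsUnit (E z) :=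
    nhdsWithin_le_nhds (hEan.continuousAt.eventually (Units.isOpen.mem_nhds hE₀))
  let J : ℂ → X →L[ℂ] X := fun z => Ring.inverse (E z)
  have hJ : AnalyticAt ℂ J z₀ := by
    obtain ⟨u, hu⟩ := hE₀
    exact (analyticAt_inverse u).comp_of_eq hEan hu.symm
  -- Since `K = (1 + ι Φ E⁻¹) E`, invertibility of `K` is that of `1 + Φ E⁻¹ ι` on `V`. The factor
  -- `(z - z₀)^N` clears its pole, so the determinant `d` is analytic at `z₀`: near `z₀` it vanishes
  -- identically or has no zero except possibly `z₀`. This is the dichotomy.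
  let m : ℂ → V →L[ℂ] V := fun z => (z - z₀) ^ N • 1 + (Φ' z ∘L J z) ∘L ι
  have hm : AnalyticAt ℂ m z₀ :=
    AnalyticAt.add (AnalyticAt.smul (f := fun z => (z - z₀) ^ N) (by fun_prop) analyticAt_const)
      (analyticAt_clm_comp (analyticAt_clm_comp hΦ' hJ) analyticAt_const)
  have hmΨ : ∀ z, z ≠ z₀ → m z = (z - z₀) ^ N • (1 + (Φ z ∘L J z) ∘L ι) := by
    intro z hz
    simp only [m, hΦΦ' z hz, ContinuousLinearMap.smul_comp, smul_add]
  obtain ⟨d, a, hd, ha, hma, ham, hdu⟩ := exists_analytic_adjugate hm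
  have key : ∀ᶠ z in 𝓝[≠] z₀, z ≠ z₀ ∧ IsUnit (E z) ∧
      K z = (1 + ι ∘L (Φ z ∘L J z)) * E z ∧ (IsUnit (K z) ↔ d z ≠ 0) := by
    filter_upwards [hEu, hK, self_mem_nhdsWithin] with z h1 h2 hz
    have hJE : J z * E z = 1 := Ring.inverse_mul_cancel _ h1
    have e : K z = (1 + ι ∘L (Φ z ∘L J z)) * E z := by
      have e1 : (ι ∘L (Φ z ∘L J z)) * E z = ι ∘L Φ z := by
        change (ι ∘L Φ z) * J z * E z = _
        rw [mul_assoc, hJE, mul_one]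
      rw [add_mul, one_mul, e1, h2]
    refine ⟨hz, h1, e, ?_⟩
    obtain ⟨u, hu⟩ := h1
    rw [e, ← hu, Units.isUnit_mul_units, ← isUnit_one_add_swap_iff, ← hdu, hmΨ z hz,
      isUnit_smul_iff_of_ne_zero (pow_ne_zero _ (sub_ne_zero.2 hz))]
  rcases hd.eventually_eq_zero_or_eventually_ne_zero with h0 | h0
  · right
    filter_upwards [key, nhdsWithin_le_nhds h0] with z h1 h2
    rw [h1.2.2.2]
    simpa using h2
  left
  refine ⟨by filter_upwards [key, h0] with z h1 h2; exact h1.2.2.2.2 h2, ?_⟩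
  -- The order `p` of the zero of `d` bounds the order of the pole of the inverse; the residual
  -- factor `e` is invertible near `z₀`.
  obtain ⟨p, e, he, he0, hde⟩ := hd.exists_eventuallyEq_pow_smul_nonzero_iff.2 (fun h =>
    (h0.and (nhdsWithin_le_nhds h)).exists.elim fun z hz => hz.1 hz.2)
  have hfac : FinMero (fun z => ((z - z₀) ^ p)⁻¹ • ((-(J z ∘L ι)) ∘L
      ((e z)⁻¹ • a z ∘L (Φ' z ∘L J z)))) z₀ :=
    FinMero.of_factor p (analyticAt_clm_comp hJ analyticAt_const).neg
      ((he.inv he0).smul (analyticAt_clm_comp ha (analyticAt_clm_comp hΦ' hJ)))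
  refine ((FinMero.of_analyticAt hJ).add hfac).congr ?_
  filter_upwards [key, h0, nhdsWithin_le_nhds hde] with z ⟨hz, h1, h2, h3⟩ h4 h5
  have hz' : (z - z₀) ^ N ≠ 0 := pow_ne_zero _ (sub_ne_zero.2 hz)
  have hmz := hmΨ z hz
  have hΨ : IsUnit (1 + (Φ z ∘L J z) ∘L ι) := by
    rw [← isUnit_smul_iff_of_ne_zero hz', ← hmz, hdu]
    exact h4
  obtain ⟨hu, hinv⟩ := isUnit_one_add_swap ι (Φ z ∘L J z) hΨ
  have hmm : 1 + (Φ z ∘L J z) ∘L ι = ((z - z₀) ^ N)⁻¹ • m z := by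
    rw [hmz, smul_smul, inv_mul_cancel₀ hz', one_smul]
  have hinv2 : Ring.inverse (1 + (Φ z ∘L J z) ∘L ι) = ((z - z₀) ^ N * (d z)⁻¹) • a z := by
    rw [hmm]
    refine ringInverse_eq ?_ ?_
    · rw [smul_mul_smul_comm, hma, smul_smul, ← mul_assoc, inv_mul_cancel₀ hz', one_mul,
        inv_mul_cancel₀ h4, one_smul]
    · have h6 : (z - z₀) ^ N * (d z)⁻¹ * ((z - z₀) ^ N)⁻¹ * d z = 1 := by
        rw [mul_right_comm, inv_mul_cancel_right₀ h4, mul_inv_cancel₀ hz']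
      rw [smul_mul_smul_comm, ham, smul_smul, h6, one_smul]
  have hΦz : (z - z₀) ^ N • Φ z = Φ' z := (hΦΦ' z hz).symm
  have hfin : Ring.inverse (K z) = J z * Ring.inverse (1 + ι ∘L (Φ z ∘L J z)) := by
    rw [h2]
    refine ringInverse_eq ?_ ?_
    · rw [mul_assoc, ← mul_assoc (E z), Ring.mul_inverse_cancel _ h1, one_mul,
        Ring.mul_inverse_cancel _ hu]
    · rw [mul_assoc, ← mul_assoc (Ring.inverse (1 + _)), Ring.inverse_mul_cancel _ hu, one_mul,
        Ring.inverse_mul_cancel _ h1]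
  rw [hfin, hinv, hinv2, ← hΦz, mul_sub, mul_one, sub_eq_add_neg]
  congr 1
  ext x
  change -(J z (ι (((z - z₀) ^ N * (d z)⁻¹) • a z (Φ z (J z x))))) = ((z - z₀) ^ p)⁻¹ •
    -(J z (ι ((e z)⁻¹ • a z ((z - z₀) ^ N • Φ z (J z x)))))
  simp only [h5, map_smul, smul_neg, smul_smul, smul_eq_mul]
  congr 2
  rw [mul_inv]
  ring

variable {H : Type*} [NormedAddCommGroup H] [InnerProductSpace ℂ H]

/-- Approximation of a compact operator by its compressions to a finite dimensional space. -/
theorem exists_finiteDimensional_approx {C : H →L[ℂ] H} (hC : IsCompactOperator C) {ε : ℝ}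
    (hε : 0 < ε) : ∃ V : Submodule ℂ H, FiniteDimensional ℂ V ∧
      ∀ x : H, ‖x‖ ≤ 1 → ∃ v ∈ V, ‖C x - v‖ ≤ ε := by
  obtain ⟨K, hK, hKC⟩ := hC.image_closedBall_subset_compact (𝕜₁ := ℂ) (f := (C : H →ₗ[ℂ] H)) 1
  obtain ⟨t, -, ht, hcov⟩ := hK.finite_cover_balls hε
  refine ⟨Submodule.span ℂ t, FiniteDimensional.span_of_finite ℂ ht, fun x hx => ?_⟩
  have := hcov (hKC ⟨x, by simpa using hx, rfl⟩)
  simp only [Set.mem_iUnion, Metric.mem_ball, exists_prop] at this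
  obtain ⟨v, hv, hd⟩ := this
  exact ⟨v, Submodule.subset_span hv, by rw [← dist_eq_norm]; exact hd.le⟩

theorem norm_sub_starProjection_le {C : H →L[ℂ] H} {ε : ℝ} (hε : 0 ≤ ε) {V : Submodule ℂ H}
    [V.HasOrthogonalProjection] (hV : ∀ x : H, ‖x‖ ≤ 1 → ∃ v ∈ V, ‖C x - v‖ ≤ ε) :
    ‖C - V.starProjection ∘L C‖ ≤ ε := by
  refine ContinuousLinearMap.opNorm_le_of_unit_norm hε fun x hx => ?_
  obtain ⟨v, hv, h⟩ := hV x hx.le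
  have h1 : V.starProjection v = v := Submodule.starProjection_eq_self_iff.2 hv
  have h2 : (C - V.starProjection ∘L C) x = Vᗮ.starProjection (C x - v) := by
    rw [Submodule.starProjection_orthogonal_val]
    simp [h1]
  rw [h2]
  exact (Submodule.norm_starProjection_apply_le _ _).trans h


/-- Up to an operator of norm at most `1/2`, the principal part and the compact value `G z₀` take
values in one finite dimensional space `V`. What remains of `1 + F` is holomorphic and invertible
near `z₀`, so `eventually_isUnit_dichotomy` applies. -/
theorem eventually_isUnit_one_add_dichotomy [CompleteSpace H] {F : ℂ → H →L[ℂ] H} {z₀ : ℂ}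
    (hF : FinMero F z₀) (hc : ∀ᶠ z in 𝓝[≠] z₀, IsCompactOperator (F z)) :
    ((∀ᶠ z in 𝓝[≠] z₀, IsUnit (1 + F z)) ∧ FinMero (fun z => Ring.inverse (1 + F z)) z₀) ∨
      ∀ᶠ z in 𝓝[≠] z₀, ¬ IsUnit (1 + F z) := by
  obtain ⟨N, A, G, hA, hG, hE⟩ := hF
  have hfin : ∀ n, IsCompactOperator (A n) := fun n => by
    have := hA n
    have h1 : IsCompactOperator ((A n).codRestrict (LinearMap.range (A n : H →ₗ[ℂ] H))
        fun x => ⟨x, rfl⟩) := by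
      refine ⟨Metric.closedBall 0 1, isCompact_closedBall _ _, ?_⟩
      exact (ContinuousLinearMap.continuous _).continuousAt.preimage_mem_nhds
        (by rw [map_zero]; exact Metric.closedBall_mem_nhds _ one_pos)
    exact h1.clm_comp (LinearMap.range (A n : H →ₗ[ℂ] H)).subtypeL
  have hsum : ∀ z, IsCompactOperator
      (∑ n ∈ Finset.range N, ((z - z₀) ^ (n + 1))⁻¹ • A n : H →L[ℂ] H) :=
    fun z => (compactOperator (RingHom.id ℂ) H H).sum_mem (t := Finset.range N)
      (f := fun n => ((z - z₀) ^ (n + 1))⁻¹ • A n)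
      (fun n _ => (hfin n).smul ((z - z₀) ^ (n + 1))⁻¹)
  -- `F` says nothing about `G` at `z₀` itself; compactness is inherited as a norm limit of `F`
  -- minus its principal part.
  have hG₀ : IsCompactOperator (G z₀) := by
    refine isCompactOperator_of_tendsto (l := 𝓝[≠] z₀)
      (hG.continuousAt.tendsto.mono_left nhdsWithin_le_nhds) ?_
    filter_upwards [hE, hc] with z h1 h2
    have e : G z = F z - ∑ n ∈ Finset.range N, ((z - z₀) ^ (n + 1))⁻¹ • A n := by
      rw [h1]; abel
    rw [e]
    exact h2.sub (hsum z)
  obtain ⟨V₀, hV₀, hV⟩ := exists_finiteDimensional_approx hG₀ (ε := 1 / 2) (by norm_num)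
  let V : Submodule ℂ H := V₀ ⊔ (Finset.range N).sup fun n => LinearMap.range (A n : H →ₗ[ℂ] H)
  have : FiniteDimensional ℂ V := by
    have : ∀ n, FiniteDimensional ℂ (LinearMap.range (A n : H →ₗ[ℂ] H)) := hA
    infer_instance
  have hAV : ∀ n ∈ Finset.range N, ∀ x, A n x ∈ V := fun n hn x =>
    le_sup_right (a := V₀) (Finset.le_sup (f := fun n => LinearMap.range (A n : H →ₗ[ℂ] H)) hn
      ⟨x, rfl⟩)
  set P : H →L[ℂ] V := V.orthogonalProjectionOnto
  set ι : V →L[ℂ] H := V.subtypeL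
  have hιP : ∀ x ∈ V, ι (P x) = x := fun x hx => Submodule.starProjection_eq_self_iff.2 hx
  have hsmall : ‖G z₀ - ι ∘L P ∘L G z₀‖ ≤ 1 / 2 :=
    norm_sub_starProjection_le (V := V) (by norm_num) fun x hx => by
      obtain ⟨v, hv, h⟩ := hV x hx
      exact ⟨v, le_sup_left (a := V₀) hv, h⟩
  -- the invertible holomorphic part
  let E : ℂ → H →L[ℂ] H := fun z => 1 + (G z - ι ∘L P ∘L G z₀)
  have hEan : AnalyticAt ℂ E z₀ := analyticAt_const.add (hG.sub analyticAt_const)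
  have hE₀ : IsUnit (E z₀) := by
    have h1 : ‖-(G z₀ - ι ∘L P ∘L G z₀)‖ < 1 := by rw [norm_neg]; linarith
    have := isUnit_one_sub_of_norm_lt_one h1
    rwa [sub_neg_eq_add] at this
  -- the singular part, with values in `V`
  let Φ : ℂ → H →L[ℂ] V := fun z =>
    P ∘L (G z₀ + ∑ n ∈ Finset.range N, ((z - z₀) ^ (n + 1))⁻¹ • A n)
  let Φ' : ℂ → H →L[ℂ] V := fun z =>
    P ∘L ((z - z₀) ^ N • G z₀ + ∑ n ∈ Finset.range N, (z - z₀) ^ (N - (n + 1)) • A n)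
  have hΦ' : AnalyticAt ℂ Φ' z₀ := by
    refine analyticAt_clm_comp analyticAt_const ?_
    refine AnalyticAt.add (AnalyticAt.smul (f := fun z => (z - z₀) ^ N) (by fun_prop)
      analyticAt_const) ?_
    exact Finset.analyticAt_fun_sum _ fun n _ =>
      AnalyticAt.smul (f := fun z => (z - z₀) ^ (N - (n + 1))) (by fun_prop) analyticAt_const
  have hΦΦ' : ∀ z, z ≠ z₀ → Φ' z = (z - z₀) ^ N • Φ z := by
    intro z hz
    have hz' : z - z₀ ≠ 0 := sub_ne_zero.2 hz
    change P ∘L _ = (z - z₀) ^ N • (P ∘L _)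
    rw [← ContinuousLinearMap.comp_smul, smul_add, Finset.smul_sum]
    congr 2
    refine Finset.sum_congr rfl fun n hn => ?_
    rw [smul_smul, pow_sub₀ _ hz' (Finset.mem_range.1 hn)]
  have hιΦ : ∀ z, ι ∘L Φ z = ι ∘L P ∘L G z₀ + ∑ n ∈ Finset.range N,
      ((z - z₀) ^ (n + 1))⁻¹ • A n := by
    intro z
    ext x
    obtain ⟨T, hT⟩ : ∃ T : H →L[ℂ] H, T = ∑ n ∈ Finset.range N, ((z - z₀) ^ (n + 1))⁻¹ • A n :=
      ⟨_, rfl⟩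
    have h1 : T x ∈ V := by
      rw [hT, sum_apply]
      exact V.sum_mem fun n hn => V.smul_mem _ (hAV n hn x)
    simp only [Φ, ← hT]
    change ι (P (G z₀ x + T x)) = ι (P (G z₀ x)) + T x
    rw [map_add, map_add, hιP _ h1]
  refine eventually_isUnit_dichotomy hEan hE₀ ι hΦ' hΦΦ' ?_
  filter_upwards [hE] with z hz
  rw [hιΦ, hz]
  simp only [E]
  abel

/-- The meromorphic Fredholm theorem. -/
theorem finMero_inverse_one_add [CompleteSpace H] {F : ℂ → H →L[ℂ] H} {U : Set ℂ}
    (hU : IsOpen U) (hUc : IsPreconnected U) (hF : ∀ z ∈ U, FinMero F z)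
    (hc : ∀ z ∈ U, IsCompactOperator (F z)) {z₁ : ℂ} (hz₁ : z₁ ∈ U)
    (h₁ : ∀ᶠ z in 𝓝[≠] z₁, IsUnit (1 + F z)) : ∀ z₀ ∈ U,
      (∀ᶠ z in 𝓝[≠] z₀, IsUnit (1 + F z)) ∧ FinMero (fun z => Ring.inverse (1 + F z)) z₀ := by
  have hdich := fun z hz => eventually_isUnit_one_add_dichotomy (hF z hz)
    (nhdsWithin_le_nhds ((hU.eventually_mem hz).mono hc))
  -- Each alternative of the dichotomy, holding on a punctured neighbourhood, defines an open set.
  -- The two sets cover `U` and cannot meet, so connectedness propagates invertibility from `z₁` to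
  -- all of `U`.
  have hopen : ∀ p : ℂ → Prop, IsOpen {z | ∀ᶠ ζ in 𝓝[≠] z, p ζ} := by
    intro p
    rw [isOpen_iff_mem_nhds]
    intro z hz
    have h2 : ∀ᶠ ζ in 𝓝[≠] z, ζ ∈ {z | ∀ᶠ ζ in 𝓝[≠] z, p ζ} := by
      filter_upwards [eventually_eventually_nhdsWithin.2 hz, self_mem_nhdsWithin] with ζ h3 h4
      have h5 : 𝓝[≠] z ⊓ 𝓝 ζ ≤ 𝓝[≠] z := inf_le_left
      have h6 : 𝓝[{z}ᶜ] ζ = 𝓝 ζ := isOpen_compl_singleton.nhdsWithin_eq h4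
      rw [h6] at h3
      exact nhdsWithin_le_nhds h3
    rw [eventually_nhdsWithin_iff] at h2
    filter_upwards [h2] with ζ h3
    by_cases h : ζ = z
    · rw [h]; exact hz
    · exact h3 h
  intro z₀ hz₀
  refine (hdich z₀ hz₀).resolve_right fun hbad => ?_
  obtain ⟨z, -, h2, h3⟩ := hUc _ _ (hopen fun ζ => IsUnit (1 + F ζ))
    (hopen fun ζ => ¬ IsUnit (1 + F ζ))
    (fun z hz => (hdich z hz).imp (fun h => h.1) id) ⟨z₁, hz₁, h₁⟩ ⟨z₀, hz₀, hbad⟩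
  obtain ⟨ζ, h4, h5⟩ := (Filter.Eventually.and (f := 𝓝[≠] z) h2 h3).exists
  exact h5 h4

/-- A singular point of an analytic family with meromorphic inverse has a nontrivial kernel. -/
theorem exists_ker_of_meromorphicAt_inverse {X : Type*} [NormedAddCommGroup X] [NormedSpace ℂ X]
    {P : ℂ → X →L[ℂ] X} {z₀ : ℂ}
    (hP : AnalyticAt ℂ P z₀) (hu : ∀ᶠ z in 𝓝[≠] z₀, IsUnit (P z))
    (hm : MeromorphicAt (fun z => Ring.inverse (P z)) z₀) (h₀ : ¬ IsUnit (P z₀)) :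
    ∃ f, f ≠ 0 ∧ P z₀ f = 0 := by
  have hPt : Tendsto P (𝓝[≠] z₀) (𝓝 (P z₀)) := hP.continuousAt.tendsto.mono_left nhdsWithin_le_nhds
  have hnt : Nontrivial (X →L[ℂ] X) := by
    by_contra h
    rw [not_nontrivial_iff_subsingleton] at h
    exact h₀ (isUnit_of_subsingleton _)
  have htop : meromorphicOrderAt (fun z => Ring.inverse (P z)) z₀ ≠ ⊤ := by
    intro h
    rw [meromorphicOrderAt_eq_top_iff] at h
    obtain ⟨z, h1, h2⟩ := (h.and hu).exists
    have := Ring.mul_inverse_cancel _ h2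
    rw [h1, mul_zero] at this
    exact zero_ne_one this
  rw [meromorphicOrderAt_ne_top_iff hm] at htop
  obtain ⟨g, hg, hg0, hE⟩ := htop
  have hgt : Tendsto g (𝓝[≠] z₀) (𝓝 (g z₀)) := hg.continuousAt.tendsto.mono_left nhdsWithin_le_nhds
  -- Without a pole, the inverse has a limit at `z₀` which inverts `P z₀`, contrary to assumption.
  -- With a pole, the leading Laurent coefficient `g z₀ ≠ 0` satisfies `P z₀ * g z₀ = 0`, and its
  -- range provides the kernel vector.
  rcases le_or_gt 0 (meromorphicOrderAt (fun z => Ring.inverse (P z)) z₀).untop₀ with hn | hn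
  · exfalso
    apply h₀
    obtain ⟨n, hn⟩ := Int.eq_ofNat_of_zero_le hn
    rw [hn] at hE
    have hQ : Tendsto (fun z => (z - z₀) ^ n • g z) (𝓝[≠] z₀) (𝓝 ((z₀ - z₀) ^ n • g z₀)) :=
      ((Continuous.tendsto (f := fun z : ℂ => (z - z₀) ^ n) (by fun_prop) z₀).mono_left
        nhdsWithin_le_nhds).smul hgt
    have e1 : P z₀ * ((z₀ - z₀) ^ n • g z₀) = 1 := by
      refine tendsto_nhds_unique (hPt.mul hQ) (tendsto_const_nhds.congr' ?_)
      filter_upwards [hE, hu] with z h1 h2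
      have := Ring.mul_inverse_cancel _ h2
      rw [h1] at this
      simpa using this.symm
    have e2 : ((z₀ - z₀) ^ n • g z₀) * P z₀ = 1 := by
      refine tendsto_nhds_unique (hQ.mul hPt) (tendsto_const_nhds.congr' ?_)
      filter_upwards [hE, hu] with z h1 h2
      have := Ring.inverse_mul_cancel _ h2
      rw [h1] at this
      simpa using this.symm
    exact ⟨⟨_, _, e1, e2⟩, rfl⟩
  · obtain ⟨n, hn'⟩ := Int.eq_negSucc_of_lt_zero hn
    rw [hn'] at hE
    have e1 : P z₀ * g z₀ = 0 := by
      have h0 : Tendsto (fun z : ℂ => (z - z₀) ^ (n + 1) • (1 : X →L[ℂ] X)) (𝓝[≠] z₀) (𝓝 0) := by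
        have : Tendsto (fun z : ℂ => (z - z₀) ^ (n + 1) • (1 : X →L[ℂ] X)) (𝓝 z₀)
            (𝓝 ((z₀ - z₀) ^ (n + 1) • (1 : X →L[ℂ] X))) := Continuous.tendsto (by fun_prop) z₀
        rw [sub_self, zero_pow (Nat.succ_ne_zero n), zero_smul] at this
        exact this.mono_left nhdsWithin_le_nhds
      refine tendsto_nhds_unique (hPt.mul hgt) (h0.congr' ?_)
      filter_upwards [hE, hu, self_mem_nhdsWithin] with z h1 h2 h3
      have h4 : (z - z₀) ^ (n + 1) ≠ 0 := pow_ne_zero _ (sub_ne_zero.2 h3)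
      have h5 : g z = (z - z₀) ^ (n + 1) • Ring.inverse (P z) := by
        rw [h1, zpow_negSucc, smul_smul, mul_inv_cancel₀ h4, one_smul]
      rw [h5, mul_smul_comm, Ring.mul_inverse_cancel _ h2]
    obtain ⟨v, hv⟩ : ∃ v, g z₀ v ≠ 0 := by
      by_contra! h
      exact hg0 (ContinuousLinearMap.ext h)
    exact ⟨g z₀ v, hv, DFunLike.congr_fun e1 v⟩

end Fredholm

/-! ### Factorization and compactness of bounded operators -/

section Operators

variable {H : Type*} [NormedAddCommGroup H] [InnerProductSpace ℂ H]

/-- Factorization of linear maps by domination (Douglas). -/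
theorem exists_factor {D : Type*} [AddCommGroup D] [Module ℂ D] [CompleteSpace H]
    (a : D →ₗ[ℂ] H) (b : D →ₗ[ℂ] H) {c : ℝ} (hc : ∀ u, ‖b u‖ ≤ c * ‖a u‖) :
    ∃ B : H →L[ℂ] H, (∀ u, b u = B (a u)) ∧
      ∀ v, ∃ v' ∈ (LinearMap.range a).topologicalClosure, ‖v'‖ ≤ ‖v‖ ∧ B v = B v' := by
  let V := (LinearMap.range a).topologicalClosure
  have hmem : ∀ u, a u ∈ V := fun u => (LinearMap.range a).le_topologicalClosure ⟨u, rfl⟩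
  let e : D →ₗ[ℂ] V := a.codRestrict V hmem
  have he : DenseRange e := by
    rw [DenseRange, Subtype.dense_iff]
    intro x hx
    refine closure_mono ?_ hx
    rintro _ ⟨u, rfl⟩
    exact ⟨⟨a u, hmem u⟩, ⟨u, rfl⟩, rfl⟩
  have hV : IsClosed (V : Set H) := Submodule.isClosed_topologicalClosure _
  have : CompleteSpace V := hV.completeSpace_coe
  refine ⟨(b.extendOfNorm e) ∘L V.orthogonalProjectionOnto, fun u => ?_, fun v =>
    ⟨V.orthogonalProjectionOnto v, Subtype.property _, ?_, ?_⟩⟩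
  · have h1 : V.orthogonalProjectionOnto (a u) = e u :=
      Submodule.orthogonalProjectionOnto_mem_subspace_eq_self (K := V) ⟨a u, hmem u⟩
    rw [ContinuousLinearMap.comp_apply, h1, LinearMap.extendOfNorm_eq he ⟨c, hc⟩]
  · exact V.norm_orthogonalProjectionOnto_apply_le v
  · rw [ContinuousLinearMap.comp_apply, ContinuousLinearMap.comp_apply,
      Submodule.orthogonalProjectionOnto_mem_subspace_eq_self]

theorem exists_factor_of_dense {D : Type*} [AddCommGroup D] [Module ℂ D] [CompleteSpace H]
    (a : D →ₗ[ℂ] H) (b : D →ₗ[ℂ] H) (ha : DenseRange a) {c : ℝ}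
    (hc : ∀ u, ‖b u‖ ≤ c * ‖a u‖) :
    ∃ B : H →L[ℂ] H, (∀ u, b u = B (a u)) ∧ ∀ v, ‖B v‖ ≤ c * ‖v‖ :=
  ⟨b.extendOfNorm a, fun u => (LinearMap.extendOfNorm_eq ha ⟨c, hc⟩ u).symm,
    LinearMap.norm_extendOfNorm_apply_le ha c hc⟩

variable [CompleteSpace H]

/-- A bounded operator whose form is dominated by `‖A₁ a‖ ‖A₂ b‖` factors as `A₁* B A₂`. -/
theorem exists_factor_form {D A₁ A₂ : H →L[ℂ] H} {c : ℝ}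
    (h : ∀ a b, ‖⟪a, D b⟫_ℂ‖ ≤ c * ‖A₁ a‖ * ‖A₂ b‖) :
    ∃ B : H →L[ℂ] H, D = star A₁ * B * A₂ := by
  -- Testing with `a = D b` bounds `D b` by a multiple of `A₂ b`, whence `D = E A₂` with `E`
  -- determined by the closure of the range of `A₂`. There the form bound reads `‖E* a‖ ≤ |c| ‖A₁
  -- a‖`, and a second factorization, of `E*` through `A₁`, concludes.
  have h1 : ∀ b, ‖D b‖ ≤ (|c| * ‖A₁‖) * ‖A₂ b‖ := fun b => by
    by_cases hb : D b = 0
    · rw [hb, norm_zero]; positivity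
    have h2 := h (D b) b
    rw [inner_self_eq_norm_sq_to_K, norm_pow, RCLike.norm_ofReal, abs_norm] at h2
    have h3 : ‖D b‖ ^ 2 ≤ (|c| * ‖A₁‖ * ‖A₂ b‖) * ‖D b‖ := by
      refine h2.trans ?_
      calc c * ‖A₁ (D b)‖ * ‖A₂ b‖ ≤ |c| * (‖A₁‖ * ‖D b‖) * ‖A₂ b‖ := by
            gcongr
            · exact le_abs_self c
            · exact A₁.le_opNorm _
        _ = _ := by ring
    have h4 : 0 < ‖D b‖ := norm_pos_iff.2 hb
    nlinarith
  obtain ⟨E, hE, hE'⟩ := exists_factor (A₂ : H →ₗ[ℂ] H) (D : H →ₗ[ℂ] H) h1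
  have h2 : ∀ a, ∀ v ∈ (LinearMap.range (A₂ : H →ₗ[ℂ] H)).topologicalClosure,
      ‖⟪a, E v⟫_ℂ‖ ≤ c * ‖A₁ a‖ * ‖v‖ := by
    intro a v hv
    have hcl : IsClosed {v | ‖⟪a, E v⟫_ℂ‖ ≤ c * ‖A₁ a‖ * ‖v‖} :=
      isClosed_le (by fun_prop) (by fun_prop)
    refine closure_minimal ?_ hcl hv
    rintro _ ⟨b, rfl⟩
    have := h a b
    rwa [show D b = E (A₂ b) from hE b] at this
  have h3 : ∀ a, ‖star E a‖ ≤ |c| * ‖A₁ a‖ := by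
    intro a
    by_cases ha : star E a = 0
    · rw [ha, norm_zero]; positivity
    obtain ⟨v, hv, hvn, hvE⟩ := hE' (star E a)
    have h4 := h2 a v hv
    rw [← hvE, ← ContinuousLinearMap.adjoint_inner_left, ← ContinuousLinearMap.star_eq_adjoint,
      inner_self_eq_norm_sq_to_K, norm_pow, RCLike.norm_ofReal, abs_norm] at h4
    have h5 : ‖star E a‖ ^ 2 ≤ (|c| * ‖A₁ a‖) * ‖star E a‖ := by
      refine h4.trans ?_
      gcongr
      exact le_abs_self c
    have h6 : 0 < ‖star E a‖ := norm_pos_iff.2 ha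
    nlinarith
  obtain ⟨B, hB, -⟩ := exists_factor (A₁ : H →ₗ[ℂ] H) (star E : H →L[ℂ] H).toLinearMap h3
  refine ⟨star B, ?_⟩
  have h4 : star E = B * A₁ := ContinuousLinearMap.ext hB
  rw [← star_mul, ← h4, star_star]
  exact ContinuousLinearMap.ext hE

/-- A selfadjoint bounded operator is symmetric. -/
theorem inner_comm_of_selfAdjoint {T : H →L[ℂ] H} (hT : IsSelfAdjoint T) (u v : H) :
    ⟪T u, v⟫_ℂ = ⟪u, T v⟫_ℂ := by
  conv_lhs => rw [← hT.star_eq, ContinuousLinearMap.star_eq_adjoint,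
    ContinuousLinearMap.adjoint_inner_left]

theorem denseRange_of_selfAdjoint_of_injective {T : H →L[ℂ] H} (hT : IsSelfAdjoint T)
    (hi : ∀ u, T u = 0 → u = 0) : DenseRange T := by
  have h1 : (LinearMap.range (T : H →ₗ[ℂ] H)).topologicalClosure = ⊤ := by
    rw [Submodule.topologicalClosure_eq_top_iff, Submodule.eq_bot_iff]
    intro u hu
    refine hi u ?_
    rw [← inner_self_eq_zero (𝕜 := ℂ), inner_comm_of_selfAdjoint hT]
    rw [← inner_eq_zero_symm, inner_comm_of_selfAdjoint hT, ← inner_comm_of_selfAdjoint hT]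
    exact hu _ ⟨_, rfl⟩
  have h2 := congrArg (fun V : Submodule ℂ H => (V : Set H)) h1
  rw [DenseRange, dense_iff_closure_eq]
  exact h2

/-- From `‖T x‖² ≤ ‖T*T x‖ ‖x‖`, and since points of the unit ball are at distance at most `2`, an
`ε²/4`-net for the image of the ball under `T*T` yields an `ε`-net for its image under `T`. -/
theorem isCompactOperator_of_star_mul_self {T : H →L[ℂ] H} (hT : IsCompactOperator (star T * T)) :
    IsCompactOperator T := by
  have key : ∀ x, ‖T x‖ ^ 2 ≤ ‖(star T * T) x‖ * ‖x‖ := by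
    intro x
    have h1 : ⟪(star T * T) x, x⟫_ℂ = ((‖T x‖ : ℂ)) ^ 2 := by
      rw [mul_apply_eq_comp, ContinuousLinearMap.star_eq_adjoint,
        ContinuousLinearMap.adjoint_inner_left, inner_self_eq_norm_sq_to_K]
      rfl
    have h2 := norm_inner_le_norm (𝕜 := ℂ) ((star T * T) x) x
    rwa [h1, norm_pow, Complex.norm_real, norm_norm] at h2
  have h1 := (isCompactOperator_iff_isCompact_closure_image_closedBall
    ((star T * T : H →L[ℂ] H) : H →ₗ[ℂ] H) zero_lt_one).1 hT
  refine (isCompactOperator_iff_isCompact_closure_image_closedBall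
    (T : H →ₗ[ℂ] H) zero_lt_one).2 ?_
  refine TotallyBounded.isCompact_of_isClosed (TotallyBounded.closure ?_) isClosed_closure
  have h2 : TotallyBounded ((star T * T) '' Metric.closedBall 0 1) :=
    h1.totallyBounded.subset subset_closure
  rw [Metric.totallyBounded_iff]
  intro ε hε
  obtain ⟨t, ht1, ht2, ht3⟩ := h2.exists_subset (Metric.dist_mem_uniformity
    (show (0 : ℝ) < ε ^ 2 / 4 by positivity))
  obtain ⟨t', ht', htf, rfl⟩ := Set.exists_subset_image_finite_and.1 ⟨t, ht1, ht2, rfl⟩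
  refine ⟨T '' t', htf.image _, ?_⟩
  rintro _ ⟨x, hx, rfl⟩
  have h3 := ht3 ⟨x, hx, rfl⟩
  simp only [Set.mem_image, Set.mem_iUnion, exists_prop] at h3
  obtain ⟨_, ⟨y, hy, rfl⟩, hxy⟩ := h3
  simp only [Set.mem_iUnion, exists_prop]
  refine ⟨T y, ⟨y, hy, rfl⟩, ?_⟩
  change dist ((star T * T) x) ((star T * T) y) < ε ^ 2 / 4 at hxy
  have hyb := ht' hy
  rw [mem_closedBall_zero_iff] at hx hyb
  have h4 := key (x - y)
  rw [map_sub, map_sub] at h4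
  rw [dist_eq_norm] at hxy
  change dist (T x) (T y) < ε
  rw [dist_eq_norm]
  have h5 : ‖x - y‖ ≤ 2 := (norm_sub_le _ _).trans (by linarith)
  have h6 : ‖T x - T y‖ ^ 2 < ε ^ 2 := by
    refine h4.trans_lt ?_
    have := norm_nonneg (x - y)
    have := norm_nonneg ((star T * T) x - (star T * T) y)
    nlinarith
  exact lt_of_pow_lt_pow_left₀ 2 hε.le h6

end Operators

/-! ### Resolvents of selfadjoint operators -/

section Resolvent

theorem IsResolventAt.unique {X : Type*} [NormedAddCommGroup X] [NormedSpace ℂ X]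
    {A : X →ₗ.[ℂ] X} {z : ℂ} {B B' : X →L[ℂ] X} (h : IsResolventAt A z B)
    (h' : IsResolventAt A z B') : B = B' := by
  ext f
  obtain ⟨hf, e⟩ := h'.1 f
  have := h.2 ⟨B' f, hf⟩
  change B (A ⟨B' f, hf⟩ - z • B' f) = B' f at this
  rw [e] at this
  exact this

theorem IsResolventAt.resolventOp_eq {X : Type*} [NormedAddCommGroup X] [NormedSpace ℂ X]
    {A : X →ₗ.[ℂ] X} {z : ℂ} {B : X →L[ℂ] X} (h : IsResolventAt A z B) :
    resolventOp A z = B := by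
  have hz : ∃ B : X →L[ℂ] X, IsResolventAt A z B := ⟨B, h⟩
  rw [resolventOp, dif_pos hz]
  exact hz.choose_spec.unique h

variable {H : Type*} [NormedAddCommGroup H] [InnerProductSpace ℂ H] [CompleteSpace H]
  {S : H →ₗ.[ℂ] H}

theorem selfAdjoint_symm (hS : IsSelfAdjoint S) (u v : S.domain) :
    ⟪S u, (v : H)⟫_ℂ = ⟪(u : H), S v⟫_ℂ := by
  have h1 := LinearPMap.adjoint_isFormalAdjoint hS.dense_domain (T := S)
  have h2 : S.adjoint = S := hS
  rw [h2] at h1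
  exact h1 u v

theorem selfAdjoint_mem (hS : IsSelfAdjoint S) {y w : H}
    (h : ∀ u : S.domain, ⟪w, (u : H)⟫_ℂ = ⟪y, S u⟫_ℂ) :
    ∃ hy : y ∈ S.domain, S ⟨y, hy⟩ = w := by
  have hy : y ∈ S.adjoint.domain := LinearPMap.mem_adjoint_domain_of_exists y ⟨w, h⟩
  have h1 : S.adjoint ⟨y, hy⟩ = w := LinearPMap.adjoint_apply_eq hS.dense_domain _ h
  have h2 : (y, w) ∈ S.adjoint.graph := (LinearPMap.mem_graph_iff _).2 ⟨⟨y, hy⟩, rfl, h1⟩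
  have h3 : S.adjoint = S := hS
  rw [h3, LinearPMap.mem_graph_iff] at h2
  obtain ⟨⟨y', hy'⟩, rfl, e⟩ := h2
  exact ⟨hy', e⟩

theorem selfAdjoint_lower_bound (hS : IsSelfAdjoint S) (z : ℂ) (u : S.domain) :
    |z.im| * ‖(u : H)‖ ≤ ‖S u - z • (u : H)‖ := by
  by_cases hu : (u : H) = 0
  · rw [hu, norm_zero, mul_zero]; positivity
  have h1 := selfAdjoint_symm hS u u
  have h2 : (⟪(u : H), S u⟫_ℂ).im = 0 := by
    rw [← inner_conj_symm] at h1
    exact Complex.conj_eq_iff_im.1 h1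
  have h3 : (⟪(u : H), S u - z • (u : H)⟫_ℂ).im = -(z.im * ‖(u : H)‖ ^ 2) := by
    rw [inner_sub_right, inner_smul_right, inner_self_eq_norm_sq_to_K, Complex.sub_im, h2,
      zero_sub, neg_inj]
    have e : z * ((‖(u : H)‖ ^ 2 : ℝ) : ℂ) = z * (RCLike.ofReal ‖(u : H)‖ : ℂ) ^ 2 := by
      push_cast
      rfl
    rw [← e, Complex.im_mul_ofReal]
  have h4 := (Complex.abs_im_le_norm _).trans (norm_inner_le_norm (𝕜 := ℂ) (u : H)
    (S u - z • (u : H)))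
  rw [h3, abs_neg, abs_mul, abs_of_nonneg (sq_nonneg ‖(u : H)‖)] at h4
  have h5 : 0 < ‖(u : H)‖ := norm_pos_iff.2 hu
  nlinarith

/-- The graph of `S` is closed, hence complete, and `(u, S u) ↦ S u - z u` is bounded below on it,
so its range is closed. A vector orthogonal to the range lies in the domain and satisfies the
eigenvalue equation at the conjugate of `z`, so it vanishes by the same lower bound. -/
theorem exists_isResolventAt (hS : IsSelfAdjoint S) {z : ℂ} (hz : z.im ≠ 0) :
    ∃ B : H →L[ℂ] H, IsResolventAt S z B := by
  have hz' : 0 < |z.im| := abs_pos.2 hz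
  let G := S.graph
  have hG : IsClosed (G : Set (H × H)) := hS.isClosed
  have : CompleteSpace G := hG.completeSpace_coe
  let φ : G →L[ℂ] H :=
    (ContinuousLinearMap.snd ℂ H H - z • ContinuousLinearMap.fst ℂ H H) ∘L G.subtypeL
  have hφ : ∀ p : G, ∃ u : S.domain, (u : H) = p.1.1 ∧ S u = p.1.2 := fun p =>
    (LinearPMap.mem_graph_iff _).1 p.2
  have hb : ∀ p : G, ‖p‖ ≤ (1 + (1 + ‖z‖) / |z.im|) * ‖φ p‖ := by
    intro p
    obtain ⟨u, hu1, hu2⟩ := hφ p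
    have h1 := selfAdjoint_lower_bound hS z u
    have h2 : φ p = S u - z • (u : H) := by rw [hu1, hu2]; rfl
    rw [← h2] at h1
    have h3 : ‖(u : H)‖ ≤ ‖φ p‖ / |z.im| := by rwa [le_div_iff₀' hz']
    have h4 : ‖S u‖ ≤ ‖φ p‖ + ‖z‖ * ‖(u : H)‖ := by
      have : S u = φ p + z • (u : H) := by rw [h2]; abel
      rw [this, ← norm_smul]
      exact norm_add_le _ _
    have h5 : ‖z‖ * ‖(u : H)‖ ≤ ‖z‖ * (‖φ p‖ / |z.im|) := by gcongr
    have e : (1 + (1 + ‖z‖) / |z.im|) * ‖φ p‖ =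
        ‖φ p‖ + ‖φ p‖ / |z.im| + ‖z‖ * (‖φ p‖ / |z.im|) := by ring
    have h6 : 0 ≤ ‖φ p‖ / |z.im| := by positivity
    have h7 : 0 ≤ ‖z‖ * (‖φ p‖ / |z.im|) := by positivity
    change max ‖p.1.1‖ ‖p.1.2‖ ≤ _
    rw [← hu1, ← hu2, e]
    refine max_le ?_ ?_
    · linarith [norm_nonneg (φ p)]
    · linarith
  have hanti : AntilipschitzWith (Real.toNNReal (1 + (1 + ‖z‖) / |z.im|)) φ := by
    refine AddMonoidHomClass.antilipschitz_of_bound φ fun p => ?_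
    rw [Real.coe_toNNReal _ (by positivity)]
    exact hb p
  have hcl : IsClosed (Set.range φ) := hanti.isClosed_range φ.uniformContinuous
  have hsurj : Function.Surjective φ := by
    have h1 : (LinearMap.range (φ : G →ₗ[ℂ] H))ᗮ = ⊥ := by
      rw [Submodule.eq_bot_iff]
      intro y hy
      have h2 : ∀ u : S.domain, ⟪(starRingEnd ℂ z) • y, (u : H)⟫_ℂ = ⟪y, S u⟫_ℂ := by
        intro u
        have h3 : ⟪φ ⟨(u, S u), S.mem_graph u⟩, y⟫_ℂ = 0 := hy _ ⟨_, rfl⟩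
        change ⟪S u - z • (u : H), y⟫_ℂ = 0 at h3
        rw [inner_eq_zero_symm, inner_sub_right, inner_smul_right, sub_eq_zero] at h3
        rw [h3, inner_smul_left, Complex.conj_conj]
      obtain ⟨hy', e⟩ := selfAdjoint_mem hS h2
      have h4 := selfAdjoint_lower_bound hS (starRingEnd ℂ z) ⟨y, hy'⟩
      rw [e, sub_self, norm_zero, Complex.conj_im, abs_neg] at h4
      have h5 : ‖y‖ ≤ 0 := by
        by_contra h
        exact absurd h4 (not_le.2 (mul_pos hz' (not_le.1 h)))
      exact norm_le_zero_iff.1 h5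
    have h2 := (Submodule.topologicalClosure_eq_top_iff).2 h1
    have h3 := congrArg (fun V : Submodule ℂ H => (V : Set H)) h2
    have h4 : closure (Set.range φ) = Set.univ := h3
    rw [hcl.closure_eq] at h4
    exact Set.range_eq_univ.1 h4
  have hinj : Function.Injective φ := hanti.injective
  let e : G ≃L[ℂ] H := ContinuousLinearEquiv.ofBijective φ
    (LinearMap.ker_eq_bot.2 hinj) (LinearMap.range_eq_top.2 hsurj)
  refine ⟨ContinuousLinearMap.fst ℂ H H ∘L G.subtypeL ∘L (e.symm : H →L[ℂ] G), fun f => ?_,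
    fun u => ?_⟩
  · obtain ⟨⟨u, hu⟩, hu1, hu2⟩ := hφ (e.symm f)
    have h1 : φ (e.symm f) = f := e.apply_symm_apply f
    have h2 : (e.symm f).1.1 = u := hu1.symm
    change ∃ hf : (e.symm f).1.1 ∈ S.domain, S ⟨(e.symm f).1.1, hf⟩ - z • (e.symm f).1.1 = f
    refine ⟨by rw [h2]; exact hu, ?_⟩
    have h3 : (⟨(e.symm f).1.1, by rw [h2]; exact hu⟩ : S.domain) = ⟨u, hu⟩ := Subtype.ext h2
    rw [h3, hu2]
    exact h1
  · have h1 : e.symm (S u - z • (u : H)) = ⟨(u, S u), S.mem_graph u⟩ := by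
      rw [ContinuousLinearEquiv.symm_apply_eq]
      rfl
    change (e.symm (S u - z • (u : H))).1.1 = u
    rw [h1]

theorem isResolventAt_resolventOp (hS : IsSelfAdjoint S) {z : ℂ} (hz : z.im ≠ 0) :
    IsResolventAt S z (resolventOp S z) := by
  obtain ⟨B, hB⟩ := exists_isResolventAt hS hz
  rwa [hB.resolventOp_eq]

theorem star_resolventOp (hS : IsSelfAdjoint S) {z : ℂ} (hz : z.im ≠ 0) :
    star (resolventOp S z) = resolventOp S (starRingEnd ℂ z) := by
  have h1 := isResolventAt_resolventOp hS hz
  have h2 := isResolventAt_resolventOp hS (z := starRingEnd ℂ z) (by simpa using hz)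
  ext u
  refine ext_inner_right ℂ fun v => ?_
  rw [ContinuousLinearMap.star_eq_adjoint, ContinuousLinearMap.adjoint_inner_left]
  obtain ⟨ha, ea⟩ := h2.1 u
  obtain ⟨hb, eb⟩ := h1.1 v
  conv_lhs => rw [← ea]
  conv_rhs => rw [← eb]
  rw [inner_sub_left, inner_sub_right, inner_smul_left, inner_smul_right, Complex.conj_conj]
  congr 1
  exact selfAdjoint_symm hS ⟨_, ha⟩ ⟨_, hb⟩

theorem resolventOp_sub (hS : IsSelfAdjoint S) {z z' : ℂ} (hz : z.im ≠ 0) (hz' : z'.im ≠ 0) :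
    resolventOp S z - resolventOp S z' =
      (z - z') • (resolventOp S z * resolventOp S z') := by
  have h1 := isResolventAt_resolventOp hS hz
  have h2 := isResolventAt_resolventOp hS hz'
  ext u
  obtain ⟨hb, eb⟩ := h2.1 u
  have h3 := h1.2 ⟨_, hb⟩
  have h4 : S ⟨resolventOp S z' u, hb⟩ - z • resolventOp S z' u =
      u - (z - z') • resolventOp S z' u := by
    rw [sub_smul]
    nth_rewrite 3 [← eb]
    abel
  change resolventOp S z (S ⟨resolventOp S z' u, hb⟩ - z • resolventOp S z' u) = _ at h3
  rw [h4, map_sub, map_smul] at h3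
  change resolventOp S z u - resolventOp S z' u =
    (z - z') • resolventOp S z (resolventOp S z' u)
  change _ = resolventOp S z' u at h3
  rw [sub_eq_iff_eq_add] at h3
  rw [h3]
  abel

end Resolvent

/-! ### Continuous functions of a selfadjoint operator -/

section Calculus

variable {H : Type*} [NormedAddCommGroup H] [InnerProductSpace ℂ H] [CompleteSpace H]

/-- `f` is continuous with limit `c` at infinity. -/
def HasLim (f : ℝ → ℝ) (c : ℝ) : Prop := Continuous f ∧ Tendsto f (cocompact ℝ) (𝓝 c)

/-- The function `f` in the spectral variable of `(S + i)⁻¹`. -/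
def cayley (f : ℝ → ℝ) (c : ℝ) : ℂ → ℂ := fun ζ =>
  if ζ = 0 then (c : ℂ) else ((f (ζ⁻¹ - Complex.I).re : ℝ) : ℂ)

/-- `f(S)`, for `f` continuous with limit `c` at infinity. -/
def limFun (S : H →ₗ.[ℂ] H) (f : ℝ → ℝ) (c : ℝ) : H →L[ℂ] H :=
  cfc (cayley f c) (resolventOp S (-Complex.I))

theorem ccFun_eq (S : H →ₗ.[ℂ] H) (g : ℝ → ℝ) : ccFun S g = limFun S g 0 := by
  have h : (fun ζ : ℂ => if ζ = 0 then 0 else ((g (ζ⁻¹ - Complex.I).re : ℝ) : ℂ)) =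
      cayley g 0 := by
    funext ζ
    rw [cayley, Complex.ofReal_zero]
  rw [ccFun, limFun, h]

theorem HasLim.of_hasCompactSupport {g : ℝ → ℝ} (hg : Continuous g) (hg' : HasCompactSupport g) :
    HasLim g 0 := by
  refine ⟨hg, ?_⟩
  refine tendsto_const_nhds.congr' ?_
  have := hg'.isCompact.compl_mem_cocompact
  filter_upwards [this] with t ht
  exact (image_eq_zero_of_notMem_tsupport ht).symm

theorem HasLim.mul {f g : ℝ → ℝ} {c d : ℝ} (hf : HasLim f c) (hg : HasLim g d) :
    HasLim (fun t => f t * g t) (c * d) := ⟨hf.1.mul hg.1, hf.2.mul hg.2⟩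

theorem HasLim.sub {f g : ℝ → ℝ} {c d : ℝ} (hf : HasLim f c) (hg : HasLim g d) :
    HasLim (fun t => f t - g t) (c - d) := ⟨hf.1.sub hg.1, hf.2.sub hg.2⟩

theorem HasLim.sqrt {f : ℝ → ℝ} {c : ℝ} (hf : HasLim f c) :
    HasLim (fun t => Real.sqrt (f t)) (Real.sqrt c) :=
  ⟨hf.1.sqrt, (Real.continuous_sqrt.tendsto c).comp hf.2⟩

theorem hasLim_const (c : ℝ) : HasLim (fun _ => c) c := ⟨continuous_const, tendsto_const_nhds⟩

theorem HasLim.bdd_mul {f g : ℝ → ℝ} {M : ℝ} (hf : Continuous f) (hM : ∀ t, |f t| ≤ M)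
    (hg : HasLim g 0) : HasLim (fun t => f t * g t) 0 :=
  ⟨hf.mul hg.1, bdd_le_mul_tendsto_zero' M (Eventually.of_forall hM) hg.2⟩

variable {S : H →ₗ.[ℂ] H} (hS : IsSelfAdjoint S)

include hS

/-- The adjoint is the resolvent at the conjugate point, and the resolvent identity written in both
orders shows that the two commute. -/
theorem isStarNormal_resolventOp : IsStarNormal (resolventOp S (-Complex.I)) := by
  have h1 : (-Complex.I).im ≠ 0 := by simp
  have h2 : (starRingEnd ℂ (-Complex.I)).im ≠ 0 := by simp
  have h3 : -Complex.I - starRingEnd ℂ (-Complex.I) ≠ 0 := by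
    intro h
    have := congrArg Complex.im h
    norm_num at this
  have e1 := resolventOp_sub hS h1 h2
  have e2 := resolventOp_sub hS h2 h1
  refine ⟨?_⟩
  rw [star_resolventOp hS h1]
  have e3 : (-Complex.I - starRingEnd ℂ (-Complex.I)) •
      (resolventOp S (starRingEnd ℂ (-Complex.I)) * resolventOp S (-Complex.I)) =
      (-Complex.I - starRingEnd ℂ (-Complex.I)) •
      (resolventOp S (-Complex.I) * resolventOp S (starRingEnd ℂ (-Complex.I))) := by
    rw [← e1, ← neg_sub (resolventOp S (starRingEnd ℂ (-Complex.I))), e2, ← neg_smul, neg_sub]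
  exact smul_right_injective _ h3 e3

theorem resolventOp_sub_star : resolventOp S (-Complex.I) - star (resolventOp S (-Complex.I)) =
    (-2 * Complex.I) • (star (resolventOp S (-Complex.I)) * resolventOp S (-Complex.I)) := by
  have h1 : (-Complex.I).im ≠ 0 := by simp
  have h2 : (starRingEnd ℂ (-Complex.I)).im ≠ 0 := by simp
  rw [star_resolventOp hS h1, ← neg_sub, resolventOp_sub hS h2 h1, ← neg_smul]
  congr 1
  simp
  ring

theorem sub_conj_of_mem_spectrum {ζ : ℂ} (hζ : ζ ∈ spectrum ℂ (resolventOp S (-Complex.I))) :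
    ζ - star ζ = (-2 * Complex.I) * (star ζ * ζ) := by
  have hN := isStarNormal_resolventOp hS
  set N := resolventOp S (-Complex.I) with hNdef
  have e := resolventOp_sub_star hS
  rw [← hNdef] at e
  have h1 : cfc (fun ζ : ℂ => ζ - star ζ) N = N - star N := by
    rw [cfc_sub (fun ζ : ℂ => ζ) (fun ζ : ℂ => star ζ) N, cfc_id' ℂ N, cfc_star_id (R := ℂ) N]
  have h2 : cfc (fun ζ : ℂ => (-2 * Complex.I) • (star ζ * ζ)) N =
      (-2 * Complex.I) • (star N * N) := by
    rw [cfc_smul (-2 * Complex.I) (fun ζ : ℂ => star ζ * ζ) N,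
      cfc_mul (fun ζ : ℂ => star ζ) (fun ζ : ℂ => ζ) N, cfc_id' ℂ N, cfc_star_id (R := ℂ) N]
  rw [← h1, ← h2, cfc_eq_cfc_iff_eqOn] at e
  exact e hζ

/-- The identity `N - N* = -2i N*N` for `N = (S + i)⁻¹` passes to spectral values, where for `ζ ≠ 0`
it says `Im ζ⁻¹ = 1`. -/
theorem exists_real_of_mem_spectrum {ζ : ℂ} (hζ : ζ ∈ spectrum ℂ (resolventOp S (-Complex.I)))
    (h0 : ζ ≠ 0) : ∃ t : ℝ, ζ⁻¹ = t + Complex.I ∧ (ζ⁻¹ - Complex.I).re = t := by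
  have e := sub_conj_of_mem_spectrum hS hζ
  have h1 : star ζ ≠ 0 := star_ne_zero.2 h0
  have h2 : ζ⁻¹ - star ζ⁻¹ = 2 * Complex.I := by
    rw [star_inv₀]
    field_simp
    linear_combination -e
  have h3 : (ζ⁻¹).im = 1 := by
    have := congrArg Complex.im h2
    have h4 : (star ζ⁻¹).im = -(ζ⁻¹).im := Complex.conj_im _
    rw [Complex.sub_im, h4] at this
    have h5 : (2 * Complex.I).im = 2 := by simp
    linarith
  refine ⟨(ζ⁻¹).re, ?_, by simp⟩
  apply Complex.ext <;> simp [h3] 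

/-- Spectral values tending to `0` correspond to real `t` with `|t| → ∞`, so continuity at `ζ = 0`
is the existence of the limit of `f` at infinity. -/
theorem continuousOn_cayley {f : ℝ → ℝ} {c : ℝ} (hf : HasLim f c) :
    ContinuousOn (cayley f c) (spectrum ℂ (resolventOp S (-Complex.I))) := by
  intro ζ hζ
  by_cases h0 : ζ = 0
  · subst h0
    rw [← continuousWithinAt_sdiff_self]
    set σ := spectrum ℂ (resolventOp S (-Complex.I)) with hσ
    have h1 : Tendsto (fun ζ : ℂ => ζ⁻¹ - Complex.I) (𝓝[σ \ {0}] 0) (Bornology.cobounded ℂ) := by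
      have h2 : 𝓝[σ \ {0}] (0 : ℂ) ≤ 𝓝[≠] 0 := nhdsWithin_mono _ fun ζ h => h.2
      have h3 : Tendsto (fun ζ : ℂ => ζ⁻¹ - Complex.I) (𝓝[≠] 0) (Bornology.cobounded ℂ) := by
        rw [← tendsto_norm_atTop_iff_cobounded]
        have h4 : Tendsto (fun ζ : ℂ => ‖ζ⁻¹‖ - 1) (𝓝[≠] 0) atTop :=
          tendsto_atTop_add_const_right _ _
            (tendsto_norm_atTop_iff_cobounded.2 tendsto_inv₀_nhdsNE_zero)
        refine tendsto_atTop_mono (fun ζ => ?_) h4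
        have := norm_sub_norm_le ζ⁻¹ Complex.I
        rwa [Complex.norm_I] at this
      exact h3.mono_left h2
    have h2 : Tendsto (fun ζ : ℂ => (ζ⁻¹ - Complex.I).re) (𝓝[σ \ {0}] 0) (cocompact ℝ) := by
      rw [← Metric.cobounded_eq_cocompact, ← tendsto_norm_atTop_iff_cobounded]
      refine (tendsto_norm_atTop_iff_cobounded.2 h1).congr' ?_
      filter_upwards [self_mem_nhdsWithin] with ζ hζ
      obtain ⟨t, ht, ht'⟩ := exists_real_of_mem_spectrum hS hζ.1 hζ.2
      rw [ht', ht, add_sub_cancel_right, Complex.norm_real]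
    have h3 : cayley f c 0 = c := by rw [cayley, if_pos rfl]
    rw [ContinuousWithinAt, h3]
    refine ((Complex.continuous_ofReal.tendsto c).comp (hf.2.comp h2)).congr' ?_
    filter_upwards [self_mem_nhdsWithin] with ζ hζ
    rw [cayley, if_neg (show ζ ≠ 0 from hζ.2)]
    rfl
  · refine ContinuousAt.continuousWithinAt ?_
    have h1 : (fun ζ : ℂ => ((f (ζ⁻¹ - Complex.I).re : ℝ) : ℂ)) =ᶠ[𝓝 ζ] cayley f c := by
      filter_upwards [isOpen_ne.mem_nhds h0] with ξ hξ
      rw [cayley, if_neg hξ]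
    refine ContinuousAt.congr ?_ h1
    refine Complex.continuous_ofReal.continuousAt.comp (hf.1.continuousAt.comp ?_)
    exact Complex.continuous_re.continuousAt.comp ((continuousAt_inv₀ h0).sub continuousAt_const)

theorem limFun_mul {f g : ℝ → ℝ} {c d : ℝ} (hf : HasLim f c) (hg : HasLim g d) :
    limFun S (fun t => f t * g t) (c * d) = limFun S f c * limFun S g d := by
  rw [limFun, limFun, limFun, ← cfc_mul _ _ _ (continuousOn_cayley hS hf)
    (continuousOn_cayley hS hg)]
  congr 1
  funext ζ
  by_cases h : ζ = 0 <;> simp [cayley, h]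

theorem limFun_add {f g : ℝ → ℝ} {c d : ℝ} (hf : HasLim f c) (hg : HasLim g d) :
    limFun S (fun t => f t + g t) (c + d) = limFun S f c + limFun S g d := by
  rw [limFun, limFun, limFun, ← cfc_add _ _ _ (continuousOn_cayley hS hf)
    (continuousOn_cayley hS hg)]
  congr 1
  funext ζ
  by_cases h : ζ = 0 <;> simp [cayley, h]

theorem limFun_const (c : ℝ) : limFun S (fun _ => c) c = (c : ℂ) • 1 := by
  have hN := isStarNormal_resolventOp hS
  have h : cayley (fun _ => c) c = fun _ => (c : ℂ) := by
    funext ζ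
    by_cases h : ζ = 0 <;> simp [cayley, h]
  rw [limFun, h, cfc_const _ _, Algebra.algebraMap_eq_smul_one]

omit hS in
theorem isSelfAdjoint_limFun (S : H →ₗ.[ℂ] H) (f : ℝ → ℝ) (c : ℝ) : IsSelfAdjoint (limFun S f c) := by
  rw [isSelfAdjoint_iff, limFun, ← cfc_star]
  congr 1
  funext ζ
  by_cases h : ζ = 0 <;> simp [cayley, h]

theorem limFun_comm {f g : ℝ → ℝ} {c d : ℝ} (hf : HasLim f c) (hg : HasLim g d) :
    limFun S f c * limFun S g d = limFun S g d * limFun S f c := by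
  rw [← limFun_mul hS hf hg, ← limFun_mul hS hg hf, mul_comm c]
  simp only [mul_comm]

omit hS in
theorem norm_sq_limFun (S : H →ₗ.[ℂ] H) {f : ℝ → ℝ} {c : ℝ} (u : H) :
    ((‖limFun S f c u‖ ^ 2 : ℝ) : ℂ) = ⟪u, (limFun S f c * limFun S f c) u⟫_ℂ := by
  rw [mul_apply_eq_comp, ← inner_comm_of_selfAdjoint (isSelfAdjoint_limFun S f c),
    inner_self_eq_norm_sq_to_K]
  push_cast
  rfl

/-- With `q = √(g² - f²)`, which again has a limit at infinity, `g² = f² + q²` gives `‖g(S) u‖² =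
‖f(S) u‖² + ‖q(S) u‖²`. -/
theorem norm_limFun_le {f g : ℝ → ℝ} {c d : ℝ} (hf : HasLim f c) (hg : HasLim g d)
    (h : ∀ t, |f t| ≤ |g t|) (u : H) : ‖limFun S f c u‖ ≤ ‖limFun S g d u‖ := by
  have hsq : ∀ t, 0 ≤ g t * g t - f t * f t := fun t => by
    have := sq_le_sq.2 (h t)
    nlinarith
  have hcd : 0 ≤ d * d - c * c := ge_of_tendsto ((hg.mul hg).sub (hf.mul hf)).2
    (Eventually.of_forall hsq)
  have hq := ((hg.mul hg).sub (hf.mul hf)).sqrt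
  have e : limFun S g d * limFun S g d = limFun S f c * limFun S f c + 
      limFun S (fun t => Real.sqrt (g t * g t - f t * f t)) (Real.sqrt (d * d - c * c)) *
      limFun S (fun t => Real.sqrt (g t * g t - f t * f t)) (Real.sqrt (d * d - c * c)) := by
    rw [← limFun_mul hS hq hq, ← limFun_mul hS hf hf, ← limFun_mul hS hg hg,
      ← limFun_add hS (hf.mul hf) (hq.mul hq), Real.mul_self_sqrt hcd]
    simp only [Real.mul_self_sqrt (hsq _)]
    congr 1
    · funext t; ring
    · ring
  have h1 := norm_sq_limFun S (f := g) (c := d) u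
  rw [e, add_apply, inner_add_right, ← norm_sq_limFun S, ← norm_sq_limFun S] at h1
  have h2 := Complex.ofReal_injective (h1.trans (Complex.ofReal_add _ _).symm)
  refine le_of_sq_le_sq ?_ (norm_nonneg _)
  rw [h2]
  exact le_add_of_nonneg_right (sq_nonneg _)

theorem norm_limFun_le_const {f : ℝ → ℝ} {c M : ℝ} (hf : HasLim f c) (h : ∀ t, |f t| ≤ M) (u : H) :
    ‖limFun S f c u‖ ≤ M * ‖u‖ := by
  have h0 : 0 ≤ M := (abs_nonneg _).trans (h 0)
  have := norm_limFun_le hS hf (hasLim_const M) (fun t => by rw [abs_of_nonneg h0]; exact h t) u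
  rwa [limFun_const hS, smul_apply, norm_smul, Complex.norm_real, Real.norm_of_nonneg h0] at this

/-- The function `(1 + t²)⁻¹`. -/
def lorentz (t : ℝ) : ℝ := (1 + t ^ 2)⁻¹

omit hS in
theorem lorentz_pos (t : ℝ) : 0 < lorentz t := by unfold lorentz; positivity

omit hS in
theorem hasLim_lorentz : HasLim lorentz 0 := by
  refine ⟨Continuous.inv₀ (by fun_prop) fun t => by positivity, ?_⟩
  refine tendsto_inv_atTop_zero.comp (tendsto_atTop_add_const_left _ _ ?_)
  have h := (tendsto_pow_atTop (two_ne_zero)).comp (tendsto_norm_cocompact_atTop (E := ℝ))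
  refine h.congr fun t => ?_
  simp

/-- Here `(1 + t²)⁻¹ = |t + i|⁻²`. This operator is injective with dense range although its symbol
vanishes at infinity; bounded functions of `S` are constructed on its range. -/
theorem limFun_lorentz : limFun S lorentz 0 =
    star (resolventOp S (-Complex.I)) * resolventOp S (-Complex.I) := by
  have hN := isStarNormal_resolventOp hS
  set N := resolventOp S (-Complex.I) with hNdef
  have h2 : cfc (fun ζ : ℂ => star ζ * ζ) N = star N * N := by
    rw [cfc_mul (fun ζ : ℂ => star ζ) (fun ζ : ℂ => ζ) N, cfc_id' ℂ N, cfc_star_id (R := ℂ) N]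
  rw [limFun, ← hNdef, ← h2]
  refine cfc_congr fun ζ hζ => ?_
  by_cases h : ζ = 0
  · simp [cayley, h]
  obtain ⟨t, ht, ht'⟩ := exists_real_of_mem_spectrum hS hζ h
  have h3 : ζ = (t + Complex.I)⁻¹ := by rw [← ht, inv_inv]
  have h4 : star ζ = (t - Complex.I)⁻¹ := by
    rw [h3, star_inv₀]
    simp [sub_eq_add_neg]
  rw [cayley, if_neg h, ht', h4]
  nth_rewrite 1 [h3]
  rw [← mul_inv, lorentz]
  push_cast
  congr 1
  ring_nf
  rw [Complex.I_sq]
  ring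

theorem resolventOp_injective {u : H} (h : resolventOp S (-Complex.I) u = 0) : u = 0 := by
  obtain ⟨hf, e⟩ := (isResolventAt_resolventOp hS (z := -Complex.I) (by simp)).1 u
  have h1 : (⟨_, hf⟩ : S.domain) = 0 := Subtype.ext h
  rw [← e, h1, LinearPMap.map_zero, h, smul_zero, sub_zero]

theorem limFun_lorentz_injective {u : H} (h : limFun S lorentz 0 u = 0) : u = 0 := by
  apply resolventOp_injective hS
  rw [← inner_self_eq_zero (𝕜 := ℂ), ← ContinuousLinearMap.adjoint_inner_right,
    ← ContinuousLinearMap.star_eq_adjoint, ← mul_apply_eq_comp, ← limFun_lorentz hS, h,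
    inner_zero_right]

theorem denseRange_limFun_lorentz : DenseRange (limFun S lorentz 0) :=
  denseRange_of_selfAdjoint_of_injective (isSelfAdjoint_limFun S _ _)
    fun _ => limFun_lorentz_injective hS

/-- The truncations `max (lorentz - η) 0` have compact support and approximate `lorentz` uniformly
within `η`. A vector killed by all of them is killed by the injective operator `lorentz(S)`. -/
theorem eq_zero_of_ccFun {u : H}
    (h : ∀ g : ℝ → ℝ, Continuous g → HasCompactSupport g → ccFun S g u = 0) : u = 0 := by
  apply limFun_lorentz_injective hS
  rw [← norm_le_zero_iff]
  refine le_of_forall_pos_le_add fun ε hε => ?_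
  rw [zero_add]
  obtain ⟨η, hη, hη'⟩ : ∃ η : ℝ, 0 < η ∧ η * ‖u‖ ≤ ε := by
    refine ⟨ε / (1 + ‖u‖), by positivity, ?_⟩
    rw [div_mul_eq_mul_div, div_le_iff₀ (by positivity)]
    nlinarith [norm_nonneg u]
  let g : ℝ → ℝ := fun t => max (lorentz t - η) 0
  have hgc : Continuous g := (hasLim_lorentz.1.sub continuous_const).max continuous_const
  have hgs : HasCompactSupport g := by
    have h1 : ∀ᶠ t in cocompact ℝ, lorentz t < η := hasLim_lorentz.2.eventually (gt_mem_nhds hη)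
    obtain ⟨K, hK, hK'⟩ := mem_cocompact.1 h1
    refine HasCompactSupport.intro hK fun t ht => ?_
    have h2 : lorentz t < η := hK' ht
    exact max_eq_right (by linarith)
  have hg := HasLim.of_hasCompactSupport hgc hgs
  have e : limFun S lorentz 0 = limFun S (fun t => lorentz t - g t) (0 - 0) + limFun S g 0 := by
    rw [← limFun_add hS (hasLim_lorentz.sub hg) hg]
    simp
  have h1 := h g hgc hgs
  rw [ccFun_eq] at h1
  rw [e, add_apply, h1, add_zero]
  refine (norm_limFun_le_const hS (hasLim_lorentz.sub hg) (M := η) (fun t => ?_) u).trans hη'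
  have h2 := lorentz_pos t
  rw [abs_le]
  simp only [g]
  rcases le_total (lorentz t - η) 0 with h3 | h3
  · rw [max_eq_right h3]; constructor <;> linarith
  · rw [max_eq_left h3]; constructor <;> linarith

theorem eq_of_ccFun {u v : H}
    (h : ∀ g : ℝ → ℝ, Continuous g → HasCompactSupport g → ccFun S g u = ccFun S g v) : u = v :=
  sub_eq_zero.1 (eq_zero_of_ccFun hS fun g hg hg' => by rw [map_sub, h g hg hg', sub_self])

/-! ### Bounded functions -/

omit hS in
theorem bdd_cc {f g : ℝ → ℝ} (hf : Continuous f) (hg : Continuous g) (hg' : HasCompactSupport g) :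
    Continuous (fun t => g t * f t) ∧ HasCompactSupport (fun t => g t * f t) :=
  ⟨hg.mul hf, hg'.mul_right⟩

theorem ccFun_mul_limFun {f g : ℝ → ℝ} {c : ℝ} (hf : HasLim f c) (hg : Continuous g)
    (hg' : HasCompactSupport g) : ccFun S (fun t => g t * f t) = ccFun S g * limFun S f c := by
  rw [ccFun_eq, ccFun_eq, ← limFun_mul hS (HasLim.of_hasCompactSupport hg hg') hf, zero_mul]

/-- A bounded `f` may have no limit at infinity, but `f · lorentz` tends to `0`, and its value at
`S` is dominated by `M` times that of `lorentz`. This defines `f(S)` on the dense range of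
`lorentz(S)`. -/
theorem exists_bddFun {f : ℝ → ℝ} {M : ℝ} (hf : Continuous f) (hM : ∀ t, |f t| ≤ M) :
    ∃ B : H →L[ℂ] H, ∀ u, (u, B u) ∈ funGraph S f := by
  have h0 : 0 ≤ M := (abs_nonneg _).trans (hM 0)
  have hfρ := HasLim.bdd_mul hf hM hasLim_lorentz
  obtain ⟨B, hB, -⟩ := exists_factor_of_dense (limFun S lorentz 0 : H →ₗ[ℂ] H)
    (limFun S (fun t => f t * lorentz t) 0 : H →ₗ[ℂ] H) (denseRange_limFun_lorentz hS) (c := M)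
    (fun u => by
      have h1 := (hasLim_const M).mul hasLim_lorentz
      have h2 := norm_limFun_le hS hfρ h1 (fun t => by
        rw [abs_mul, abs_mul, abs_of_nonneg h0]
        exact mul_le_mul_of_nonneg_right (hM t) (abs_nonneg _)) u
      rw [limFun_mul hS (hasLim_const M) hasLim_lorentz, limFun_const hS, smul_mul_assoc, one_mul,
        smul_apply, norm_smul, Complex.norm_real, Real.norm_of_nonneg h0] at h2
      exact h2)
  refine ⟨B, fun u g hg hg' => ?_⟩
  change ccFun S (fun t => g t * f t) u = ccFun S g (B u)
  obtain ⟨hc1, hc2⟩ := bdd_cc hf hg hg'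
  refine (denseRange_limFun_lorentz hS).induction_on
    (p := fun u => ccFun S (fun t => g t * f t) u = ccFun S g (B u)) u
    (isClosed_eq (by fun_prop) (by fun_prop)) fun v => ?_
  have h1 : B (limFun S lorentz 0 v) = limFun S (fun t => f t * lorentz t) 0 v := (hB v).symm
  rw [h1, ← mul_apply_eq_comp, ← mul_apply_eq_comp, ← ccFun_mul_limFun hS hfρ hg hg',
    ← ccFun_mul_limFun hS hasLim_lorentz hc1 hc2]
  simp only [mul_assoc]

end Calculus

section Bounded

variable {H : Type*} [NormedAddCommGroup H] [InnerProductSpace ℂ H] [CompleteSpace H]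
  {S : H →ₗ.[ℂ] H} (hS : IsSelfAdjoint S)

theorem isSelfAdjoint_ccFun (S : H →ₗ.[ℂ] H) (g : ℝ → ℝ) : IsSelfAdjoint (ccFun S g) := by
  rw [ccFun_eq]
  exact isSelfAdjoint_limFun S g 0

include hS

theorem clm_eq_of_ccFun {B B' : H →L[ℂ] H} (h : ∀ g : ℝ → ℝ, Continuous g → HasCompactSupport g →
    ccFun S g * B = ccFun S g * B') : B = B' := by
  ext u
  refine eq_of_ccFun hS fun g hg hg' => ?_
  rw [← mul_apply_eq_comp, ← mul_apply_eq_comp, h g hg hg']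

omit hS in
theorem ccFun_mul_bddFun_of_exists {f : ℝ → ℝ}
    (h : ∃ B : H →L[ℂ] H, ∀ u, (u, B u) ∈ funGraph S f) {g : ℝ → ℝ} (hg : Continuous g)
    (hg' : HasCompactSupport g) :
    ccFun S (fun t => g t * f t) = ccFun S g * bddFun S f := by
  rw [bddFun, dif_pos h]
  ext u
  exact h.choose_spec u g hg hg'

theorem bddFun_eq_of {f : ℝ → ℝ} {B : H →L[ℂ] H} (h : ∀ g : ℝ → ℝ, Continuous g →
    HasCompactSupport g → ccFun S (fun t => g t * f t) = ccFun S g * B) : bddFun S f = B := by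
  have h1 : ∃ B : H →L[ℂ] H, ∀ u, (u, B u) ∈ funGraph S f :=
    ⟨B, fun u g hg hg' => by rw [h g hg hg']; rfl⟩
  exact clm_eq_of_ccFun hS fun g hg hg' => by
    rw [← h g hg hg', ccFun_mul_bddFun_of_exists h1 hg hg']

/-- `f` is continuous and bounded. -/
def BddCont (f : ℝ → ℝ) : Prop := Continuous f ∧ ∃ M, ∀ t, |f t| ≤ M

omit hS in
theorem BddCont.mul {f g : ℝ → ℝ} (hf : BddCont f) (hg : BddCont g) :
    BddCont (fun t => f t * g t) := by
  obtain ⟨hf, M, hM⟩ := hf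
  obtain ⟨hg, M', hM'⟩ := hg
  refine ⟨hf.mul hg, M * M', fun t => ?_⟩
  rw [abs_mul]
  exact mul_le_mul (hM t) (hM' t) (abs_nonneg _) ((abs_nonneg _).trans (hM t))

theorem ccFun_mul_bddFun {f g : ℝ → ℝ} (hf : BddCont f) (hg : Continuous g)
    (hg' : HasCompactSupport g) :
    ccFun S (fun t => g t * f t) = ccFun S g * bddFun S f := by
  obtain ⟨hf, M, hM⟩ := hf
  exact ccFun_mul_bddFun_of_exists (exists_bddFun hS hf hM) hg hg'

theorem bddFun_eq_limFun {f : ℝ → ℝ} {c : ℝ} (hf : HasLim f c) : bddFun S f = limFun S f c :=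
  bddFun_eq_of hS fun _ hg hg' => ccFun_mul_limFun hS hf hg hg'

theorem bddFun_mul {f g : ℝ → ℝ} (hf : BddCont f) (hg : BddCont g) :
    bddFun S (fun t => f t * g t) = bddFun S f * bddFun S g := by
  refine bddFun_eq_of hS fun q hq hq' => ?_
  rw [← mul_assoc, ← ccFun_mul_bddFun hS hf hq hq',
    ← ccFun_mul_bddFun hS hg (g := fun t => q t * f t) (hq.mul hf.1) hq'.mul_right]
  simp only [mul_assoc]

theorem bddFun_add {f g : ℝ → ℝ} (hf : BddCont f) (hg : BddCont g) :
    bddFun S (fun t => f t + g t) = bddFun S f + bddFun S g := by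
  refine bddFun_eq_of hS fun q hq hq' => ?_
  rw [mul_add, ← ccFun_mul_bddFun hS hf hq hq', ← ccFun_mul_bddFun hS hg hq hq', ccFun_eq,
    ccFun_eq, ccFun_eq, ← limFun_add hS (f := fun t => q t * f t)
      (g := fun t => q t * g t) (.of_hasCompactSupport (hq.mul hf.1) hq'.mul_right)
      (.of_hasCompactSupport (hq.mul hg.1) hq'.mul_right), add_zero]
  simp only [mul_add]

theorem bddFun_const (c : ℝ) : bddFun S (fun _ => c) = (c : ℂ) • 1 := by
  rw [bddFun_eq_limFun hS (hasLim_const c), limFun_const hS]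

theorem bddFun_comm {f g : ℝ → ℝ} (hf : BddCont f) (hg : BddCont g) :
    Commute (bddFun S f) (bddFun S g) := by
  rw [Commute, SemiconjBy, ← bddFun_mul hS hf hg, ← bddFun_mul hS hg hf]
  simp only [mul_comm]

theorem bddFun_mul_ccFun {f g : ℝ → ℝ} (hf : BddCont f) (hg : Continuous g)
    (hg' : HasCompactSupport g) :
    ccFun S (fun t => g t * f t) = bddFun S f * ccFun S g := by
  rw [ccFun_mul_bddFun hS hf hg hg', ccFun_eq, ← bddFun_eq_limFun hS (.of_hasCompactSupport hg hg')]
  obtain ⟨M, hM⟩ := hg'.exists_bound_of_continuous hg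
  exact bddFun_comm hS ⟨hg, M, hM⟩ hf

theorem isSelfAdjoint_bddFun {f : ℝ → ℝ} (hf : BddCont f) : IsSelfAdjoint (bddFun S f) := by
  refine (bddFun_eq_of hS fun g hg hg' => ?_).symm
  rw [← (isSelfAdjoint_ccFun S g).star_eq, ← star_mul, ← bddFun_mul_ccFun hS hf hg hg',
    (isSelfAdjoint_ccFun S _).star_eq]

theorem bddFun_injective {f : ℝ → ℝ} (hf : BddCont f) (h0 : ∀ t, f t ≠ 0) {u : H}
    (hu : bddFun S f u = 0) : u = 0 := by
  refine eq_zero_of_ccFun hS fun g hg hg' => ?_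
  have h1 := ccFun_mul_bddFun hS hf (g := fun t => g t * (f t)⁻¹) (hg.mul (hf.1.inv₀ h0))
    hg'.mul_right
  have h2 : (fun t => g t * (f t)⁻¹ * f t) = g := by
    funext t
    rw [inv_mul_cancel_right₀ (h0 t)]
  rw [h2] at h1
  rw [h1, mul_apply_eq_comp, hu, map_zero]

omit hS in
theorem commute_ccFun {k : H →L[ℂ] H} (hk : IsSelfAdjoint k)
    (hkN : Commute (resolventOp S (-Complex.I)) k) (g : ℝ → ℝ) : Commute (ccFun S g) k := by
  have h : Commute (star (resolventOp S (-Complex.I))) k := by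
    have h1 := hkN.star_star
    rwa [hk.star_eq] at h1
  exact Commute.cfc hkN h _

theorem commute_bddFun {k : H →L[ℂ] H} (hk : IsSelfAdjoint k)
    (hkN : Commute (resolventOp S (-Complex.I)) k) {f : ℝ → ℝ} (hf : BddCont f) :
    Commute (bddFun S f) k := by
  refine clm_eq_of_ccFun hS fun g hg hg' => ?_
  have h1 := commute_ccFun hk hkN g
  have h2 := commute_ccFun hk hkN (fun t => g t * f t)
  rw [← mul_assoc, ← ccFun_mul_bddFun hS hf hg hg', h2.eq, ccFun_mul_bddFun hS hf hg hg',
    ← mul_assoc, ← mul_assoc, h1.eq]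

theorem commute_resolventOp {k : H →L[ℂ] H}
    (h : ∀ u : S.domain, ∃ hu : k (u : H) ∈ S.domain, S ⟨k (u : H), hu⟩ = k (S u)) :
    Commute (resolventOp S (-Complex.I)) k := by
  have hN := isResolventAt_resolventOp hS (z := -Complex.I) (by simp)
  ext v
  obtain ⟨hv, ev⟩ := hN.1 v
  obtain ⟨hu, eu⟩ := h ⟨_, hv⟩
  have h1 := hN.2 ⟨_, hu⟩
  simp only [eu] at h1
  rw [← map_smul, ← map_sub, ev] at h1
  exact h1

/-- Bounded perturbations of selfadjoint operators are selfadjoint. -/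
theorem isSelfAdjoint_perturb {B : H →L[ℂ] H} (hB : IsSelfAdjoint B) :
    IsSelfAdjoint (perturb S B) := by
  have hd : Dense ((perturb S B).domain : Set H) := hS.dense_domain
  have hap : ∀ u : S.domain, perturb S B u = B (u : H) + S u := fun u => rfl
  rw [LinearPMap.isSelfAdjoint_def]
  refine le_antisymm ?_ (LinearPMap.IsFormalAdjoint.le_adjoint hd ?_)
  · refine LinearPMap.le_of_eqLocus_ge ?_
    intro y hy
    have h1 := LinearPMap.adjoint_isFormalAdjoint hd ⟨y, hy⟩
    obtain ⟨hy', e⟩ := selfAdjoint_mem hS (y := y)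
      (w := (perturb S B).adjoint ⟨y, hy⟩ - B y) fun u => by
        have h2 := h1 u
        rw [inner_sub_left, h2]
        change ⟪y, B (u : H) + S u⟫_ℂ - _ = _
        rw [inner_add_right, inner_comm_of_selfAdjoint hB, add_sub_cancel_left]
    refine ⟨hy, hy', ?_⟩
    change _ = B y + S ⟨y, hy'⟩
    rw [e, add_sub_cancel]
  · intro u v
    change ⟪B (u : H) + S u, (v : H)⟫_ℂ = ⟪(u : H), B (v : H) + S v⟫_ℂ
    rw [inner_add_left, inner_add_right, inner_comm_of_selfAdjoint hB]
    congr 1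
    exact selfAdjoint_symm hS u v

end Bounded

/-! ### Weights and cutoffs as functions of the position operator -/

section Weights

variable {H : Type*} [NormedAddCommGroup H] [InnerProductSpace ℂ H] [CompleteSpace H]
  {x : H →ₗ.[ℂ] H} {w : ℝ → ℝ}

theorem bddCont_rpow_neg (hw : Continuous w) (hp : ∃ c : ℝ, 0 < c ∧ ∀ t, c ≤ w t) {a : ℝ}
    (ha : 0 < a) : BddCont (fun t => w t ^ (-a)) := by
  obtain ⟨c, hc, h⟩ := hp
  have h0 : ∀ t, 0 < w t := fun t => hc.trans_le (h t)
  refine ⟨hw.rpow_const fun t => Or.inl (h0 t).ne', c ^ (-a), fun t => ?_⟩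
  rw [abs_of_nonneg (Real.rpow_nonneg (h0 t).le _)]
  exact Real.rpow_le_rpow_of_nonpos hc (h t) (neg_nonpos.2 ha.le)

theorem weight_mul (hx : IsSelfAdjoint x) (hw : Continuous w)
    (hp : ∃ c : ℝ, 0 < c ∧ ∀ t, c ≤ w t) {a b : ℝ} (ha : 0 < a) (hb : 0 < b) :
    weight x w a * weight x w b = weight x w (a + b) := by
  rw [weight, weight, ← bddFun_mul hx (bddCont_rpow_neg hw hp ha) (bddCont_rpow_neg hw hp hb),
    weight]
  obtain ⟨c, hc, h⟩ := hp
  congr 1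
  funext t
  rw [← Real.rpow_add (hc.trans_le (h t)), neg_add]

theorem weight_injective (hx : IsSelfAdjoint x) (hw : Continuous w)
    (hp : ∃ c : ℝ, 0 < c ∧ ∀ t, c ≤ w t) {a : ℝ} (ha : 0 < a) {u : H}
    (hu : weight x w a u = 0) : u = 0 := by
  refine bddFun_injective hx (bddCont_rpow_neg hw hp ha) (fun t => ?_) hu
  obtain ⟨c, hc, h⟩ := hp
  exact (Real.rpow_pos_of_pos (hc.trans_le (h t)) _).ne'

theorem bddCont_cut {χ : ℝ → ℝ} (hχ : Continuous χ) (h : ∀ t, χ t ∈ Set.Icc (0 : ℝ) 1)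
    (R a : ℝ) : BddCont (fun t => χ (t / R + a)) := by
  refine ⟨by fun_prop, 1, fun t => ?_⟩
  rw [abs_of_nonneg (h _).1]
  exact (h _).2

theorem cut_mul_cut_eq_zero (hx : IsSelfAdjoint x) {χ χ' : ℝ → ℝ} (hχ : Continuous χ)
    (h : ∀ t, χ t ∈ Set.Icc (0 : ℝ) 1) (hχ' : Continuous χ') (h' : ∀ t, χ' t ∈ Set.Icc (0 : ℝ) 1)
    {R a b : ℝ} (h0 : ∀ t, χ (t + a) * χ' (t + b) = 0) : cut x χ R a * cut x χ' R b = 0 := by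
  rw [cut, cut, ← bddFun_mul hx (bddCont_cut hχ h R a) (bddCont_cut hχ' h' R b)]
  simp only [h0]
  rw [bddFun_const hx, Complex.ofReal_zero, zero_smul]

theorem cut_sq_add_sq (hx : IsSelfAdjoint x) {χ χ' : ℝ → ℝ} (hχ : Continuous χ)
    (h : ∀ t, χ t ∈ Set.Icc (0 : ℝ) 1) (hχ' : Continuous χ') (h' : ∀ t, χ' t ∈ Set.Icc (0 : ℝ) 1)
    (h1 : ∀ t, χ t ^ 2 + χ' t ^ 2 = 1) (R : ℝ) :
    cut x χ R 0 * cut x χ R 0 + cut x χ' R 0 * cut x χ' R 0 = 1 := by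
  have hb := bddCont_cut hχ h R 0
  have hb' := bddCont_cut hχ' h' R 0
  rw [cut, cut, ← bddFun_mul hx hb hb, ← bddFun_mul hx hb' hb',
    ← bddFun_add hx (hb.mul hb) (hb'.mul hb')]
  have h2 : (fun t => χ (t / R + 0) * χ (t / R + 0) + χ' (t / R + 0) * χ' (t / R + 0)) =
      fun _ => (1 : ℝ) := by
    funext t
    rw [← h1 (t / R + 0)]
    ring
  rw [h2, bddFun_const hx, Complex.ofReal_one, one_smul]

end Weights

/-! ### The root of a nonnegative selfadjoint operator -/

section Root

variable {H : Type*} [NormedAddCommGroup H] [InnerProductSpace ℂ H] [CompleteSpace H]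

/-- The bounded operators `L = (1 + S)^{-1/2}` and `C = S^{1/2} (1 + S)^{-1/2}` describe the
nonnegative selfadjoint operator `S` and its square root. -/
structure IsRoot (S : H →ₗ.[ℂ] H) (L C : H →L[ℂ] H) : Prop where
  selfAdjoint_L : IsSelfAdjoint L
  selfAdjoint_C : IsSelfAdjoint C
  comm : Commute L C
  sq_add_sq : L * L + C * C = 1
  injective : ∀ u, L u = 0 → u = 0
  mem_domain : ∀ u, u ∈ S.domain ↔ ∃ f, L (L f) = u
  apply : ∀ f (hf : L (L f) ∈ S.domain), S ⟨L (L f), hf⟩ = C (C f)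
  mem_sqrt : ∀ u, u ∈ (sqrtOp S).domain ↔ ∃ f, L f = u
  sqrt_apply : ∀ f (hf : L f ∈ (sqrtOp S).domain), sqrtOp S ⟨L f, hf⟩ = C f
  japanese : ∃ Y : H →L[ℂ] H, L * L = japaneseInv S * Y

/-- The function `(1 + |t|)^{-1/2}`. -/
def rootFun (t : ℝ) : ℝ := Real.sqrt (1 + |t|)⁻¹

/-- The function `(|t| / (1 + |t|))^{1/2}`. -/
def corootFun (t : ℝ) : ℝ := Real.sqrt (1 - (1 + |t|)⁻¹)

theorem inv_one_add_abs_le (t : ℝ) : (1 + |t|)⁻¹ ≤ 1 := inv_le_one_of_one_le₀ (by simp)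

theorem hasLim_inv_one_add_abs : HasLim (fun t : ℝ => (1 + |t|)⁻¹) 0 := by
  refine ⟨Continuous.inv₀ (by fun_prop) fun t => by positivity, ?_⟩
  exact tendsto_inv_atTop_zero.comp (tendsto_atTop_add_const_left _ _
    (tendsto_norm_cocompact_atTop (E := ℝ)))

theorem hasLim_rootFun : HasLim rootFun 0 := by
  have := hasLim_inv_one_add_abs.sqrt
  rwa [Real.sqrt_zero] at this

theorem hasLim_corootFun : HasLim corootFun 1 := by
  have := ((hasLim_const 1).sub hasLim_inv_one_add_abs).sqrt
  rwa [sub_zero, Real.sqrt_one] at this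

theorem rootFun_mul_self (t : ℝ) : rootFun t * rootFun t = (1 + |t|)⁻¹ :=
  Real.mul_self_sqrt (by positivity)

theorem corootFun_mul_self (t : ℝ) : corootFun t * corootFun t = 1 - (1 + |t|)⁻¹ :=
  Real.mul_self_sqrt (sub_nonneg.2 (inv_one_add_abs_le t))

theorem sqrt_mul_rootFun {t : ℝ} (ht : 0 ≤ t) : Real.sqrt t * rootFun t = corootFun t := by
  rw [rootFun, corootFun, ← Real.sqrt_mul ht, abs_of_nonneg ht]
  congr 1
  field_simp
  ring

variable {S : H →ₗ.[ℂ] H} (hS : IsSelfAdjoint S)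
  (hS0 : ∀ u : S.domain, 0 ≤ (⟪(u : H), S u⟫_ℂ).re)

include hS hS0

open scoped ComplexOrder in
-- For `N = (S + i)⁻¹`, `Re ⟨N v, v⟩ = Re ⟨N v, S N v⟩ ≥ 0`. Hence `N + N* ≥ 0`, the spectral values
-- have nonnegative real part, and so do their inverses.
theorem nonneg_of_mem_spectrum {ζ : ℂ} (hζ : ζ ∈ spectrum ℂ (resolventOp S (-Complex.I))) :
    0 ≤ (ζ⁻¹ - Complex.I).re := by
  have hN := isStarNormal_resolventOp hS
  have hres := isResolventAt_resolventOp hS (z := -Complex.I) (by simp)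
  set N := resolventOp S (-Complex.I) with hNdef
  have h1 : cfc (fun ζ : ℂ => ζ + star ζ) N = N + star N := by
    rw [cfc_add N (fun ζ : ℂ => ζ) (fun ζ : ℂ => star ζ), cfc_id' ℂ N, cfc_star_id (R := ℂ) N]
  have h2 : 0 ≤ N + star N := by
    rw [ContinuousLinearMap.nonneg_iff_isPositive, ContinuousLinearMap.isPositive_def']
    refine ⟨?_, fun v => ?_⟩
    · rw [isSelfAdjoint_iff, star_add, star_star, add_comm]
    · obtain ⟨hv, e⟩ := hres.1 v
      have h3 : 0 ≤ (⟪N v, v⟫_ℂ).re := by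
        have h4 := hS0 ⟨N v, hv⟩
        rw [sub_eq_iff_eq_add] at e
        rw [e, inner_add_right, inner_smul_right, inner_self_eq_norm_sq_to_K] at h4
        simpa [← Complex.ofReal_pow] using h4
      change 0 ≤ (⟪(N + star N) v, v⟫_ℂ).re
      rw [add_apply, inner_add_left, ContinuousLinearMap.star_eq_adjoint,
        ContinuousLinearMap.adjoint_inner_left, Complex.add_re]
      have h4 : (⟪v, N v⟫_ℂ).re = (⟪N v, v⟫_ℂ).re := inner_re_symm (𝕜 := ℂ) v (N v)
      rw [h4]
      exact add_nonneg h3 h3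
  rw [← h1, cfc_nonneg_iff _ _] at h2
  have h3 := h2 ζ hζ
  have h4 : 0 ≤ ζ.re := by
    have := (Complex.le_def.1 h3).1
    simp at this
    exact this
  rw [Complex.sub_re, Complex.I_re, sub_zero, Complex.inv_re]
  exact div_nonneg h4 (Complex.normSq_nonneg _)

theorem limFun_congr {f g : ℝ → ℝ} {c : ℝ} (h : ∀ t, 0 ≤ t → f t = g t) :
    limFun S f c = limFun S g c := by
  refine cfc_congr fun ζ hζ => ?_
  by_cases h0 : ζ = 0
  · simp [cayley, h0]
  · simp only [cayley, if_neg h0, h _ (nonneg_of_mem_spectrum hS hS0 hζ)]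

theorem ccFun_congr {f g : ℝ → ℝ} (h : ∀ t, 0 ≤ t → f t = g t) : ccFun S f = ccFun S g := by
  rw [ccFun_eq, ccFun_eq, limFun_congr hS hS0 h]

/-- For `t ≥ 0`, `(1 + t)⁻¹ = (t + i)⁻¹ (1 + (i - 1)(1 + t)⁻¹)`. Written as a resolvent times a
bounded operator, `(1 + S)⁻¹` is seen to map into the domain of `S`. -/
theorem limFun_inv_one_add_abs : limFun S (fun t : ℝ => (1 + |t|)⁻¹) 0 =
    resolventOp S (-Complex.I) *
      (1 + (Complex.I - 1) • limFun S (fun t : ℝ => (1 + |t|)⁻¹) 0) := by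
  have hN := isStarNormal_resolventOp hS
  have hc := continuousOn_cayley hS hasLim_inv_one_add_abs
  set N := resolventOp S (-Complex.I) with hNdef
  have h1 : cfc (fun ζ : ℂ => ζ * (1 + (Complex.I - 1) •
      cayley (fun t : ℝ => (1 + |t|)⁻¹) 0 ζ)) N =
      N * (1 + (Complex.I - 1) • limFun S (fun t : ℝ => (1 + |t|)⁻¹) 0) := by
    rw [cfc_mul (fun ζ : ℂ => ζ) _ N (by fun_prop) (by fun_prop), cfc_id' ℂ N,
      cfc_add N (fun ζ : ℂ => 1) _ (by fun_prop) (by fun_prop), cfc_const_one ℂ N,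
      cfc_smul _ _ N (by fun_prop), limFun]
  rw [← h1, limFun, ← hNdef]
  refine cfc_congr fun ζ hζ => ?_
  by_cases h : ζ = 0
  · simp [cayley, h]
  obtain ⟨t, ht, ht'⟩ := exists_real_of_mem_spectrum hS hζ h
  have ht0 := nonneg_of_mem_spectrum hS hS0 hζ
  simp only [cayley, if_neg h]
  rw [ht'] at ht0 ⊢
  rw [abs_of_nonneg ht0]
  have h3 : ζ = (t + Complex.I)⁻¹ := by rw [← ht, inv_inv]
  have h4 : (t + Complex.I : ℂ) ≠ 0 := by
    rw [← ht]; exact inv_ne_zero h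
  have h5 : (1 + t : ℂ) ≠ 0 := by
    norm_cast; positivity
  rw [h3]
  push_cast
  rw [smul_eq_mul]
  field_simp
  ring

omit hS hS0 in
theorem toLinearPMap_of_forall {E F : Type*} [AddCommGroup E] [Module ℂ E] [AddCommGroup F]
    [Module ℂ F] {G : Submodule ℂ (E × F)} (hG : ∀ v, (0, v) ∈ G → v = 0) :
    (∀ u, u ∈ G.toLinearPMap.domain ↔ ∃ v, (u, v) ∈ G) ∧
    ∀ (u : E) (hu : u ∈ G.toLinearPMap.domain) (v : F), (u, v) ∈ G → G.toLinearPMap ⟨u, hu⟩ = v := by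
  have h0 : ∀ q ∈ G, q.1 = 0 → q.2 = 0 := by
    rintro ⟨u, v⟩ h h'
    change u = 0 at h'
    subst h'
    exact hG v h
  have hg := Submodule.toLinearPMap_graph_eq G h0
  constructor
  · intro u
    rw [Submodule.toLinearPMap_domain]
    simp [Submodule.mem_map]
  · intro u hu v huv
    rw [← hg, LinearPMap.mem_graph_iff] at huv
    obtain ⟨y, hy, hy'⟩ := huv
    have : y = ⟨u, hu⟩ := Subtype.ext hy
    rw [← this]
    exact hy'

/-- Every nonnegative selfadjoint operator has a root. -/
theorem exists_isRoot : ∃ L C, IsRoot S L C := by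
  have hL := hasLim_rootFun
  have hC := hasLim_corootFun
  have hLL : limFun S rootFun 0 * limFun S rootFun 0 = limFun S (fun t : ℝ => (1 + |t|)⁻¹) 0 := by
    rw [← limFun_mul hS hL hL, mul_zero]
    simp only [rootFun_mul_self]
  have hsq : limFun S rootFun 0 * limFun S rootFun 0 + limFun S corootFun 1 * limFun S corootFun 1
      = 1 := by
    rw [hLL, ← limFun_mul hS hC hC]
    simp only [corootFun_mul_self]
    rw [← limFun_add hS hasLim_inv_one_add_abs
      (by simpa using (hasLim_const 1).sub hasLim_inv_one_add_abs)]
    have := limFun_const hS 1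
    simpa using this
  have hres := isResolventAt_resolventOp hS (z := -Complex.I) (by simp)
  have hap : ∀ f, ∃ hf : limFun S rootFun 0 (limFun S rootFun 0 f) ∈ S.domain,
      S ⟨_, hf⟩ = limFun S corootFun 1 (limFun S corootFun 1 f) := by
    intro f
    have h1 : limFun S rootFun 0 (limFun S rootFun 0 f) = resolventOp S (-Complex.I)
        (f + (Complex.I - 1) • limFun S rootFun 0 (limFun S rootFun 0 f)) := by
      have h2 := limFun_inv_one_add_abs hS hS0
      rw [← hLL] at h2
      exact congrArg (fun T : H →L[ℂ] H => T f) h2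
    obtain ⟨hf, e⟩ := hres.1 (f + (Complex.I - 1) • limFun S rootFun 0 (limFun S rootFun 0 f))
    simp only [← h1] at hf e
    refine ⟨hf, ?_⟩
    have h3 := congrArg (fun T : H →L[ℂ] H => T f) hsq
    simp only [add_apply, mul_apply_eq_comp, one_apply_eq_self] at h3
    rw [sub_eq_iff_eq_add] at e
    rw [e]
    nth_rewrite 1 [← h3]
    module
  have hcc : ∀ (g : ℝ → ℝ), Continuous g → HasCompactSupport g →
      ccFun S (fun t => g t * rootFun t) = ccFun S g * limFun S rootFun 0 ∧
      ccFun S (fun t => g t * corootFun t) = ccFun S g * limFun S corootFun 1 := fun g hg hg' =>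
    ⟨ccFun_mul_limFun hS hL hg hg', ccFun_mul_limFun hS hC hg hg'⟩
  have hcoL : ∀ (g : ℝ → ℝ), Continuous g → HasCompactSupport g →
      ccFun S (fun t => g t * Real.sqrt t) * limFun S rootFun 0 =
        ccFun S g * limFun S corootFun 1 := by
    intro g hg hg'
    rw [← (hcc (fun t => g t * Real.sqrt t) (hg.mul Real.continuous_sqrt) hg'.mul_right).1,
      ← (hcc g hg hg').2]
    refine ccFun_congr hS hS0 fun t ht => ?_
    rw [mul_assoc, sqrt_mul_rootFun ht]
  have hadd : ∀ (g g' : ℝ → ℝ), Continuous g → HasCompactSupport g → Continuous g' →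
      HasCompactSupport g' → ccFun S (fun t => g t + g' t) = ccFun S g + ccFun S g' := by
    intro g g' hg hgs hg' hgs'
    rw [ccFun_eq, ccFun_eq, ccFun_eq, ← limFun_add hS (.of_hasCompactSupport hg hgs)
      (.of_hasCompactSupport hg' hgs'), add_zero]
  have hsqrt : ∀ u v, (u, v) ∈ funGraph S Real.sqrt ↔
      ∃ f, u = limFun S rootFun 0 f ∧ v = limFun S corootFun 1 f := by
    intro u v
    constructor
    · intro huv
      have h1 : ∀ g : ℝ → ℝ, Continuous g → HasCompactSupport g →
          ccFun S (fun t => g t * Real.sqrt t) u = ccFun S g v := huv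
      -- The only candidate: `L² + C² = 1` recovers `f` from the pair `(L f, C f)` as `L (L f) + C
      -- (C f)`.
      refine ⟨limFun S rootFun 0 u + limFun S corootFun 1 v, ?_, ?_⟩
      · refine eq_of_ccFun hS fun g hg hg' => ?_
        have hg1 := hg.mul hL.1
        have hg1' := hg'.mul_right (f' := rootFun)
        rw [← mul_apply_eq_comp (ccFun S g), ← (hcc g hg hg').1, map_add, ← mul_apply_eq_comp,
          ← mul_apply_eq_comp, ← (hcc (fun t => g t * rootFun t) hg1 hg1').1,
          ← (hcc (fun t => g t * rootFun t) hg1 hg1').2,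
          ← h1 (fun t => g t * rootFun t * corootFun t) (hg1.mul hC.1) hg1'.mul_right, ← add_apply,
          ← hadd (fun t => g t * rootFun t * rootFun t)
            (fun t => g t * rootFun t * corootFun t * Real.sqrt t) (hg1.mul hL.1) hg1'.mul_right
            ((hg1.mul hC.1).mul Real.continuous_sqrt) hg1'.mul_right.mul_right]
        refine congrArg (fun T : H →L[ℂ] H => T u) (ccFun_congr hS hS0 fun t ht => ?_)
        have e1 := rootFun_mul_self t
        have e2 := corootFun_mul_self t
        have e3 := sqrt_mul_rootFun ht
        linear_combination -g t * e1 - g t * e2 - g t * corootFun t * e3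
      · refine eq_of_ccFun hS fun g hg hg' => ?_
        have hg1 := hg.mul hC.1
        have hg1' := hg'.mul_right (f' := corootFun)
        have e0 : ccFun S (fun t => g t * corootFun t * rootFun t) u =
            ccFun S (fun t => g t * rootFun t * rootFun t) v := by
          rw [← h1 (fun t => g t * rootFun t * rootFun t) ((hg.mul hL.1).mul hL.1)
            hg'.mul_right.mul_right]
          refine congrArg (fun T : H →L[ℂ] H => T u) (ccFun_congr hS hS0 fun t ht => ?_)
          have e3 := sqrt_mul_rootFun ht
          linear_combination -g t * rootFun t * e3
        rw [← mul_apply_eq_comp (ccFun S g), ← (hcc g hg hg').2, map_add, ← mul_apply_eq_comp,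
          ← mul_apply_eq_comp, ← (hcc (fun t => g t * corootFun t) hg1 hg1').1,
          ← (hcc (fun t => g t * corootFun t) hg1 hg1').2, e0, ← add_apply,
          ← hadd (fun t => g t * rootFun t * rootFun t) (fun t => g t * corootFun t * corootFun t)
            ((hg.mul hL.1).mul hL.1) hg'.mul_right.mul_right (hg1.mul hC.1) hg1'.mul_right]
        refine congrArg (fun T : H →L[ℂ] H => T v) (ccFun_congr hS hS0 fun t ht => ?_)
        have e1 := rootFun_mul_self t
        have e2 := corootFun_mul_self t
        linear_combination -g t * e1 - g t * e2
    · rintro ⟨f, rfl, rfl⟩ g hg hg'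
      exact congrArg (fun T : H →L[ℂ] H => T f) (hcoL g hg hg')
  have hgr := toLinearPMap_of_forall (G := funGraph S Real.sqrt) fun v hv => by
    refine eq_zero_of_ccFun hS fun g hg hg' => ?_
    have h1 : ccFun S _ 0 = ccFun S g v := hv g hg hg'
    rw [← h1, map_zero]
  refine ⟨limFun S rootFun 0, limFun S corootFun 1, isSelfAdjoint_limFun S _ _,
    isSelfAdjoint_limFun S _ _, limFun_comm hS hL hC, hsq, ?_, ?_, fun f hf => (hap f).2, ?_, ?_, ?_⟩
  · intro u hu
    rw [← bddFun_eq_limFun hS hL] at hu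
    refine bddFun_injective hS ⟨hL.1, 1, fun t => ?_⟩ (fun t => ?_) hu
    · rw [rootFun, abs_of_nonneg (Real.sqrt_nonneg _)]
      exact Real.sqrt_le_one.2 (inv_one_add_abs_le t)
    · exact (Real.sqrt_pos.2 (by positivity)).ne'
  · intro u
    constructor
    · intro hu
      -- Necessarily `f = (1 + S) u`. The difference `d` of `L² f` and `u` satisfies `S d = -d`, and
      -- nonnegativity of `S` forces `d = 0`.
      refine ⟨u + S ⟨u, hu⟩, ?_⟩
      set f := u + S ⟨u, hu⟩ with hf
      obtain ⟨hm, e⟩ := hap f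
      have h3 := congrArg (fun T : H →L[ℂ] H => T f) hsq
      simp only [add_apply, mul_apply_eq_comp, one_apply_eq_self] at h3
      have h4 := hS0 (⟨_, hm⟩ - ⟨u, hu⟩)
      have h5 : S (⟨_, hm⟩ - ⟨u, hu⟩) =
          -(limFun S rootFun 0 (limFun S rootFun 0 f) - u) := by
        rw [LinearPMap.map_sub, e, eq_sub_of_add_eq' hf.symm, eq_sub_of_add_eq' h3]
        abel
      rw [h5, inner_neg_right] at h4
      change 0 ≤ (-⟪limFun S rootFun 0 (limFun S rootFun 0 f) - u,
        limFun S rootFun 0 (limFun S rootFun 0 f) - u⟫_ℂ).re at h4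
      rw [inner_self_eq_norm_sq_to_K, Complex.neg_re] at h4
      have h6 : ‖limFun S rootFun 0 (limFun S rootFun 0 f) - u‖ ^ 2 ≤ 0 := by
        simpa [← Complex.ofReal_pow] using h4
      exact sub_eq_zero.1 (norm_eq_zero.1 (pow_eq_zero_iff two_ne_zero |>.1
        (le_antisymm h6 (sq_nonneg _))))
    · rintro ⟨f, rfl⟩
      exact (hap f).1
  · intro u
    rw [sqrtOp, opFun, hgr.1]
    constructor
    · rintro ⟨v, hv⟩
      obtain ⟨f, hf, -⟩ := (hsqrt u v).1 hv
      exact ⟨f, hf.symm⟩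
    · rintro ⟨f, rfl⟩
      exact ⟨_, (hsqrt _ _).2 ⟨f, rfl, rfl⟩⟩
  · intro f hf
    exact hgr.2 _ hf _ ((hsqrt _ _).2 ⟨f, rfl, rfl⟩)
  -- Write `(1 + |t|)⁻¹` as `⟨t⟩⁻¹` times `⟨t⟩ (1 + |t|)⁻¹`, the latter being at most `1`. This
  -- transfers the compactness hypothesis on `⟨S⟩⁻¹` to `L²`.
  · have hb : BddCont fun t : ℝ => (Real.sqrt (1 + t ^ 2))⁻¹ := by
      refine ⟨Continuous.inv₀ (by fun_prop) fun t => (Real.sqrt_pos.2 (by positivity)).ne', 1,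
        fun t => ?_⟩
      rw [abs_of_nonneg (by positivity)]
      exact inv_le_one_of_one_le₀ (Real.one_le_sqrt.2 (by nlinarith [sq_nonneg t]))
    have hb' : BddCont fun t : ℝ => Real.sqrt (1 + t ^ 2) * (1 + |t|)⁻¹ := by
      refine ⟨Continuous.mul (by fun_prop) hasLim_inv_one_add_abs.1, 1, fun t => ?_⟩
      rw [abs_of_nonneg (by positivity)]
      refine (div_eq_mul_inv _ _).symm.trans_le ((div_le_one (by positivity)).2 ?_)
      refine Real.sqrt_le_iff.2 ⟨by positivity, ?_⟩
      nlinarith [abs_nonneg t, sq_abs t]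
    refine ⟨bddFun S fun t : ℝ => Real.sqrt (1 + t ^ 2) * (1 + |t|)⁻¹, ?_⟩
    rw [hLL, ← bddFun_eq_limFun hS hasLim_inv_one_add_abs, japaneseInv]
    rw [← bddFun_mul hS hb hb']
    congr 1
    funext t
    rw [inv_mul_cancel_left₀ (Real.sqrt_pos.2 (by positivity)).ne']

end Root

/-! ### Resolvents expressed through the root -/

section RootResolvent

variable {H : Type*} [NormedAddCommGroup H] [InnerProductSpace ℂ H] [CompleteSpace H]
  {S : H →ₗ.[ℂ] H} {L C : H →L[ℂ] H} (hr : IsRoot S L C)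

include hr

theorem IsRoot.add_apply (f : H) : L (L f) + C (C f) = f :=
  congrArg (fun T : H →L[ℂ] H => T f) hr.sq_add_sq

theorem IsRoot.comm_apply (f : H) : L (C f) = C (L f) :=
  congrArg (fun T : H →L[ℂ] H => T f) hr.comm.eq

theorem IsRoot.mem (f : H) : L (L f) ∈ S.domain := (hr.mem_domain _).2 ⟨f, rfl⟩

theorem IsRoot.norm_sq_add (f : H) : ‖L f‖ ^ 2 + ‖C f‖ ^ 2 = ‖f‖ ^ 2 := by
  have h1 : ⟪f, L (L f)⟫_ℂ + ⟪f, C (C f)⟫_ℂ = ⟪f, f⟫_ℂ := by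
    rw [← inner_add_right, hr.add_apply]
  rw [← inner_comm_of_selfAdjoint hr.selfAdjoint_L, ← inner_comm_of_selfAdjoint hr.selfAdjoint_C,
    inner_self_eq_norm_sq_to_K, inner_self_eq_norm_sq_to_K, inner_self_eq_norm_sq_to_K] at h1
  exact_mod_cast h1

theorem IsRoot.norm_L_le (f : H) : ‖L f‖ ≤ ‖f‖ := by
  refine le_of_sq_le_sq ?_ (norm_nonneg _)
  rw [← hr.norm_sq_add f]
  exact le_add_of_nonneg_right (sq_nonneg _)

theorem IsRoot.injective_C (h0 : ∀ u : S.domain, S u = 0 → (u : H) = 0) {f : H} (hf : C f = 0) :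
    f = 0 := by
  have h1 := h0 ⟨_, hr.mem f⟩ (by rw [hr.apply, hf, map_zero])
  exact hr.injective _ (hr.injective _ h1)

/-- The bounded operator `(S - ζ²)(1 + S)⁻¹`. -/
def rootSymbol (L : H →L[ℂ] H) (ζ : ℂ) : H →L[ℂ] H := 1 - (1 + ζ ^ 2) • (L * L)

omit hr [CompleteSpace H] in
theorem rootSymbol_apply (L : H →L[ℂ] H) (ζ : ℂ) (f : H) :
    rootSymbol L ζ f = f - (1 + ζ ^ 2) • L (L f) := rfl

theorem IsRoot.rootSymbol_apply_eq (ζ : ℂ) (f : H) :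
    rootSymbol L ζ f = C (C f) - ζ ^ 2 • L (L f) := by
  rw [rootSymbol_apply]
  nth_rewrite 1 [← hr.add_apply f]
  module

open scoped ComplexOrder in
-- The spectrum of `L²` lies in `[0, 1]`. If `(1 + ζ²)⁻¹ = r` were in it, then `ζ² = r⁻¹ - 1 ≥ 0`
-- and `ζ` would be real.
theorem IsRoot.isUnit_rootSymbol {ζ : ℂ} (hζ : ζ.im ≠ 0) : IsUnit (rootSymbol L ζ) := by
  by_cases h0 : 1 + ζ ^ 2 = 0
  · rw [rootSymbol, h0, zero_smul, sub_zero]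
    exact isUnit_one
  have h1 : (1 + ζ ^ 2)⁻¹ ∉ spectrum ℂ (L * L) := by
    intro hmem
    have hpos : (0 : H →L[ℂ] H) ≤ L * L := by
      have := star_mul_self_nonneg L
      rwa [hr.selfAdjoint_L.star_eq] at this
    have h2 : (0 : ℂ) ≤ (1 + ζ ^ 2)⁻¹ := spectrum_nonneg_of_nonneg hpos hmem
    have h3 : ‖(1 + ζ ^ 2)⁻¹‖ ≤ 1 := by
      refine (spectrum.norm_le_norm_mul_of_mem hmem).trans ?_
      have h4 : ‖L * L‖ ≤ 1 := ContinuousLinearMap.opNorm_le_bound _ zero_le_one fun f => by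
        rw [one_mul]
        exact (hr.norm_L_le _).trans (hr.norm_L_le _)
      have h5 : ‖(1 : H →L[ℂ] H)‖ ≤ 1 := ContinuousLinearMap.norm_id_le
      nlinarith [norm_nonneg (L * L), norm_nonneg (1 : H →L[ℂ] H)]
    obtain ⟨r, hr0, e⟩ : ∃ r : ℝ, 0 ≤ r ∧ (1 + ζ ^ 2)⁻¹ = (r : ℂ) := by
      refine ⟨((1 + ζ ^ 2)⁻¹).re, (Complex.le_def.1 h2).1, ?_⟩
      exact Complex.ext rfl (Complex.le_def.1 h2).2.symm
    rw [e, Complex.norm_real, Real.norm_of_nonneg hr0] at h3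
    have e' : 1 + ζ ^ 2 = ((r⁻¹ : ℝ) : ℂ) := by
      rw [Complex.ofReal_inv, ← e, inv_inv]
    have hr1 : r ≠ 0 := by
      rintro rfl
      exact h0 (by simpa using e')
    have h6 : 1 ≤ r⁻¹ := (one_le_inv₀ (lt_of_le_of_ne hr0 hr1.symm)).2 h3
    have hre := congrArg Complex.re e'
    have him := congrArg Complex.im e'
    simp [pow_two] at hre him
    rcases mul_eq_zero.1 (show ζ.re * ζ.im = 0 by linarith) with h7 | h7
    · rw [h7] at hre
      have := mul_self_pos.2 hζ
      linarith
    · exact hζ h7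
  rw [spectrum.notMem_iff, Algebra.algebraMap_eq_smul_one] at h1
  rw [← isUnit_smul_iff_of_ne_zero (c := (1 + ζ ^ 2)⁻¹) (inv_ne_zero h0), rootSymbol, smul_sub,
    smul_smul, inv_mul_cancel₀ h0, one_smul]
  exact h1

theorem IsRoot.isResolventAt {ζ : ℂ} (hζ : ζ.im ≠ 0) :
    IsResolventAt S (ζ ^ 2) (L * L * Ring.inverse (rootSymbol L ζ)) := by
  have hu := hr.isUnit_rootSymbol hζ
  have e : ∀ f, S ⟨_, hr.mem f⟩ - ζ ^ 2 • L (L f) = rootSymbol L ζ f := fun f => by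
    rw [hr.apply, hr.rootSymbol_apply_eq]
  constructor
  · intro f
    refine ⟨hr.mem _, ?_⟩
    refine (e _).trans ?_
    exact congrArg (fun T : H →L[ℂ] H => T f) (Ring.mul_inverse_cancel _ hu)
  · rintro ⟨u, hud⟩
    obtain ⟨f, rfl⟩ := (hr.mem_domain u).1 hud
    rw [e]
    change L (L (Ring.inverse (rootSymbol L ζ) (rootSymbol L ζ f))) = L (L f)
    rw [show Ring.inverse (rootSymbol L ζ) (rootSymbol L ζ f) = f from
      congrArg (fun T : H →L[ℂ] H => T f) (Ring.inverse_mul_cancel _ hu)]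

theorem IsRoot.resolventOp_eq {ζ : ℂ} (hζ : ζ.im ≠ 0) :
    resolventOp S (ζ ^ 2) = L * L * Ring.inverse (rootSymbol L ζ) :=
  (hr.isResolventAt hζ).resolventOp_eq

/-- Resolvent bounds far from the spectrum. -/
theorem IsRoot.norm_resolvent_le {ζ : ℂ} {m : ℝ} (hm : 0 < m) (hζm : (-ζ ^ 2).re = m) (f : H) :
    m * ‖L (L f)‖ ≤ ‖rootSymbol L ζ f‖ ∧ m * ‖C (L f)‖ ^ 2 ≤ ‖rootSymbol L ζ f‖ ^ 2 := by
  -- The real part of this pairing is `‖C L f‖² + m ‖L² f‖²`, and Cauchy-Schwarz yields both bounds.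
  have e1 : ⟪L (L f), rootSymbol L ζ f⟫_ℂ = ⟪C (L f), C (L f)⟫_ℂ +
      (-ζ ^ 2) * ⟪L (L f), L (L f)⟫_ℂ := by
    rw [hr.rootSymbol_apply_eq, inner_sub_right, inner_smul_right,
      ← inner_comm_of_selfAdjoint hr.selfAdjoint_C (L (L f)) (C f),
      inner_comm_of_selfAdjoint hr.selfAdjoint_C (L f) (C (L f)),
      inner_comm_of_selfAdjoint hr.selfAdjoint_C (L (L f)) (C f),
      inner_comm_of_selfAdjoint hr.selfAdjoint_L (L f) (C (C f)), hr.comm_apply, hr.comm_apply]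
    ring
  have e2 : ‖C (L f)‖ ^ 2 + m * ‖L (L f)‖ ^ 2 ≤ ‖L (L f)‖ * ‖rootSymbol L ζ f‖ := by
    refine le_trans (le_of_eq ?_) (re_inner_le_norm (𝕜 := ℂ) _ _)
    rw [e1, inner_self_eq_norm_sq_to_K, inner_self_eq_norm_sq_to_K, ← hζm]
    simp [← Complex.ofReal_pow]
  have h1 : m * ‖L (L f)‖ ≤ ‖rootSymbol L ζ f‖ := by
    rcases (norm_nonneg (L (L f))).eq_or_lt with h0 | h0
    · rw [← h0, mul_zero]; exact norm_nonneg _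
    · refine le_of_mul_le_mul_left ?_ h0
      nlinarith [sq_nonneg ‖C (L f)‖]
  refine ⟨h1, ?_⟩
  have h2 : ‖C (L f)‖ ^ 2 ≤ ‖L (L f)‖ * ‖rootSymbol L ζ f‖ := by
    nlinarith [sq_nonneg ‖L (L f)‖]
  nlinarith [norm_nonneg (rootSymbol L ζ f)]

omit hr in
theorem analyticAt_rootSymbol (L : H →L[ℂ] H) (ζ : ℂ) :
    AnalyticAt ℂ (rootSymbol L) ζ := by
  unfold rootSymbol
  fun_prop (disch := simp)

end RootResolvent

/-! ### The parametrix at one end -/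

section Ends

variable {H : Type*} [NormedAddCommGroup H] [InnerProductSpace ℂ H] [CompleteSpace H]

omit [CompleteSpace H] in
theorem isCompactOperator_mul_left {A : H →L[ℂ] H} (hA : IsCompactOperator A) (B : H →L[ℂ] H) :
    IsCompactOperator (B * A) := hA.clm_comp B

omit [CompleteSpace H] in
theorem isCompactOperator_mul_right {A : H →L[ℂ] H} (hA : IsCompactOperator A) (B : H →L[ℂ] H) :
    IsCompactOperator (A * B) := hA.comp_clm B

omit [CompleteSpace H] in
theorem isCompactOperator_add {A B : H →L[ℂ] H} (hA : IsCompactOperator A)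
    (hB : IsCompactOperator B) : IsCompactOperator (A + B : H →L[ℂ] H) := hA.add hB

/-- The quadratic pencil `h₀ - (k - z)²`, multiplied by `L₀ = (1 + h₀)^{-1/2}` on both sides. -/
def pencil (L₀ k : H →L[ℂ] H) (z : ℂ) : H →L[ℂ] H :=
  1 - L₀ * ((1 + (k - z • 1) * (k - z • 1)) * L₀)

/-- The quadratic pencil `h₀ - (k - z)²`, multiplied by `L₀²` on the right. -/
def rightPencil (L₀ k : H →L[ℂ] H) (z : ℂ) : H →L[ℂ] H :=
  1 - (1 + (k - z • 1) * (k - z • 1)) * (L₀ * L₀)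

/-- Bounded operators which describe one asymptotic end: `L`, `C` is the root of the comparison
operator `S`, `i` the cutoff, `κ` the charge, `D = [h, i] (1 + S)⁻¹`, and `F` the continuation of the
weighted resolvent of `S`. -/
structure EndData (k L₀ V : H →L[ℂ] H) (ℓ : ℝ) where
  (S : H →ₗ.[ℂ] H)
  (L C i κ D Θ Θ' B τ : H →L[ℂ] H)
  (F : ℂ → H →L[ℂ] H)
  (δ : ℝ)
  isRoot : IsRoot S L C
  comm_charge : Commute i κ
  comm_weight : Commute i V
  charge : k * i = (κ + (ℓ : ℂ) • 1) * i
  charge_eq : κ = V * V * τ * (V * V)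
  -- This encodes `(1 + h₀) i = i (1 + S + κ²) + [h, i]`, applied to `L² = (1 + S)⁻¹`; the
  -- commutators of `i` with `h` and `h₀` agree because `i` commutes with `k`.
  transport : i * (L * L) = L₀ * L₀ * (i * (1 + κ * κ * (L * L)) + D)
  comm_eq : D = Θ' * (C * L)
  -- With `W = V² = w⁻¹` and `Θ` in the role of `w [h, i] w S^{-1/2}`, this is `D = W Θ S^{1/2} W
  -- L²`, where commuting `W` past `L²` gives `S^{1/2} W L² = C L W + C² B V L²`.
  comm_weight_eq : D = V * V * Θ * (C * L * (V * V) + C * C * B * (V * (L * L)))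
  compact₁ : IsCompactOperator (V * (L * L))
  compact₂ : IsCompactOperator (L * (V * V))
  δ_pos : 0 < δ
  F_mero : ∀ z : ℂ, -δ < z.im → FinMero F z
  F_compact : ∀ z : ℂ, -δ < z.im → IsCompactOperator (F z)
  F_eq : ∀ z : ℂ, 0 < z.im → F z = V * (L * L * Ring.inverse (rootSymbol L z)) * V

namespace EndData

variable {k L₀ V : H →L[ℂ] H} {ℓ : ℝ} (e : EndData k L₀ V ℓ)

/-- The inverse of the shifted symbol. -/
def R (z : ℂ) : H →L[ℂ] H := Ring.inverse (rootSymbol e.L (z - ℓ))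

/-- The contribution of the end to the parametrix. -/
def Q (z : ℂ) : H →L[ℂ] H := (e.i * (1 + e.κ * e.κ * (e.L * e.L)) + e.D) * e.R z * e.i

/-- The contribution of the end to the remainder. -/
def K (z : ℂ) : H →L[ℂ] H :=
  e.D * e.R z * e.i + (2 * (z - ℓ)) • (e.κ * e.i * (e.L * e.L) * e.R z * e.i)

/-- The contribution of the end to the weighted remainder. -/
def Kw (z : ℂ) : H →L[ℂ] H :=
  V * e.Θ * e.C * (e.L * (V * V)) * (V * e.i) +
    ((1 + (z - ℓ) ^ 2) • (V * e.Θ * e.C * e.L * V) + V * e.Θ * e.C * e.C * e.B +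
      (2 * (z - ℓ)) • (V * e.τ * V * e.i)) * (e.F (z - ℓ) * e.i)

theorem isUnit_symbol {z : ℂ} (hz : z.im ≠ 0) : IsUnit (rootSymbol e.L (z - ℓ)) :=
  e.isRoot.isUnit_rootSymbol (by simpa using hz)

theorem symbol_mul_R {z : ℂ} (hz : z.im ≠ 0) : rootSymbol e.L (z - ℓ) * e.R z = 1 :=
  Ring.mul_inverse_cancel _ (e.isUnit_symbol hz)

/-- On the range of `i`, `k - z` acts as `κ - (z - ℓ)`, so the pencil becomes `S - (z - ℓ)² + 2(z -
ℓ)κ`. By `transport`, `L₀² Q = i L² R i`, where `L² R` is the resolvent of `S` at `(z - ℓ)²`. The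
leading part gives `i²`; the commutator and the charge term form `K`. -/
theorem pencil_mul_Q {z : ℂ} (hz : z.im ≠ 0) :
    rightPencil L₀ k z * e.Q z = e.i * e.i + e.K z := by
  have h1 : ∀ v, (k - z • (1 : H →L[ℂ] H)) (e.i v) = e.i (e.κ v - (z - ℓ) • v) := fun v => by
    have h2 : k (e.i v) = e.κ (e.i v) + (ℓ : ℂ) • e.i v :=
      congrArg (fun T : H →L[ℂ] H => T v) e.charge
    have h3 : e.i (e.κ v) = e.κ (e.i v) :=
      congrArg (fun T : H →L[ℂ] H => T v) e.comm_charge.eq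
    rw [sub_apply, h2, map_sub, map_smul, h3]
    simp only [smul_apply, one_apply_eq_self]
    module
  have h4 : ∀ g, rightPencil L₀ k z ((e.i * (1 + e.κ * e.κ * (e.L * e.L)) + e.D) g) =
      e.D g + e.i (rootSymbol e.L (z - ℓ) g) +
        (2 * (z - ℓ)) • e.κ (e.i (e.L (e.L g))) := fun g => by
    have h5 : L₀ (L₀ ((e.i * (1 + e.κ * e.κ * (e.L * e.L)) + e.D) g)) = e.i (e.L (e.L g)) :=
      (congrArg (fun T : H →L[ℂ] H => T g) e.transport).symm
    have h3 : e.i (e.κ (e.L (e.L g))) = e.κ (e.i (e.L (e.L g))) :=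
      congrArg (fun T : H →L[ℂ] H => T (e.L (e.L g))) e.comm_charge.eq
    rw [rightPencil, sub_apply, one_apply_eq_self, mul_apply_eq_comp, mul_apply_eq_comp L₀, h5,
      add_apply 1, mul_apply_eq_comp (k - _), h1, h1, rootSymbol_apply, ← h3]
    simp only [add_apply, mul_apply_eq_comp, one_apply_eq_self, map_add, map_sub, map_smul]
    module
  ext f
  rw [mul_apply_eq_comp, Q, mul_apply_eq_comp, mul_apply_eq_comp, h4]
  have h6 : rootSymbol e.L (z - ℓ) (e.R z (e.i f)) = e.i f :=
    congrArg (fun T : H →L[ℂ] H => T (e.i f)) (e.symbol_mul_R hz)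
  rw [h6]
  simp only [K, add_apply, mul_apply_eq_comp, smul_apply]
  abel

theorem analyticAt_R {z : ℂ} (hz : z.im ≠ 0) : AnalyticAt ℂ e.R z := by
  have h1 : AnalyticAt ℂ (fun z : ℂ => rootSymbol e.L (z - ℓ)) z :=
    (analyticAt_rootSymbol e.L (z - ℓ)).comp_of_eq (by fun_prop) rfl
  obtain ⟨u, hu⟩ := e.isUnit_symbol hz
  exact (analyticAt_inverse u).comp_of_eq h1 hu.symm

theorem analyticAt_Q {z : ℂ} (hz : z.im ≠ 0) : AnalyticAt ℂ e.Q z := by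
  unfold Q
  exact (analyticAt_const.mul (e.analyticAt_R hz)).mul analyticAt_const

theorem analyticAt_K {z : ℂ} (hz : z.im ≠ 0) : AnalyticAt ℂ e.K z := by
  unfold K
  have h := e.analyticAt_R hz
  have h2 : AnalyticAt ℂ (fun z : ℂ => 2 * (z - ℓ)) z := by fun_prop
  exact ((analyticAt_const.mul h).mul analyticAt_const).add
    (h2.smul ((analyticAt_const.mul h).mul analyticAt_const))

theorem isCompactOperator_D : IsCompactOperator e.D := by
  have h1 : IsCompactOperator (e.C * e.L * (V * V) : H →L[ℂ] H) := by
    rw [mul_assoc]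
    exact isCompactOperator_mul_left e.compact₂ e.C
  have h2 := isCompactOperator_mul_left e.compact₁ (e.C * e.C * e.B)
  have h3 := isCompactOperator_mul_left (isCompactOperator_add h1 h2) (V * V * e.Θ)
  rwa [← e.comm_weight_eq] at h3

theorem isCompactOperator_charge : IsCompactOperator (e.κ * e.i * (e.L * e.L)) := by
  have h : e.κ * e.i * (e.L * e.L) = V * V * e.τ * V * e.i * (V * (e.L * e.L)) := by
    nth_rewrite 1 [e.charge_eq]
    simp only [mul_assoc]
    rw [← mul_assoc V e.i, ← e.comm_weight.eq, mul_assoc]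
  rw [h]
  exact isCompactOperator_mul_left e.compact₁ _

theorem isCompactOperator_K (z : ℂ) : IsCompactOperator (e.K z) := by
  have h1 : IsCompactOperator (e.D * e.R z * e.i : H →L[ℂ] H) :=
    (e.isCompactOperator_D.comp_clm (e.R z)).comp_clm e.i
  have h2 : IsCompactOperator (e.κ * e.i * (e.L * e.L) * e.R z * e.i : H →L[ℂ] H) :=
    (e.isCompactOperator_charge.comp_clm (e.R z)).comp_clm e.i
  exact h1.add (h2.smul (2 * (z - ℓ)))

/-- The remainder is small far away on the imaginary axis. -/
theorem exists_norm_K_le : ∃ c : ℝ, ∀ y : ℝ, |ℓ| < |y| →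
    ‖e.K (y * Complex.I)‖ ≤ c / (|y| - |ℓ|) := by
  refine ⟨‖e.Θ'‖ * ‖e.i‖ + 2 * (‖e.κ‖ * ‖e.i‖ * ‖e.i‖), fun y hy => ?_⟩
  have hd : 0 < |y| - |ℓ| := sub_pos.2 hy
  have hy0 : y ≠ 0 := by
    rintro rfl
    rw [abs_zero] at hy
    exact absurd hy (abs_nonneg _).not_gt
  have hz : (y * Complex.I : ℂ).im ≠ 0 := by simpa using hy0
  set z : ℂ := y * Complex.I with hzdef
  -- At `z = iy`, the resolvent of `S` at `(z - ℓ)²` is bounded by the inverse of `y² - ℓ² = (|y| -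
  -- |ℓ|)(|y| + |ℓ|)`. The second factor absorbs the coefficient `|z - ℓ| ≤ |y| + |ℓ|` of the charge
  -- term.
  have hm : (-(z - ℓ) ^ 2).re = y ^ 2 - ℓ ^ 2 := by
    simp [hzdef, pow_two]
  have hfac : y ^ 2 - ℓ ^ 2 = (|y| - |ℓ|) * (|y| + |ℓ|) := by
    rw [← sq_abs y, ← sq_abs ℓ]; ring
  have hm0 : 0 < y ^ 2 - ℓ ^ 2 := by
    rw [hfac]
    exact mul_pos hd (by linarith [abs_nonneg ℓ])
  have hzl : ‖z - ℓ‖ ≤ |y| + |ℓ| := by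
    refine (norm_sub_le _ _).trans (le_of_eq ?_)
    simp [hzdef]
  have hR : ∀ f, ‖e.L (e.L (e.R z f))‖ * (y ^ 2 - ℓ ^ 2) ≤ ‖f‖ ∧
      ‖e.C (e.L (e.R z f))‖ * (|y| - |ℓ|) ≤ ‖f‖ := fun f => by
    obtain ⟨h1, h2⟩ := e.isRoot.norm_resolvent_le hm0 hm (e.R z f)
    have h3 : rootSymbol e.L (z - ℓ) (e.R z f) = f :=
      congrArg (fun T : H →L[ℂ] H => T f) (e.symbol_mul_R hz)
    rw [h3] at h1 h2
    refine ⟨by linarith, le_of_sq_le_sq (le_trans ?_ h2) (norm_nonneg _)⟩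
    rw [mul_pow, mul_comm, hfac]
    refine mul_le_mul_of_nonneg_right ?_ (sq_nonneg _)
    nlinarith [abs_nonneg ℓ]
  refine ContinuousLinearMap.opNorm_le_bound _ (by positivity) fun f => ?_
  rw [div_mul_eq_mul_div, le_div_iff₀ hd]
  obtain ⟨h1, h2⟩ := hR (e.i f)
  have h3 : e.K z f = e.Θ' (e.C (e.L (e.R z (e.i f)))) +
      (2 * (z - ℓ)) • e.κ (e.i (e.L (e.L (e.R z (e.i f))))) := by
    rw [K, e.comm_eq]; rfl
  set a := ‖e.C (e.L (e.R z (e.i f)))‖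
  set b := ‖e.L (e.L (e.R z (e.i f)))‖ with hb
  have h4 : ‖e.K z f‖ ≤ ‖e.Θ'‖ * a + 2 * (|y| + |ℓ|) * (‖e.κ‖ * (‖e.i‖ * b)) := by
    rw [h3]
    refine (norm_add_le _ _).trans (add_le_add (e.Θ'.le_opNorm _) ?_)
    rw [norm_smul, norm_mul]
    refine mul_le_mul ?_ ((e.κ.le_opNorm _).trans
      (mul_le_mul_of_nonneg_left (e.i.le_opNorm _) (norm_nonneg _))) (norm_nonneg _) (by positivity)
    rw [Complex.norm_ofNat]
    linarith
  have h5 := e.i.le_opNorm f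
  have h6 : b * (|y| + |ℓ|) * (|y| - |ℓ|) ≤ ‖e.i‖ * ‖f‖ := by
    rw [hfac] at h1
    linarith
  have h7 : a * (|y| - |ℓ|) ≤ ‖e.i‖ * ‖f‖ := h2.trans h5
  calc ‖e.K z f‖ * (|y| - |ℓ|) ≤
      (‖e.Θ'‖ * a + 2 * (|y| + |ℓ|) * (‖e.κ‖ * (‖e.i‖ * b))) * (|y| - |ℓ|) :=
        mul_le_mul_of_nonneg_right h4 hd.le
    _ = ‖e.Θ'‖ * (a * (|y| - |ℓ|)) +
        2 * (‖e.κ‖ * ‖e.i‖) * (b * (|y| + |ℓ|) * (|y| - |ℓ|)) := by ring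
    _ ≤ ‖e.Θ'‖ * (‖e.i‖ * ‖f‖) + 2 * (‖e.κ‖ * ‖e.i‖) * (‖e.i‖ * ‖f‖) := by gcongr
    _ = _ := by ring

/-- The bare resolvent in `K` is not assumed to continue across the real axis. But `D` and `κ` carry
weights, and after the substitution `R = 1 + (1 + (z - ℓ)²) L² R` the resolvent appears in `K V`
only through `V L² R V = F(z - ℓ)`, with a spare `V` on the left. -/
theorem K_mul_V {z : ℂ} (hz : 0 < z.im) : e.K z * V = V * e.Kw z := by
  have hF : e.F (z - ℓ) = V * (e.L * e.L * e.R z) * V := e.F_eq _ (by simpa using hz)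
  ext f
  have h1 : e.i (V f) = V (e.i f) := congrArg (fun T : H →L[ℂ] H => T f) e.comm_weight.eq
  set g := e.i f with hg
  set u := e.R z (V g) with hu
  have h2 : V (e.L (e.L u)) = e.F (z - ℓ) g := by rw [hF]; rfl
  have h3 : u = V g + (1 + (z - ℓ) ^ 2) • e.L (e.L u) := by
    have h4 : rootSymbol e.L (z - ℓ) u = V g :=
      congrArg (fun T : H →L[ℂ] H => T (V g)) (e.symbol_mul_R hz.ne')
    rw [rootSymbol_apply] at h4
    rw [← h4, sub_add_cancel]
  have h5 : V (V u) = V (V (V g)) + (1 + (z - ℓ) ^ 2) • V (e.F (z - ℓ) g) := by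
    rw [h3, map_add, map_add, map_smul, map_smul, h2]
  have h6 : e.D u = V (V (e.Θ (e.C (e.L (V (V u))) + e.C (e.C (e.B (V (e.L (e.L u)))))))) :=
    congrArg (fun T : H →L[ℂ] H => T u) e.comm_weight_eq
  have h7 : e.κ (e.i (e.L (e.L u))) = V (V (e.τ (V (e.i (e.F (z - ℓ) g))))) := by
    have h8 : ∀ v, e.κ v = V (V (e.τ (V (V v)))) := fun v =>
      congrArg (fun T : H →L[ℂ] H => T v) e.charge_eq
    have h9 : V (e.i (e.L (e.L u))) = e.i (V (e.L (e.L u))) :=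
      (congrArg (fun T : H →L[ℂ] H => T (e.L (e.L u))) e.comm_weight.eq).symm
    rw [h8, h9, h2]
  have h10 : e.K z (V f) = e.D u + (2 * (z - ℓ)) • e.κ (e.i (e.L (e.L u))) := by
    rw [hu, ← h1]; rfl
  rw [mul_apply_eq_comp, h10, h6, h5, h7, h2]
  simp only [Kw, mul_apply_eq_comp, add_apply, smul_apply, map_add, map_smul, ← hg]
  abel

theorem isCompactOperator_Kw {z : ℂ} (hz : -e.δ < z.im) : IsCompactOperator (e.Kw z) := by
  have h1 : IsCompactOperator (V * e.Θ * e.C * (e.L * (V * V)) * (V * e.i) : H →L[ℂ] H) :=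
    (e.compact₂.clm_comp (V * e.Θ * e.C)).comp_clm (V * e.i)
  have h2 : IsCompactOperator (e.F (z - ℓ) * e.i : H →L[ℂ] H) :=
    (e.F_compact (z - ℓ) (by simpa using hz)).comp_clm e.i
  exact isCompactOperator_add h1 (isCompactOperator_mul_left h2 _)

theorem finMero_Kw {z : ℂ} (hz : -e.δ < z.im) : FinMero e.Kw z := by
  have h1 : FinMero (fun z => e.F (z - ℓ)) z := (e.F_mero (z - ℓ) (by simpa using hz)).comp_sub
  have h2 := h1.comp_clm (L := fun _ => e.i) analyticAt_const
  have h3 : AnalyticAt ℂ (fun z : ℂ => (1 + (z - ℓ) ^ 2) • (V * e.Θ * e.C * e.L * V) +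
      V * e.Θ * e.C * e.C * e.B + (2 * (z - ℓ)) • (V * e.τ * V * e.i)) z := by
    have h4 : AnalyticAt ℂ (fun z : ℂ => 1 + (z - ℓ) ^ 2) z := by fun_prop
    have h5 : AnalyticAt ℂ (fun z : ℂ => 2 * (z - ℓ)) z := by fun_prop
    exact ((h4.smul analyticAt_const).add analyticAt_const).add (h5.smul analyticAt_const)
  exact (FinMero.of_analyticAt analyticAt_const).add (h2.clm_comp h3)

end EndData

end Ends

/-! ### Gluing the two ends: inverse of the pencil and its singular points -/

section TwoEndsPencil

variable {H : Type*} [NormedAddCommGroup H] [InnerProductSpace ℂ H] [CompleteSpace H]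
  {k L₀ V : H →L[ℂ] H} {ℓ₁ ℓ₂ : ℝ}

theorem star_pencil (hL : IsSelfAdjoint L₀) (hk : IsSelfAdjoint k) (z : ℂ) :
    star (pencil L₀ k (star z)) = pencil L₀ k z := by
  simp only [pencil, star_sub, star_mul, star_add, star_one, star_smul, star_star, hL.star_eq,
    hk.star_eq, mul_assoc]

theorem isUnit_pencil_star (hL : IsSelfAdjoint L₀) (hk : IsSelfAdjoint k) {z : ℂ} :
    IsUnit (pencil L₀ k (star z)) ↔ IsUnit (pencil L₀ k z) := by
  rw [← star_pencil hL hk z, isUnit_star]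

theorem analyticAt_pencil (L₀ k : H →L[ℂ] H) (z : ℂ) : AnalyticAt ℂ (pencil L₀ k) z := by
  have h1 : AnalyticAt ℂ (fun z : ℂ => k - z • (1 : H →L[ℂ] H)) z :=
    analyticAt_const.sub (analyticAt_id.smul analyticAt_const)
  exact analyticAt_const.sub (analyticAt_const.mul ((analyticAt_const.add (h1.mul h1)).mul
    analyticAt_const))

omit [CompleteSpace H] in
/-- A right inverse of the pencil from one of the pencil multiplied on the right. -/
theorem pencil_mul_eq_one {z : ℂ} {T : H →L[ℂ] H} (hT : rightPencil L₀ k z * T = 1) :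
    pencil L₀ k z * (1 + L₀ * T * ((1 + (k - z • 1) * (k - z • 1)) * L₀)) = 1 := by
  set Y := (1 + (k - z • 1) * (k - z • 1)) * L₀ with hY
  have h1 : (1 - Y * L₀) * T = 1 := by
    rw [hY, mul_assoc _ L₀ L₀]
    exact hT
  have h2 : T - Y * L₀ * T = 1 := by
    rwa [sub_mul, one_mul] at h1
  have h3 : pencil L₀ k z = 1 - L₀ * Y := rfl
  calc pencil L₀ k z * (1 + L₀ * T * Y) = 1 - L₀ * Y + L₀ * (T - Y * L₀ * T) * Y := by
        rw [h3]; noncomm_ring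
    _ = 1 := by rw [h2]; noncomm_ring

variable (e₁ : EndData k L₀ V ℓ₁) (e₂ : EndData k L₀ V ℓ₂)

theorem exists_far_norm_lt : ∃ Y : ℝ, 0 < Y ∧ ∀ y : ℝ, Y ≤ |y| →
    ‖e₁.K (y * Complex.I) + e₂.K (y * Complex.I)‖ < 1 := by
  obtain ⟨c₁, h₁⟩ := e₁.exists_norm_K_le
  obtain ⟨c₂, h₂⟩ := e₂.exists_norm_K_le
  have a1 := abs_nonneg ℓ₁
  have a2 := abs_nonneg ℓ₂
  have a3 := abs_nonneg c₁
  have a4 := abs_nonneg c₂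
  refine ⟨|ℓ₁| + |ℓ₂| + 2 * |c₁| + 2 * |c₂| + 1, by positivity, fun y hy => ?_⟩
  have b1 : ∀ c ℓ : ℝ, 0 < |y| - |ℓ| → 2 * |c| < |y| - |ℓ| → c / (|y| - |ℓ|) < 1 / 2 := by
    intro c ℓ h0 h
    rw [div_lt_iff₀ h0]
    linarith [le_abs_self c]
  have b2 := (h₁ y (by linarith)).trans_lt (b1 c₁ ℓ₁ (by linarith) (by linarith))
  have b3 := (h₂ y (by linarith)).trans_lt (b1 c₂ ℓ₂ (by linarith) (by linarith))
  linarith [norm_add_le (e₁.K (y * Complex.I)) (e₂.K (y * Complex.I))]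

theorem exists_far_isUnit : ∃ Y : ℝ, 0 < Y ∧ ∀ y : ℝ, Y ≤ |y| →
    ∀ᶠ z in 𝓝 (y * Complex.I : ℂ), IsUnit (1 + (e₁.K z + e₂.K z)) := by
  obtain ⟨Y, hY, h⟩ := exists_far_norm_lt e₁ e₂
  refine ⟨Y, hY, fun y hy => ?_⟩
  have hy0 : y ≠ 0 := by
    rintro rfl
    rw [abs_zero] at hy
    linarith
  have hz : (y * Complex.I : ℂ).im ≠ 0 := by simpa using hy0
  have hc : ContinuousAt (fun z => ‖e₁.K z + e₂.K z‖) (y * Complex.I : ℂ) :=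
    ((e₁.analyticAt_K hz).continuousAt.add (e₂.analyticAt_K hz).continuousAt).norm
  filter_upwards [hc.eventually_lt_const (h y hy)] with z hz
  have h1 : ‖-(e₁.K z + e₂.K z)‖ < 1 := by rwa [norm_neg]
  have h2 := isUnit_one_sub_of_norm_lt_one h1
  rwa [sub_neg_eq_add] at h2

/-- The remainder is compact, holomorphic off the real axis, and of norm less than `1` far out on
the imaginary axis, so the meromorphic Fredholm theorem applies in the half plane containing `z₀`.
-/
theorem finMero_inverse_remainder {z₀ : ℂ} (hz₀ : z₀.im ≠ 0) :
    (∀ᶠ z in 𝓝[≠] z₀, IsUnit (1 + (e₁.K z + e₂.K z))) ∧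
      FinMero (fun z => Ring.inverse (1 + (e₁.K z + e₂.K z))) z₀ := by
  obtain ⟨Y, hY, h⟩ := exists_far_isUnit e₁ e₂
  have key : ∀ U : Set ℂ, IsOpen U → Convex ℝ U → (∀ z ∈ U, z.im ≠ 0) → ∀ y : ℝ,
      (y * Complex.I : ℂ) ∈ U → Y ≤ |y| → z₀ ∈ U → _ := fun U hU hUc hU0 y hy hyY hz =>
    finMero_inverse_one_add (F := fun z => e₁.K z + e₂.K z) hU hUc.isPreconnected
      (fun z hz => .of_analyticAt ((e₁.analyticAt_K (hU0 z hz)).add (e₂.analyticAt_K (hU0 z hz))))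
      (fun z _ => isCompactOperator_add (e₁.isCompactOperator_K z) (e₂.isCompactOperator_K z))
      hy ((h y hyY).filter_mono nhdsWithin_le_nhds) z₀ hz
  rcases lt_or_gt_of_ne hz₀ with hneg | hpos
  · refine key {z | z.im < 0} (isOpen_lt Complex.continuous_im continuous_const)
      (convex_halfSpace_im_lt 0) (fun z hz => (show z.im < 0 from hz).ne) (-Y) ?_ ?_ hneg
    · simpa using hY
    · rw [abs_neg]; exact le_abs_self Y
  · exact key {z | 0 < z.im} (isOpen_lt continuous_const Complex.continuous_im)
      (convex_halfSpace_im_gt 0) (fun z hz => (show 0 < z.im from hz).ne') Y (by simpa using hY)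
      (le_abs_self Y) hpos

theorem tendsto_star_nhdsNE (z₀ : ℂ) : Tendsto (star : ℂ → ℂ) (𝓝[≠] z₀) (𝓝[≠] (star z₀)) :=
  tendsto_nhdsWithin_of_tendsto_nhds_of_eventually_within _
    (continuous_star.continuousAt.tendsto.mono_left nhdsWithin_le_nhds)
    (by filter_upwards [self_mem_nhdsWithin] with z hz using star_injective.ne hz)

variable (hi : e₁.i * e₁.i + e₂.i * e₂.i = 1)

include hi

theorem rightPencil_mul {z : ℂ} (hz : z.im ≠ 0) :
    rightPencil L₀ k z * (e₁.Q z + e₂.Q z) = 1 + (e₁.K z + e₂.K z) := by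
  rw [mul_add, e₁.pencil_mul_Q hz, e₂.pencil_mul_Q hz, ← hi]
  abel

/-- The inverse of the pencil is finite meromorphic off the real axis. -/
theorem finMero_inverse_pencil (hL : IsSelfAdjoint L₀) (hk : IsSelfAdjoint k) {z₀ : ℂ}
    (hz₀ : z₀.im ≠ 0) : (∀ᶠ z in 𝓝[≠] z₀, IsUnit (pencil L₀ k z)) ∧
      FinMero (fun z => Ring.inverse (pencil L₀ k z)) z₀ := by
  obtain ⟨hu, hm⟩ := finMero_inverse_remainder e₁ e₂ hz₀
  have hz₀' : (star z₀).im ≠ 0 := by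
    change -z₀.im ≠ 0
    exact neg_ne_zero.2 hz₀
  have hu' := (tendsto_star_nhdsNE z₀).eventually (finMero_inverse_remainder e₁ e₂ hz₀').1
  have him : ∀ᶠ z : ℂ in 𝓝[≠] z₀, z.im ≠ 0 :=
    (Complex.continuous_im.continuousAt.eventually_ne hz₀).filter_mono nhdsWithin_le_nhds
  let T : ℂ → H →L[ℂ] H := fun z =>
    (e₁.Q z + e₂.Q z) * Ring.inverse (1 + (e₁.K z + e₂.K z))
  let G : ℂ → H →L[ℂ] H := fun z => 1 + L₀ * T z * ((1 + (k - z • 1) * (k - z • 1)) * L₀)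
  have hG : ∀ z : ℂ, z.im ≠ 0 → IsUnit (1 + (e₁.K z + e₂.K z)) → pencil L₀ k z * G z = 1 := by
    intro z hz h
    refine pencil_mul_eq_one ?_
    rw [← mul_assoc, rightPencil_mul e₁ e₂ hi hz, Ring.mul_inverse_cancel _ h]
  -- The parametrix yields only a right inverse. The adjoint of the right inverse at `star z` is a
  -- left inverse at `z`.
  have hinv : ∀ᶠ z in 𝓝[≠] z₀, pencil L₀ k z * G z = 1 ∧ G z * pencil L₀ k z = 1 := by
    filter_upwards [hu, hu', him] with z h1 h2 h3
    have h4 := hG z h3 h1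
    have h5 := hG (star z) (by change -z.im ≠ 0; exact neg_ne_zero.2 h3) h2
    have h6 := congrArg star h5
    rw [star_mul, star_pencil hL hk, star_one] at h6
    refine ⟨h4, ?_⟩
    rwa [left_inv_eq_right_inv h6 h4] at h6
  refine ⟨hinv.mono fun z h => ⟨⟨_, _, h.1, h.2⟩, rfl⟩, ?_⟩
  have hGm : FinMero G z₀ := by
    have h1 : AnalyticAt ℂ (fun z : ℂ => k - z • (1 : H →L[ℂ] H)) z₀ :=
      analyticAt_const.sub (analyticAt_id.smul analyticAt_const)
    have h2 : AnalyticAt ℂ (fun z : ℂ => (1 + (k - z • (1 : H →L[ℂ] H)) * (k - z • 1)) * L₀) z₀ :=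
      (analyticAt_const.add (h1.mul h1)).mul analyticAt_const
    have h3 : AnalyticAt ℂ (fun z => L₀ * (e₁.Q z + e₂.Q z)) z₀ :=
      analyticAt_const.mul ((e₁.analyticAt_Q hz₀).add (e₂.analyticAt_Q hz₀))
    refine ((FinMero.of_analyticAt (analyticAt_const (v := (1 : H →L[ℂ] H)))).add ((hm.clm_comp h3).comp_clm h2)).congr ?_
    filter_upwards with z
    rfl
  exact hGm.congr (hinv.mono fun z h => ringInverse_eq h.1 h.2)

theorem exists_ker_pencil (hL : IsSelfAdjoint L₀) (hk : IsSelfAdjoint k) {z : ℂ}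
    (hz : z.im ≠ 0) (hu : ¬ IsUnit (pencil L₀ k z)) : ∃ f, f ≠ 0 ∧ pencil L₀ k z f = 0 := by
  obtain ⟨h1, h2⟩ := finMero_inverse_pencil e₁ e₂ hi hL hk hz
  exact exists_ker_of_meromorphicAt_inverse (analyticAt_pencil L₀ k z) h1 h2.meromorphicAt hu

omit hi in
/-- Nonreal singular points of the pencil are bounded by the charge. -/
theorem norm_le_of_pencil_apply_eq_zero {S : H →ₗ.[ℂ] H} {C₀ : H →L[ℂ] H} (hr : IsRoot S L₀ C₀)
    (hk : IsSelfAdjoint k) {z : ℂ} (hz : z.im ≠ 0) {f : H} (hf : f ≠ 0)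
    (hP : pencil L₀ k z f = 0) : ‖z‖ ≤ ‖k‖ := by
  set u := L₀ f with hu
  have hu0 : u ≠ 0 := fun h => hf (hr.injective _ h)
  have h1 : C₀ (C₀ f) = L₀ (k (k u) - (2 * z) • k u + z ^ 2 • u) := by
    have h2 : pencil L₀ k z f = f - L₀ (u + (k - z • (1 : H →L[ℂ] H)) ((k - z • 1) u)) := rfl
    rw [hP] at h2
    have h3 : f = L₀ (u + (k - z • (1 : H →L[ℂ] H)) ((k - z • 1) u)) := sub_eq_zero.1 h2.symm
    have h4 : C₀ (C₀ f) = f - L₀ u := eq_sub_of_add_eq' (hr.add_apply f)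
    rw [h4, sub_eq_iff_eq_add, ← map_add]
    refine h3.trans (congrArg L₀ ?_)
    simp only [sub_apply, smul_apply, one_apply_eq_self, map_sub, map_smul]
    module
  -- The equation is paired with `f`. As `Im z ≠ 0`, the imaginary part gives `⟨u, k u⟩ = Re z
  -- ‖u‖²`; inserted in the real part, this gives `‖C₀ f‖² = ‖k u‖² - |z|² ‖u‖²`.
  have h3 : ((‖C₀ f‖ ^ 2 : ℝ) : ℂ) = ((‖k u‖ ^ 2 : ℝ) : ℂ) - 2 * z * ⟪u, k u⟫_ℂ +
      z ^ 2 * ((‖u‖ ^ 2 : ℝ) : ℂ) := by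
    have h4 : ⟪f, C₀ (C₀ f)⟫_ℂ = ⟪f, L₀ (k (k u) - (2 * z) • k u + z ^ 2 • u)⟫_ℂ := by rw [h1]
    rw [← inner_comm_of_selfAdjoint hr.selfAdjoint_C,
      ← inner_comm_of_selfAdjoint hr.selfAdjoint_L] at h4
    rw [inner_add_right, inner_sub_right, inner_smul_right, inner_smul_right,
      ← inner_comm_of_selfAdjoint hk u (k u), inner_self_eq_norm_sq_to_K,
      inner_self_eq_norm_sq_to_K, inner_self_eq_norm_sq_to_K] at h4
    push_cast
    exact h4
  obtain ⟨r, hr'⟩ : ∃ r : ℝ, ⟪u, k u⟫_ℂ = r := by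
    refine ⟨(⟪u, k u⟫_ℂ).re, ?_⟩
    have h5 : (starRingEnd ℂ) ⟪u, k u⟫_ℂ = ⟪u, k u⟫_ℂ := by
      rw [inner_conj_symm, inner_comm_of_selfAdjoint hk]
    exact (Complex.conj_eq_iff_re.1 h5).symm
  rw [hr'] at h3
  have hre := congrArg Complex.re h3
  have him := congrArg Complex.im h3
  simp [pow_two] at hre him
  have h6 : r = z.re * (‖u‖ * ‖u‖) := by
    refine mul_left_cancel₀ hz ?_
    linarith
  have h7 : ‖z‖ ^ 2 * ‖u‖ ^ 2 ≤ ‖k u‖ ^ 2 := by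
    rw [← Complex.normSq_eq_norm_sq, Complex.normSq_apply]
    rw [h6] at hre
    nlinarith [mul_self_nonneg ‖C₀ f‖]
  have h8 : ‖z‖ * ‖u‖ ≤ ‖k‖ * ‖u‖ := by
    refine le_trans (le_of_sq_le_sq ?_ (norm_nonneg _)) (k.le_opNorm u)
    rwa [mul_pow]
  exact le_of_mul_le_mul_right h8 (norm_pos_iff.2 hu0)

omit hi in
-- Near `iY`, compactness reduces invertibility of `1 + Kw` to injectivity: if `(1 + Kw) f = 0`,
-- then `(1 + K) V f = V (1 + Kw) f = 0`, and `1 + K` is invertible there. The meromorphic Fredholm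
-- theorem then reaches all of `Im z > -δ`, hence punctured neighbourhoods of real points.
theorem finMero_inverse_weighted_remainder (hV : ∀ u, V u = 0 → u = 0) {z₀ : ℂ}
    (hz₀ : 0 ≤ z₀.im) : ∀ᶠ z in 𝓝[≠] z₀, IsUnit (1 + (e₁.Kw z + e₂.Kw z)) := by
  set δ := min e₁.δ e₂.δ with hδ
  have hδ0 : 0 < δ := lt_min e₁.δ_pos e₂.δ_pos
  have hδ1 : ∀ z : ℂ, -δ < z.im → -e₁.δ < z.im := fun z hz =>
    (neg_le_neg (min_le_left _ _)).trans_lt hz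
  have hδ2 : ∀ z : ℂ, -δ < z.im → -e₂.δ < z.im := fun z hz =>
    (neg_le_neg (min_le_right _ _)).trans_lt hz
  have hcp : ∀ z : ℂ, -δ < z.im → IsCompactOperator (e₁.Kw z + e₂.Kw z : H →L[ℂ] H) := fun z hz =>
    isCompactOperator_add (e₁.isCompactOperator_Kw (hδ1 z hz)) (e₂.isCompactOperator_Kw (hδ2 z hz))
  obtain ⟨Y, hY, h⟩ := exists_far_isUnit e₁ e₂
  have hYim : (Y * Complex.I : ℂ).im = Y := by simp
  have hev : ∀ᶠ z in 𝓝 (Y * Complex.I : ℂ), IsUnit (1 + (e₁.Kw z + e₂.Kw z)) := by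
    have h0 : ∀ᶠ z : ℂ in 𝓝 (Y * Complex.I : ℂ), 0 < z.im :=
      Complex.continuous_im.continuousAt.eventually_const_lt (by rwa [hYim])
    filter_upwards [h Y (le_abs_self Y), h0] with z h1 h2
    rcases IsCompactOperator.hasEigenvalue_or_mem_resolventSet (hcp z (by linarith))
      (neg_ne_zero.2 (one_ne_zero (α := ℂ))) with h3 | h3
    · exfalso
      obtain ⟨f, hf⟩ := h3.exists_hasEigenvector
      have hf1 : e₁.Kw z f + e₂.Kw z f = (-1 : ℂ) • f := hf.apply_eq_smul
      have h4 : (1 + (e₁.K z + e₂.K z)) (V f) = 0 := by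
        have h5 : e₁.K z (V f) = V (e₁.Kw z f) :=
          congrArg (fun T : H →L[ℂ] H => T f) (e₁.K_mul_V h2)
        have h6 : e₂.K z (V f) = V (e₂.Kw z f) :=
          congrArg (fun T : H →L[ℂ] H => T f) (e₂.K_mul_V h2)
        rw [add_apply, add_apply, one_apply_eq_self, h5, h6, ← map_add, hf1, map_smul]
        module
      have h7 : V f = 0 := by
        have := congrArg (fun T : H →L[ℂ] H => T (V f)) (Ring.inverse_mul_cancel _ h1)
        simp only [mul_apply_eq_comp, h4, map_zero, one_apply_eq_self] at this
        exact this.symm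
      exact hf.2 (hV f h7)
    · have h4 : IsUnit (algebraMap ℂ (H →L[ℂ] H) (-1) - (e₁.Kw z + e₂.Kw z)) := h3
      rw [map_neg, map_one, ← neg_add', IsUnit.neg_iff] at h4
      exact h4
  exact (finMero_inverse_one_add (F := fun z => e₁.Kw z + e₂.Kw z) (U := {z | -δ < z.im})
    (isOpen_lt continuous_const Complex.continuous_im)
    (convex_halfSpace_im_gt (-δ)).isPreconnected
    (fun z hz => (e₁.finMero_Kw (hδ1 z hz)).add (e₂.finMero_Kw (hδ2 z hz))) hcp
    (z₁ := Y * Complex.I) (by rw [Set.mem_ofPred_eq, hYim]; linarith)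
    (hev.filter_mono nhdsWithin_le_nhds) z₀ (by rw [Set.mem_ofPred_eq]; linarith)).1

/-- A nonreal singular point of the pencil in the lower half plane gives a singular point of the
weighted remainder. -/
theorem not_isUnit_weighted_remainder (hL : IsSelfAdjoint L₀) (hk : IsSelfAdjoint k)
    (hVs : IsSelfAdjoint V) (hV : ∀ u, V u = 0 → u = 0) (hL0 : ∀ u, L₀ u = 0 → u = 0) {z : ℂ}
    (hz : 0 < z.im) {f : H} (hf : f ≠ 0) (hP : pencil L₀ k (star z) f = 0) :
    ¬ IsUnit (1 + (e₁.Kw z + e₂.Kw z)) := by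
  intro hu
  set u := L₀ f with hudef
  -- A right parametrix at `z` detects the kernel of the adjoint pencil, that is, of the pencil at
  -- `star z`. From `(1 + K)* u = 0` and the adjoint of `(1 + K) V = V (1 + Kw)` follows `(1 + Kw)*
  -- V u = 0`.
  have h1 : star (rightPencil L₀ k z) u = L₀ (pencil L₀ k (star z) f) := by
    simp only [pencil, rightPencil, star_sub, star_mul, star_add, star_one, star_smul,
      hL.star_eq, hk.star_eq]
    simp only [sub_apply, one_apply_eq_self, mul_apply_eq_comp, map_sub, hudef]
  rw [hP, map_zero] at h1
  have h2 : star (1 + (e₁.K z + e₂.K z)) u = 0 := by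
    rw [← rightPencil_mul e₁ e₂ hi hz.ne', star_mul, mul_apply_eq_comp, h1, map_zero]
  have h3 : (1 + (e₁.K z + e₂.K z)) * V = V * (1 + (e₁.Kw z + e₂.Kw z)) := by
    rw [add_mul, add_mul, e₁.K_mul_V hz, e₂.K_mul_V hz]
    noncomm_ring
  have h4 := congrArg star h3
  rw [star_mul, star_mul, hVs.star_eq] at h4
  have h5 : star (1 + (e₁.Kw z + e₂.Kw z)) (V u) = 0 := by
    have := congrArg (fun T : H →L[ℂ] H => T u) h4
    simp only [mul_apply_eq_comp, h2, map_zero] at this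
    exact this.symm
  have h6 := congrArg (fun T : H →L[ℂ] H => T (V u)) (Ring.inverse_mul_cancel _ hu.star)
  simp only [mul_apply_eq_comp, h5, map_zero, one_apply_eq_self] at h6
  exact hf (hL0 f (hV u h6.symm))

/-- The pencil has finitely many nonreal singular points. -/
theorem finite_singular_pencil {S : H →ₗ.[ℂ] H} {C₀ : H →L[ℂ] H} (hr : IsRoot S L₀ C₀)
    (hk : IsSelfAdjoint k) (hVs : IsSelfAdjoint V) (hV : ∀ u, V u = 0 → u = 0) :
    {z : ℂ | z.im ≠ 0 ∧ ¬ IsUnit (pencil L₀ k z)}.Finite := by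
  have hL := hr.selfAdjoint_L
  let N : Set ℂ := {z | 0 < z.im ∧ ¬ IsUnit (pencil L₀ k z)}
  have hN : N.Finite := by
    -- The half disc is closed and contains its real diameter; accumulation there is excluded by the
    -- continuation of `Kw`.
    let M : Set ℂ := {z | 0 ≤ z.im ∧ ‖z‖ ≤ ‖k‖}
    have hM : IsCompact M := by
      refine (ProperSpace.isCompact_closedBall (0 : ℂ) ‖k‖).of_isClosed_subset ?_ fun z hz => by
        rw [mem_closedBall_zero_iff]; exact hz.2
      exact (isClosed_le continuous_const Complex.continuous_im).inter
        (isClosed_le continuous_norm continuous_const)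
    have hNM : ∀ z ∈ N, z ∈ M ∧ ¬ IsUnit (1 + (e₁.Kw z + e₂.Kw z)) := by
      rintro z ⟨hz, hu⟩
      obtain ⟨f, hf, hP⟩ := exists_ker_pencil e₁ e₂ hi hL hk hz.ne' hu
      rw [← isUnit_pencil_star hL hk] at hu
      have hz' : (star z).im ≠ 0 := by
        change -z.im ≠ 0
        exact neg_ne_zero.2 hz.ne'
      obtain ⟨f', hf', hP'⟩ := exists_ker_pencil e₁ e₂ hi hL hk hz' hu
      exact ⟨⟨hz.le, norm_le_of_pencil_apply_eq_zero hr hk hz.ne' hf hP⟩,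
        not_isUnit_weighted_remainder e₁ e₂ hi hL hk hVs hV hr.injective hz hf' hP'⟩
    refine Set.Finite.subset (s := {z ∈ M | ¬ IsUnit (1 + (e₁.Kw z + e₂.Kw z))}) ?_ hNM
    by_contra hinf
    obtain ⟨z₀, hz₀, hacc⟩ := Set.Infinite.exists_accPt_of_subset_isCompact hinf hM
      (fun z hz => hz.1)
    rw [accPt_iff_frequently_nhdsNE] at hacc
    exact hacc ((finMero_inverse_weighted_remainder e₁ e₂ hV hz₀.1).mono fun z hz hz' => hz'.2 hz)
  refine (hN.union (hN.image star)).subset ?_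
  rintro z ⟨hz, hu⟩
  rcases lt_or_gt_of_ne hz with h | h
  · refine Or.inr ⟨star z, ⟨?_, ?_⟩, star_star z⟩
    · change 0 < -z.im
      linarith
    · rwa [isUnit_pencil_star hL hk]
  · exact Or.inl ⟨h, hu⟩

end TwoEndsPencil

/-! ### From the hypotheses to the end data -/

section Construction

variable {H : Type*} [NormedAddCommGroup H] [InnerProductSpace ℂ H] [CompleteSpace H]

/-- A weighted commutator bound, in terms of bounded operators. -/
theorem IsRoot.exists_weight_commutator {S : H →ₗ.[ℂ] H} {L C W V : H →L[ℂ] H}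
    (hr : IsRoot S L C) (hW : IsSelfAdjoint W) {c : ℝ}
    (hc : ∀ (v y : S.domain) (v' : (sqrtOp S).domain), (v' : H) = v →
      ‖commForm S W v y‖ ≤ c * ‖sqrtOp S v'‖ * ‖V (y : H)‖) :
    ∃ B : H →L[ℂ] H, W * (L * L) = L * L * W + L * C * B * (V * (L * L)) := by
  have hL := hr.selfAdjoint_L
  have hC := hr.selfAdjoint_C
  -- The form `[S, W]` is evaluated at `L² a`, `L² b`. Since `S L² = C² = 1 - L²`, the terms `L² W
  -- L²` cancel and `W L² - L² W` remains.
  obtain ⟨B, hB⟩ := exists_factor_form (D := W * (L * L) - L * L * W) (A₁ := C * L)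
    (A₂ := V * (L * L)) (c := c) fun a b => by
      have hLa : L (L a) ∈ (sqrtOp S).domain := (hr.mem_sqrt _).2 ⟨L a, rfl⟩
      have h1 := hc ⟨_, hr.mem a⟩ ⟨_, hr.mem b⟩ ⟨_, hLa⟩ rfl
      rw [hr.sqrt_apply] at h1
      have h2 : commForm S W ⟨_, hr.mem a⟩ ⟨_, hr.mem b⟩ = ⟪a, (W * (L * L) - L * L * W) b⟫_ℂ := by
        rw [commForm, hr.apply, hr.apply]
        simp only [inner_comm_of_selfAdjoint hC, inner_comm_of_selfAdjoint hL,
          inner_comm_of_selfAdjoint hW]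
        rw [← inner_sub_right]
        congr 1
        have e : ∀ f, C (C f) = f - L (L f) := fun f => eq_sub_of_add_eq' (hr.add_apply f)
        simp only [e, map_sub, sub_apply, mul_apply_eq_comp]
        abel
      rw [← h2]
      exact h1
  refine ⟨B, ?_⟩
  rw [star_mul, hL.star_eq, hC.star_eq] at hB
  rw [← hB]
  abel

/-- An end satisfying the hypotheses of the theorem gives end data. -/
theorem exists_endData {h : H →ₗ.[ℂ] H} {k κ L₀ C₀ L C i : H →L[ℂ] H} {x : H →ₗ.[ℂ] H} {w : ℝ → ℝ}
    {ℓ : ℝ} (hh : IsSelfAdjoint h) (hi : IsSelfAdjoint i) (hr₀ : IsRoot (hZero h k) L₀ C₀)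
    (hr : IsRoot (perturb (hZero h k) (-(κ * κ))) L C)
    (hW : IsSelfAdjoint (weight x w 1)) (hV : IsSelfAdjoint (weight x w (1 / 2)))
    (hVV : weight x w (1 / 2) * weight x w (1 / 2) = weight x w 1)
    (hiκ : Commute i κ) (hik : Commute i k) (hiV : Commute i (weight x w (1 / 2)))
    (hcharge : k * i = (κ + (ℓ : ℂ) • 1) * i)
    (hwc : WeightCompatible (perturb (hZero h k) (-(κ * κ))) κ x w)
    (hext : WeightedResolventExtends (perturb (hZero h k) (-(κ * κ))) x w)
    (hcomm : CommutatorBounded h i (perturb (hZero h k) (-(κ * κ))) x w) :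
    ∃ e : EndData k L₀ (weight x w (1 / 2)) ℓ, e.i = i := by
  set S := perturb (hZero h k) (-(κ * κ)) with hSdef
  set W := weight x w 1 with hWdef
  set V := weight x w (1 / 2) with hVdef
  have hL := hr.selfAdjoint_L
  have hC := hr.selfAdjoint_C
  obtain ⟨τ, hτ⟩ := hwc.sandwich
  obtain ⟨c₀, hc₀⟩ := hwc.commutator 1 one_pos le_rfl
  obtain ⟨B, hB⟩ := hr.exists_weight_commutator hW hc₀
  obtain ⟨⟨c₁, hc₁⟩, ⟨c₂, hc₂⟩⟩ := hcomm
  have hmem : ∀ f, L (L f) ∈ h.domain := fun f => hr.mem f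
  -- `M = h L²`, because `h = S + κ² - k²`.
  let M : H →L[ℂ] H := C * C + (κ * κ - k * k) * (L * L)
  have hM : ∀ f, h ⟨_, hmem f⟩ = M f := fun f => by
    have h1 : S ⟨_, hr.mem f⟩ = C (C f) := hr.apply f _
    have h2 : S ⟨_, hr.mem f⟩ = -κ (κ (L (L f))) + (k (k (L (L f))) + h ⟨_, hmem f⟩) := rfl
    have h3 : M f = C (C f) + (κ (κ (L (L f))) - k (k (L (L f)))) := rfl
    rw [h3, ← h1, h2]
    abel
  -- The bounded operator of the form `L² [h, i] L²`. Both commutator hypotheses are applied to it,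
  -- and injectivity of `L` then strips the factor `L²` on the left.
  let D' : H →L[ℂ] H := star M * i * (L * L) - L * L * i * M
  have hD' : ∀ a f, commForm h i ⟨_, hmem a⟩ ⟨_, hmem f⟩ = ⟪a, D' f⟫_ℂ := fun a f => by
    rw [commForm, hM, hM, sub_apply, inner_sub_right, ContinuousLinearMap.star_eq_adjoint]
    simp only [mul_apply_eq_comp, ContinuousLinearMap.adjoint_inner_right,
      ← inner_comm_of_selfAdjoint hL]
    rw [inner_comm_of_selfAdjoint hi]
  have hsq : ∀ f, L f ∈ (sqrtOp S).domain := fun f => (hr.mem_sqrt _).2 ⟨f, rfl⟩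
  obtain ⟨B₁, hB₁⟩ := exists_factor_form (D := D') (A₁ := L * L) (A₂ := C * L) (c := c₂)
    fun a f => by
      have h1 := hc₂ ⟨_, hmem a⟩ ⟨_, hmem f⟩ ⟨_, hsq (L f)⟩ rfl
      rw [hD', hr.sqrt_apply] at h1
      exact h1
  -- This exhibits the preimage of `W L² f` under `L`, so that `S^{1/2} W L² f` is the image of that
  -- preimage under `C`.
  have hWL : ∀ f, L (L (W f) + C (B (V (L (L f))))) = W (L (L f)) := fun f => by
    rw [map_add]
    exact (congrArg (fun T : H →L[ℂ] H => T f) hB).symm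
  obtain ⟨Θ, hΘ⟩ := exists_factor_form (D := D') (A₁ := W * (L * L))
    (A₂ := C * L * W + C * C * B * (V * (L * L))) (c := c₁) fun a f => by
      have h1 := hc₁ ⟨_, hmem a⟩ ⟨_, hmem f⟩ ⟨_, hsq (L (W f) + C (B (V (L (L f)))))⟩ (hWL f)
      rw [hD', hr.sqrt_apply, map_add] at h1
      exact h1
  have hL2 : ∀ {A B : H →L[ℂ] H}, L * L * A = L * L * B → A = B := fun {A B} hAB => by
    ext f
    have h1 : L (L (A f)) = L (L (B f)) := congrArg (fun T : H →L[ℂ] H => T f) hAB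
    refine sub_eq_zero.1 (hr.injective _ (hr.injective _ ?_))
    rw [map_sub, map_sub, h1, sub_self]
  let D : H →L[ℂ] H := B₁ * (C * L)
  have hD1 : D' = L * L * D := by
    rw [hB₁, star_mul, hL.star_eq, mul_assoc]
  have hD2 : D = W * Θ * (C * L * W + C * C * B * (V * (L * L))) := by
    refine hL2 ?_
    rw [← hD1, hΘ, star_mul, star_mul, hL.star_eq, hW.star_eq]
    simp only [mul_assoc]
  -- Testing against `h u` for `u` in the domain and using selfadjointness gives `i L² f ∈ D(h)`
  -- with `h i L² f = i M f + D f`. Adding `k²` and inverting `1 + h₀` by `L₀²` gives the identity.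
  have htr : i * (L * L) = L₀ * L₀ * (i * (1 + κ * κ * (L * L)) + D) := by
    ext f
    have hadj : ∀ u : h.domain, ⟪i (M f) + D f, (u : H)⟫_ℂ = ⟪i (L (L f)), h u⟫_ℂ := by
      rintro ⟨u, hu⟩
      obtain ⟨a, rfl⟩ := (hr.mem_domain u).1 hu
      have h1 := hD' a f
      rw [commForm, hM, hM, hD1] at h1
      have h2 : ⟪a, (L * L * D) f⟫_ℂ = ⟪L (L a), D f⟫_ℂ := by
        rw [inner_comm_of_selfAdjoint hL, inner_comm_of_selfAdjoint hL]; rfl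
      rw [h2, sub_eq_iff_eq_add, inner_comm_of_selfAdjoint hi, ← inner_add_right] at h1
      change _ = ⟪i (L (L f)), h ⟨_, hmem a⟩⟫_ℂ
      rw [hM, ← inner_conj_symm, ← inner_conj_symm (i (L (L f))), h1, add_comm]
    obtain ⟨hy, e⟩ := selfAdjoint_mem hh hadj
    obtain ⟨g, hg⟩ := (hr₀.mem_domain (i (L (L f)))).1 hy
    have h3 : C₀ (C₀ g) = k (k (i (L (L f)))) + (i (M f) + D f) := by
      rw [← e, ← hr₀.apply g (hr₀.mem g)]
      have h4 : (⟨_, hr₀.mem g⟩ : (hZero h k).domain) = ⟨i (L (L f)), hy⟩ := Subtype.ext hg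
      rw [h4]
      rfl
    have h5 := hr₀.add_apply g
    rw [hg, h3] at h5
    have hc : ∀ v, k (k (i v)) = i (k (k v)) := fun v => by
      have h6 : ∀ v, i (k v) = k (i v) := fun v => congrArg (fun T : H →L[ℂ] H => T v) hik.eq
      rw [h6, h6]
    have h7 : (i * (1 + κ * κ * (L * L)) + D) f = g := by
      rw [← h5, hc]
      simp only [M, add_apply, sub_apply, mul_apply_eq_comp, one_apply_eq_self, map_add, map_sub]
      nth_rewrite 1 [← hr.add_apply f]
      rw [map_add]
      abel
    change i (L (L f)) = L₀ (L₀ ((i * (1 + κ * κ * (L * L)) + D) f))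
    rw [h7, hg]
  have hWLc : IsCompactOperator (W * (L * L) : H →L[ℂ] H) := by
    obtain ⟨Y, hY⟩ := hr.japanese
    rw [hY, ← mul_assoc]
    exact isCompactOperator_mul_right hwc.compact Y
  -- The hypothesis concerns the full weight `W = V²`. Passing to `T*T` doubles the weight, so the
  -- half weight suffices.
  have hc1 : IsCompactOperator (V * (L * L) : H →L[ℂ] H) := by
    refine isCompactOperator_of_star_mul_self ?_
    have h1 : star (V * (L * L)) * (V * (L * L)) = L * L * (W * (L * L)) := by
      rw [star_mul, star_mul, hV.star_eq, hL.star_eq, ← hVV]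
      simp only [mul_assoc]
    rw [h1]
    exact isCompactOperator_mul_left hWLc _
  have hc2 : IsCompactOperator (L * (V * V) : H →L[ℂ] H) := by
    refine isCompactOperator_of_star_mul_self ?_
    have h1 : star (L * (V * V)) * (L * (V * V)) = W * (L * L) * W := by
      rw [hVV, star_mul, hW.star_eq, hL.star_eq]
      simp only [mul_assoc]
    rw [h1]
    exact isCompactOperator_mul_right hWLc _
  obtain ⟨δ, hδ, F, hF1, hF2, hF3⟩ := hext (1 / 2) (by norm_num)
  exact ⟨{
    S := S, L := L, C := C, i := i, κ := κ, D := D, Θ := Θ, Θ' := B₁, B := B, τ := τ, F := F, δ := δ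
    isRoot := hr
    comm_charge := hiκ
    comm_weight := hiV
    charge := hcharge
    charge_eq := by rw [hVV]; exact hτ
    transport := htr
    comm_eq := rfl
    comm_weight_eq := by rw [hVV]; exact hD2
    compact₁ := hc1
    compact₂ := hc2
    δ_pos := hδ
    F_mero := fun z hz => hF1 z hz
    F_compact := hF2
    F_eq := fun z hz => by rw [hF3 z hz, hr.resolventOp_eq hz.ne'] }, rfl⟩

end Construction

/-! ### Operators given by graphs -/

section GraphOperators

variable {X : Type*} [NormedAddCommGroup X] [NormedSpace ℂ X] {G : Submodule ℂ (X × X)}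

theorem mem_eigenspace_iff (hG : ∀ v, (0, v) ∈ G → v = 0) {z : ℂ} {u : X} :
    u ∈ eigenspace G.toLinearPMap z ↔ (u, z • u) ∈ G := by
  obtain ⟨h1, h2⟩ := toLinearPMap_of_forall hG
  rw [eigenspace, Submodule.mem_map]
  constructor
  · rintro ⟨⟨y, hy⟩, hy', rfl⟩
    obtain ⟨v, hv⟩ := (h1 y).1 hy
    have h3 : G.toLinearPMap ⟨y, hy⟩ - z • y = 0 := hy'
    rw [h2 y hy v hv, sub_eq_zero] at h3
    rw [h3] at hv
    exact hv
  · intro hu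
    have hy := (h1 u).2 ⟨_, hu⟩
    refine ⟨⟨u, hy⟩, ?_, rfl⟩
    change G.toLinearPMap ⟨u, hy⟩ - z • u = 0
    rw [h2 u hy _ hu, sub_self]

theorem mem_pointSpectrum_iff (hG : ∀ v, (0, v) ∈ G → v = 0) {z : ℂ} :
    z ∈ pointSpectrum G.toLinearPMap ↔ ∃ u, u ≠ 0 ∧ (u, z • u) ∈ G := by
  change eigenspace G.toLinearPMap z ≠ ⊥ ↔ _
  rw [Submodule.ne_bot_iff]
  simp only [mem_eigenspace_iff hG, and_comm]

/-- The left inverse property follows from the right one: `B (v - z u) - u` is an eigenvector or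
zero, and there are no eigenvectors. -/
theorem isResolventAt_toLinearPMap (hG : ∀ v, (0, v) ∈ G → v = 0) {z : ℂ} {B : X →L[ℂ] X}
    (h1 : ∀ f, (B f, f + z • B f) ∈ G) (h2 : ∀ u, (u, z • u) ∈ G → u = 0) :
    IsResolventAt G.toLinearPMap z B := by
  obtain ⟨h3, h4⟩ := toLinearPMap_of_forall hG
  constructor
  · intro f
    have hf := (h3 (B f)).2 ⟨_, h1 f⟩
    exact ⟨hf, by rw [h4 _ hf _ (h1 f), add_sub_cancel_right]⟩
  · rintro ⟨u, hu⟩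
    obtain ⟨v, hv⟩ := (h3 u).1 hu
    rw [h4 u hu v hv]
    change B (v - z • u) = u
    refine sub_eq_zero.1 (h2 _ ?_)
    have h5 := G.sub_mem (h1 (v - z • u)) hv
    have h6 : (B (v - z • u) - u, z • (B (v - z • u) - u)) =
        (B (v - z • u), v - z • u + z • B (v - z • u)) - (u, v) := by
      refine Prod.ext rfl ?_
      change z • (B (v - z • u) - u) = v - z • u + z • B (v - z • u) - v
      rw [smul_sub]
      abel
    rw [h6]
    exact h5

/-- An eigenvalue is in the spectrum. -/
theorem pointSpectrum_subset_opSpectrum (A : X →ₗ.[ℂ] X) : pointSpectrum A ⊆ opSpectrum A := by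
  intro z hz hz'
  obtain ⟨B, -, hB⟩ := hz'
  obtain ⟨u, hu, hu0⟩ := (Submodule.ne_bot_iff _).1 hz
  obtain ⟨⟨y, hy⟩, hy', rfl⟩ := hu
  have h1 : A ⟨y, hy⟩ - z • y = 0 := hy'
  have h2 := hB ⟨y, hy⟩
  rw [h1, map_zero] at h2
  exact hu0 h2.symm

/-- Eigenspaces at poles of a finite meromorphic resolvent are finite dimensional. -/
theorem finiteDimensional_eigenspace {A : X →ₗ.[ℂ] X} {z₀ : ℂ} {B : ℂ → X →L[ℂ] X}
    (hB : FinMero B z₀) (hres : ∀ᶠ z in 𝓝[≠] z₀, IsResolventAt A z (B z)) :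
    FiniteDimensional ℂ (eigenspace A z₀) := by
  obtain ⟨N, a, F, ha, hF, hE⟩ := hB
  let W : Submodule ℂ X := ⨆ n : Fin N, LinearMap.range (a n : X →ₗ[ℂ] X)
  have hW : FiniteDimensional ℂ W := by
    have := ha
    exact Submodule.finiteDimensional_iSup _
  refine Submodule.finiteDimensional_of_le (S₂ := W) ?_
  rintro u ⟨⟨y, hy⟩, hy', rfl⟩
  have h1 : A ⟨y, hy⟩ - z₀ • y = 0 := hy'
  change y ∈ W
  -- An eigenvector satisfies `y = (z₀ - z)(A - z)⁻¹ y`. The singular terms lie in `W` and the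
  -- holomorphic part contributes a term tending to `0`, so `y` is a limit of points of the closed
  -- subspace `W`.
  have hev : ∀ᶠ z in 𝓝[≠] z₀, y - (z₀ - z) • F z y ∈ W := by
    filter_upwards [hres, hE] with z h2 h3
    have h4 := h2.2 ⟨y, hy⟩
    rw [sub_eq_zero.1 h1, ← sub_smul, map_smul, h3] at h4
    change (z₀ - z) • ((∑ n ∈ Finset.range N, ((z - z₀) ^ (n + 1))⁻¹ • a n) y + F z y) = y at h4
    rw [smul_add] at h4
    rw [← eq_sub_of_add_eq h4]
    refine W.smul_mem _ ?_
    rw [sum_apply]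
    refine W.sum_mem fun n hn => ?_
    rw [smul_apply]
    refine W.smul_mem _ ?_
    exact Submodule.mem_iSup_of_mem (⟨n, Finset.mem_range.1 hn⟩ : Fin N) ⟨y, rfl⟩
  have hlim : Tendsto (fun z => y - (z₀ - z) • F z y) (𝓝[≠] z₀) (𝓝 y) := by
    have h2 : ContinuousAt (fun z => y - (z₀ - z) • F z y) z₀ :=
      continuousAt_const.sub ((continuousAt_const.sub continuousAt_id).smul
        (hF.continuousAt.clm_apply continuousAt_const))
    have h3 := h2.tendsto
    simp only [sub_self, zero_smul, sub_zero] at h3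
    exact h3.mono_left nhdsWithin_le_nhds
  exact W.closed_of_finiteDimensional.mem_of_tendsto hlim hev

end GraphOperators

theorem analyticAt_add_smul {X Y : Type*} [NormedAddCommGroup X] [NormedSpace ℂ X]
    [NormedAddCommGroup Y] [NormedSpace ℂ Y] (A B : X →L[ℂ] Y) (z₀ : ℂ) :
    AnalyticAt ℂ (fun z : ℂ => A + z • B) z₀ :=
  analyticAt_const.add (AnalyticAt.smul (f := fun z : ℂ => z) analyticAt_id analyticAt_const)

/-! ### The operator on the inhomogeneous energy space -/

section EnergyOperator

variable {H : Type*} [NormedAddCommGroup H] [InnerProductSpace ℂ H] [CompleteSpace H]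
  {h : H →ₗ.[ℂ] H} {k L C : H →L[ℂ] H}

theorem kgGraph_single {v : Energy h k} (hv : (0, v) ∈ kgGraph h k) : v = 0 := by
  obtain ⟨h1, hu, h2⟩ := hv
  have h3 : (⟨Energy.pos h k ((0, v) : Energy h k × Energy h k).1, hu⟩ : h.domain) = 0 :=
    Subtype.ext (map_zero _)
  rw [h3] at h2
  refine Prod.ext (Subtype.ext ?_) ?_
  · exact h1.trans (map_zero (Energy.c1 h k))
  · refine h2.trans ?_
    change h 0 + (2 : ℂ) • k (Energy.c1 h k 0) = 0
    simp

theorem continuous_emb (h : H →ₗ.[ℂ] H) (k : H →L[ℂ] H) : Continuous (Energy.emb h k) :=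
  continuous_induced_dom

/-- The components of an energy vector as continuous maps. -/
def Energy.comp (h : H →ₗ.[ℂ] H) (k : H →L[ℂ] H) (j : Fin 3) : Energy h k →L[ℂ] H :=
  (PiLp.proj 2 (fun _ : Fin 3 => H) j : PiLp 2 (fun _ : Fin 3 => H) →L[ℂ] H) ∘L
    ⟨Energy.emb h k, continuous_emb h k⟩

variable (hr : IsRoot (hZero h k) L C)

include hr

theorem mem_sqrt_hZero (g : H) : L g ∈ (sqrtOp (hZero h k)).domain := (hr.mem_sqrt _).2 ⟨g, rfl⟩

/-- The vector of the energy space with components `u₀ = L g` and `u₁ = v`. -/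
def energyMk : H × H →ₗ[ℂ] Energy h k :=
  LinearMap.prodMap ((L : H →ₗ[ℂ] H).codRestrict _ (mem_sqrt_hZero hr)) LinearMap.id

theorem pos_energyMk (g v : H) : Energy.pos h k (energyMk hr (g, v)) = L g := rfl

theorem c1_energyMk (g v : H) : Energy.c1 h k (energyMk hr (g, v)) = v := rfl

theorem cov_energyMk (g v : H) : Energy.cov h k (energyMk hr (g, v)) = v - k (L g) := rfl

theorem root_energyMk (g v : H) : Energy.root h k (energyMk hr (g, v)) = C g :=
  hr.sqrt_apply g _

theorem continuous_energyMk : Continuous (energyMk hr) := by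
  refine continuous_induced_rng.2 ?_
  refine (PiLp.continuous_toLp 2 _).comp (continuous_pi fun j => ?_)
  fin_cases j
  · change Continuous fun q : H × H => q.2 - k (L q.1)
    fun_prop
  · have : (fun q : H × H => Energy.root h k (energyMk hr q)) = fun q => C q.1 :=
      funext fun q => root_energyMk hr q.1 q.2
    change Continuous (fun q : H × H => Energy.root h k (energyMk hr q))
    rw [this]
    fun_prop
  · change Continuous fun q : H × H => L q.1
    fun_prop

/-- `energyMk` as a continuous map. -/
def energyMkL : H × H →L[ℂ] Energy h k := ⟨energyMk hr, continuous_energyMk hr⟩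

/-- The inverse of `energyMk`. -/
def energyCoord (h : H →ₗ.[ℂ] H) (k L C : H →L[ℂ] H) : Energy h k →L[ℂ] H × H :=
  (L ∘L Energy.comp h k 2 + C ∘L Energy.comp h k 1).prod
    (Energy.comp h k 0 + k ∘L Energy.comp h k 2)

theorem energyMk_coord (u : Energy h k) : energyMk hr (energyCoord h k L C u) = u := by
  obtain ⟨⟨u₀, hu₀⟩, u₁⟩ := u
  obtain ⟨g, rfl⟩ := (hr.mem_sqrt u₀).1 hu₀
  have h1 : energyCoord h k L C (⟨L g, hu₀⟩, u₁) = (g, u₁) := by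
    refine Prod.ext ?_ ?_
    · change L (L g) + C (Energy.root h k (energyMk hr (g, u₁))) = g
      rw [root_energyMk, hr.add_apply]
    · change (u₁ - k (L g)) + k (L g) = u₁
      rw [sub_add_cancel]
  exact congrArg (energyMk hr) h1

theorem energyCoord_mk (q : H × H) : energyCoord h k L C (energyMk hr q) = q := by
  refine Prod.ext ?_ ?_
  · change L (L q.1) + C (Energy.root h k (energyMk hr (q.1, q.2))) = q.1
    rw [root_energyMk, hr.add_apply]
  · change (q.2 - k (L q.1)) + k (L q.1) = q.2
    rw [sub_add_cancel]

/-- This is `h₀ - (k - z)² = h + 2zk - z²`, with regularity for free: solving `pencil g = L r` for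
`g` puts `g` in the range of `L`, hence `L g` in the range of `L²`, which is the domain of `h`. -/
theorem pencil_apply_eq_iff (z : ℂ) (g r : H) : pencil L k z g = L r ↔
    ∃ hu : L g ∈ h.domain,
      h ⟨L g, hu⟩ + (2 * z) • k (L g) - z ^ 2 • L g = r := by
  have hexp : pencil L k z g = g - L (L g + (k (k (L g)) - (2 * z) • k (L g) + z ^ 2 • L g)) := by
    have h1 : pencil L k z g =
        g - L (L g + (k - z • (1 : H →L[ℂ] H)) ((k - z • 1) (L g))) := rfl
    rw [h1]
    congr 3
    simp only [sub_apply, smul_apply, one_apply_eq_self, map_sub, map_smul]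
    module
  constructor
  · intro hP
    set a := L g + (k (k (L g)) - (2 * z) • k (L g) + z ^ 2 • L g) + r with ha
    have h1 : L a = g := by
      rw [ha, map_add, ← hP, hexp]
      abel
    have h2 : L (L a) ∈ h.domain := hr.mem a
    have h3 : k (k (L (L a))) + h ⟨L (L a), h2⟩ = C (C a) := hr.apply a h2
    have h4 := hr.add_apply a
    rw [← h3] at h4
    have h5 : ∀ (y : H) (hy : y ∈ h.domain), y = L g → y + (k (k y) + h ⟨y, hy⟩) = a →
        ∃ hu : L g ∈ h.domain, h ⟨L g, hu⟩ + (2 * z) • k (L g) - z ^ 2 • L g = r := by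
      rintro y hy rfl h6
      refine ⟨hy, ?_⟩
      rw [ha] at h6
      have h7 : h ⟨L g, hy⟩ = r - (2 * z) • k (L g) + z ^ 2 • L g := by
        rw [← sub_eq_zero] at h6 ⊢
        rw [← h6]
        abel
      rw [h7]
      abel
    exact h5 _ h2 (by rw [h1]) h4
  · rintro ⟨hu, e⟩
    obtain ⟨a, ha⟩ := (hr.mem_domain (L g)).1 hu
    have hg : L a = g := sub_eq_zero.1 (hr.injective _ (by rw [map_sub, ha, sub_self]))
    subst hg
    have h3 : k (k (L (L a))) + h ⟨L (L a), hu⟩ = C (C a) := hr.apply a hu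
    have h4 := hr.add_apply a
    rw [← h3] at h4
    rw [hexp, ← e, sub_eq_iff_eq_add, ← map_add]
    refine congrArg L (h4.symm.trans ?_)
    abel

/-- The resolvent equation in the energy space. -/
theorem kg_mem_iff (z : ℂ) (g v g' v' : H) :
    (energyMk hr (g, v), energyMk hr (g', v') + z • energyMk hr (g, v)) ∈ kgGraph h k ↔
      v = L g' + z • L g ∧ pencil L k z g = L (v' + z • L g' - (2 : ℂ) • k (L g')) := by
  have e1 : energyMk hr (g', v') + z • energyMk hr (g, v) =
      energyMk hr (g' + z • g, v' + z • v) := by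
    rw [← map_smul, ← map_add]; rfl
  rw [e1, pencil_apply_eq_iff hr]
  change (Energy.pos h k (energyMk hr (g' + z • g, v' + z • v)) =
    Energy.c1 h k (energyMk hr (g, v)) ∧ ∃ hu : L g ∈ h.domain,
      v' + z • v = h ⟨L g, hu⟩ + (2 : ℂ) • k v) ↔ _
  rw [pos_energyMk, c1_energyMk, map_add, map_smul, eq_comm]
  refine and_congr_right fun hv => exists_congr fun hu => ?_
  rw [hv, ← sub_eq_zero, ← sub_eq_zero (b := v' + z • L g' - _)]
  constructor
  · intro e
    rw [← neg_eq_zero, ← e]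
    simp only [map_add, map_smul]
    module
  · intro e
    rw [← neg_eq_zero, ← e]
    simp only [map_add, map_smul]
    module

theorem kg_mem_zero_iff (z : ℂ) (g v : H) :
    (energyMk hr (g, v), z • energyMk hr (g, v)) ∈ kgGraph h k ↔
      v = z • L g ∧ pencil L k z g = 0 := by
  have h1 := kg_mem_iff hr z g v 0 0
  have h2 : energyMk hr ((0 : H), (0 : H)) = 0 := map_zero (energyMk hr)
  rw [h2, zero_add] at h1
  rw [h1]
  simp

theorem mem_pointSpectrum_kgOp_iff {z : ℂ} :
    z ∈ pointSpectrum (kgOp h k) ↔ ∃ g, g ≠ 0 ∧ pencil L k z g = 0 := by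
  rw [kgOp, mem_pointSpectrum_iff fun v => kgGraph_single]
  constructor
  · rintro ⟨u, hu, hm⟩
    obtain ⟨⟨g, v⟩, rfl⟩ : ∃ q, energyMk hr q = u := ⟨_, energyMk_coord hr u⟩
    obtain ⟨hv, hP⟩ := (kg_mem_zero_iff hr z g v).1 hm
    refine ⟨g, ?_, hP⟩
    rintro rfl
    rw [map_zero, smul_zero] at hv
    subst hv
    exact hu (map_zero (energyMk hr))
  · rintro ⟨g, hg, hP⟩
    refine ⟨energyMk hr (g, z • L g), fun h0 => ?_, (kg_mem_zero_iff hr z _ _).2 ⟨rfl, hP⟩⟩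
    have h1 := energyCoord_mk hr (g, z • L g)
    rw [h0, map_zero] at h1
    exact hg (congrArg Prod.fst h1).symm

/-- The resolvent of the energy Klein-Gordon operator. -/
def kgResolvent (z : ℂ) : Energy h k →L[ℂ] Energy h k :=
  energyMkL hr ∘L (((ContinuousLinearMap.id ℂ H).prod (z • L)) ∘L
    (Ring.inverse (pencil L k z) ∘L (L ∘L (ContinuousLinearMap.snd ℂ H H +
      ((z • (1 : H →L[ℂ] H) - (2 : ℂ) • k) ∘L L) ∘L ContinuousLinearMap.fst ℂ H H))) +
    (ContinuousLinearMap.inr ℂ H H ∘L L) ∘L ContinuousLinearMap.fst ℂ H H) ∘L energyCoord h k L C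

theorem isResolventAt_kgResolvent {z : ℂ} (hz : IsUnit (pencil L k z)) :
    IsResolventAt (kgOp h k) z (kgResolvent hr z) := by
  refine isResolventAt_toLinearPMap (fun v => kgGraph_single) (fun f => ?_) fun u hu => ?_
  · obtain ⟨⟨g', v'⟩, rfl⟩ : ∃ q, energyMk hr q = f := ⟨_, energyMk_coord hr f⟩
    set g := Ring.inverse (pencil L k z)
      (L (v' + (z • (1 : H →L[ℂ] H) - (2 : ℂ) • k) (L g'))) with hg
    have h1 : kgResolvent hr z (energyMk hr (g', v')) = energyMk hr (g, L g' + z • L g) := by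
      have h2 : kgResolvent hr z (energyMk hr (g', v')) = energyMk hr
          ((((ContinuousLinearMap.id ℂ H).prod (z • L)) ∘L
            (Ring.inverse (pencil L k z) ∘L (L ∘L (ContinuousLinearMap.snd ℂ H H +
            ((z • (1 : H →L[ℂ] H) - (2 : ℂ) • k) ∘L L) ∘L ContinuousLinearMap.fst ℂ H H))) +
            (ContinuousLinearMap.inr ℂ H H ∘L L) ∘L ContinuousLinearMap.fst ℂ H H)
            (energyCoord h k L C (energyMk hr (g', v')))) := rfl
      rw [h2, energyCoord_mk]
      refine congrArg (energyMk hr) (Prod.ext ?_ ?_)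
      · change g + 0 = g
        rw [add_zero]
      · change z • L g + L g' = L g' + z • L g
        rw [add_comm]
    rw [h1, kg_mem_iff hr]
    refine ⟨rfl, ?_⟩
    have h3 : pencil L k z g = L (v' + (z • (1 : H →L[ℂ] H) - (2 : ℂ) • k) (L g')) :=
      congrArg (fun T : H →L[ℂ] H => T (L (v' + (z • (1 : H →L[ℂ] H) - (2 : ℂ) • k) (L g'))))
        (Ring.mul_inverse_cancel _ hz)
    rw [h3, sub_apply, smul_apply, smul_apply, one_apply_eq_self, add_sub_assoc]
  · obtain ⟨⟨g, v⟩, rfl⟩ : ∃ q, energyMk hr q = u := ⟨_, energyMk_coord hr u⟩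
    obtain ⟨hv, hP⟩ := (kg_mem_zero_iff hr z g v).1 hu
    have h3 := congrArg (fun T : H →L[ℂ] H => T g) (Ring.inverse_mul_cancel _ hz)
    simp only [mul_apply_eq_comp, hP, map_zero, one_apply_eq_self] at h3
    rw [← h3, map_zero, smul_zero] at hv
    rw [hv, ← h3]
    exact map_zero (energyMk hr)

theorem finMero_kgResolvent {z₀ : ℂ}
    (hP : FinMero (fun z => Ring.inverse (pencil L k z)) z₀) :
    FinMero (kgResolvent hr) z₀ := by
  have h1 : AnalyticAt ℂ (fun z : ℂ => (ContinuousLinearMap.id ℂ H).prod (z • L)) z₀ := by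
    have h2 : (fun z : ℂ => (ContinuousLinearMap.id ℂ H).prod (z • L)) = fun z =>
        ContinuousLinearMap.inl ℂ H H + z • (ContinuousLinearMap.inr ℂ H H ∘L L) := by
      funext z
      ext f <;> simp
    rw [h2]
    exact analyticAt_add_smul _ _ z₀
  have h3 : AnalyticAt ℂ (fun z : ℂ => L ∘L (ContinuousLinearMap.snd ℂ H H +
      ((z • (1 : H →L[ℂ] H) - (2 : ℂ) • k) ∘L L) ∘L ContinuousLinearMap.fst ℂ H H)) z₀ := by
    refine analyticAt_clm_comp analyticAt_const (analyticAt_const.add ?_)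
    refine analyticAt_clm_comp (analyticAt_clm_comp ?_ analyticAt_const) analyticAt_const
    exact (analyticAt_id.smul analyticAt_const).sub analyticAt_const
  have h4 := ((hP.comp_clm h3).clm_comp h1).add (FinMero.of_analyticAt (analyticAt_const
    (v := (ContinuousLinearMap.inr ℂ H H ∘L L) ∘L ContinuousLinearMap.fst ℂ H H)))
  exact (h4.comp_clm (analyticAt_const (v := energyCoord h k L C))).clm_comp
    (analyticAt_const (v := energyMkL hr))

end EnergyOperator

/-! ### Bounded operators on the homogeneous scale -/

section HomogeneousExtension

variable {H : Type*} [NormedAddCommGroup H] [InnerProductSpace ℂ H] [CompleteSpace H]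
  {S : H →ₗ.[ℂ] H} {L C : H →L[ℂ] H} (hr : IsRoot S L C)

/-- `T` is the extension of `B` to the homogeneous space, transported by the square root. -/
def HomRel (L C B T : H →L[ℂ] H) : Prop := L * T * C = C * B * L

omit [CompleteSpace H] in
theorem HomRel.apply {B T : H →L[ℂ] H} (h : HomRel L C B T) (f : H) :
    L (T (C f)) = C (B (L f)) := congrArg (fun A : H →L[ℂ] H => A f) h

include hr

/-- The vector `g` is forced by `L² + C² = 1`. In this form the relation visibly composes: `B` acts
on `u = L f` while `T` acts on `S^{1/2} u = C f`. -/
theorem HomRel.exists_eq {B T : H →L[ℂ] H} (h : HomRel L C B T) (f : H) :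
    ∃ g, B (L f) = L g ∧ T (C f) = C g := by
  refine ⟨L (B (L f)) + C (T (C f)), ?_, ?_⟩
  · rw [map_add, hr.comm_apply, h.apply, hr.add_apply]
  · rw [map_add, ← hr.comm_apply, ← h.apply, hr.add_apply]

theorem homRel_of_forall {B T : H →L[ℂ] H} (h : ∀ f, ∃ g, B (L f) = L g ∧ T (C f) = C g) :
    HomRel L C B T := by
  ext f
  obtain ⟨g, h1, h2⟩ := h f
  change L (T (C f)) = C (B (L f))
  rw [h1, h2, hr.comm_apply]

theorem HomRel.mul {B T B' T' : H →L[ℂ] H} (h : HomRel L C B T) (h' : HomRel L C B' T') :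
    HomRel L C (B * B') (T * T') := by
  refine homRel_of_forall hr fun f => ?_
  obtain ⟨g, h1, h2⟩ := h'.exists_eq hr f
  obtain ⟨g', h3, h4⟩ := h.exists_eq hr g
  exact ⟨g', by rw [mul_apply_eq_comp, h1, h3], by rw [mul_apply_eq_comp, h2, h4]⟩

theorem homRel_one : HomRel L C (1 : H →L[ℂ] H) 1 :=
  homRel_of_forall hr fun f => ⟨f, rfl, rfl⟩

omit hr [CompleteSpace H] in
theorem HomRel.add {B T B' T' : H →L[ℂ] H} (h : HomRel L C B T) (h' : HomRel L C B' T') :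
    HomRel L C (B + B') (T + T') := by
  rw [HomRel, mul_add, add_mul, mul_add, add_mul, h, h']

omit hr [CompleteSpace H] in
theorem HomRel.smul {B T : H →L[ℂ] H} (h : HomRel L C B T) (c : ℂ) :
    HomRel L C (c • B) (c • T) := by
  rw [HomRel, mul_smul_comm, smul_mul_assoc, mul_smul_comm, smul_mul_assoc, h]

theorem HomRel.sub_smul {B T : H →L[ℂ] H} (h : HomRel L C B T) (z : ℂ) :
    HomRel L C (B - z • 1) (T - z • 1) := by
  have := h.add ((homRel_one hr).smul (-z))
  rwa [neg_smul, ← sub_eq_add_neg, ← sub_eq_add_neg] at this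

variable (hC : ∀ f, C f = 0 → f = 0)

include hC

theorem denseRange_root : DenseRange C :=
  denseRange_of_selfAdjoint_of_injective hr.selfAdjoint_C hC

theorem eq_of_mul_C {A A' : H →L[ℂ] H} (h : A * C = A' * C) : A = A' := by
  ext u
  refine (denseRange_root hr hC).induction_on (p := fun u => A u = A' u) u
    (isClosed_eq A.continuous A'.continuous) fun f => ?_
  exact congrArg (fun T : H →L[ℂ] H => T f) h

/-- The relation fixes `T` on the dense range of `C` because `L` is injective. Algebraic identities
on `H`, inverses in particular, therefore pass to the extensions. -/
theorem HomRel.unique {B T T' : H →L[ℂ] H} (h : HomRel L C B T) (h' : HomRel L C B T') :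
    T = T' := by
  refine eq_of_mul_C hr hC ?_
  ext f
  have h1 : L (T (C f)) = L (T' (C f)) := by rw [h.apply, h'.apply]
  exact sub_eq_zero.1 (hr.injective _ (by rw [mul_apply_eq_comp, mul_apply_eq_comp, map_sub, h1,
    sub_self]))

theorem HomRel.mul_eq_one {B T B' T' : H →L[ℂ] H} (h : HomRel L C B T) (h' : HomRel L C B' T')
    (e : B * B' = 1) : T * T' = 1 := by
  have h1 := h.mul hr h'
  rw [e] at h1
  exact h1.unique hr hC (homRel_one hr)

theorem exists_homExt {B : H →L[ℂ] H} {c : ℝ} (hB : HomBound S B c) :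
    HomRel L C B (homExt S B) := by
  have hsq : ∀ f, L f ∈ (sqrtOp S).domain := fun f => (hr.mem_sqrt _).2 ⟨f, rfl⟩
  have hex : ∃ T : H →L[ℂ] H, ∀ u : (sqrtOp S).domain, ∃ hu : B (u : H) ∈ (sqrtOp S).domain,
      sqrtOp S ⟨B (u : H), hu⟩ = T (sqrtOp S u) := by
    let a : H →ₗ[ℂ] H := C
    choose hm hb using hB
    let b : (sqrtOp S).domain →ₗ[ℂ] H :=
      (sqrtOp S).toFun ∘ₗ (((B : H →ₗ[ℂ] H) ∘ₗ (sqrtOp S).domain.subtype).codRestrict _ hm)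
    have hd : DenseRange (sqrtOp S).toFun := by
      refine (denseRange_root hr hC).mono ?_
      rintro _ ⟨f, rfl⟩
      exact ⟨⟨_, hsq f⟩, hr.sqrt_apply f _⟩
    obtain ⟨T, hT, -⟩ := exists_factor_of_dense (sqrtOp S).toFun b hd (c := c) fun u => hb u
    exact ⟨T, fun u => ⟨hm u, hT u⟩⟩
  rw [homExt, dif_pos hex]
  have hT := hex.choose_spec
  set T := hex.choose
  refine homRel_of_forall hr fun f => ?_
  obtain ⟨hu, e⟩ := hT ⟨_, hsq f⟩
  obtain ⟨g, hg⟩ := (hr.mem_sqrt _).1 hu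
  refine ⟨g, hg.symm, ?_⟩
  rw [hr.sqrt_apply] at e
  rw [← e, ← hr.sqrt_apply g (hsq g)]
  exact congrArg (sqrtOp S) (Subtype.ext hg.symm)

end HomogeneousExtension

/-! ### The operator on the homogeneous energy space -/

section HomogeneousOperator

variable {H : Type*} [NormedAddCommGroup H] [InnerProductSpace ℂ H] [CompleteSpace H]
  {h : H →ₗ.[ℂ] H} {k L C : H →L[ℂ] H}

theorem HomEnergy.embL_coe (u : PreEnergy h k) :
    HomEnergy.embL h k (u : HomEnergy h k) = PreEnergy.emb h k u := by
  have h1 := ContinuousLinearMap.extend_eq (PreEnergy.embL h k)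
    (e := UniformSpace.Completion.toComplL (𝕜 := ℂ) (E := PreEnergy h k))
    UniformSpace.Completion.denseRange_coe (UniformSpace.Completion.isUniformInducing_coe _) u
  exact h1

theorem HomEnergy.norm_embL (u : HomEnergy h k) : ‖HomEnergy.embL h k u‖ = ‖u‖ := by
  refine UniformSpace.Completion.induction_on u
    (isClosed_eq (HomEnergy.embL h k).continuous.norm continuous_norm) fun v => ?_
  rw [HomEnergy.embL_coe, UniformSpace.Completion.norm_coe]
  rfl

variable (hr : IsRoot (hZero h k) L C) (hC : ∀ f, C f = 0 → f = 0)

include hr hC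

/-- An isometry of a complete space has closed range. The range is dense because the first component
is arbitrary and the second runs through the range of `C`, dense by injectivity of `C`. -/
theorem HomEnergy.surjective_embL : Function.Surjective (HomEnergy.embL h k) := by
  have hiso : Isometry (HomEnergy.embL h k) :=
    AddMonoidHomClass.isometry_of_norm _ HomEnergy.norm_embL
  have hcl : IsClosed (Set.range (HomEnergy.embL h k)) := hiso.isClosedEmbedding.isClosed_range
  have hd : DenseRange (HomEnergy.embL h k) := by
    intro q
    have hq : q = WithLp.toLp 2 ![q 0, q 1] := by
      ext j
      fin_cases j <;> rfl
    have h1 : (q 1) ∈ closure (Set.range C) := denseRange_root hr hC (q 1)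
    have h2 : Continuous fun y : H => (WithLp.toLp 2 ![q 0, y] : PiLp 2 (fun _ : Fin 2 => H)) := by
      refine (PiLp.continuous_toLp 2 _).comp (continuous_pi fun j => ?_)
      fin_cases j
      · exact continuous_const
      · exact continuous_id
    rw [hq]
    refine map_mem_closure (f := fun y : H => (WithLp.toLp 2 ![q 0, y] :
      PiLp 2 (fun _ : Fin 2 => H))) h2 h1 ?_
    rintro _ ⟨g, rfl⟩
    let v : PreEnergy h k := energyMk hr (g, q 0 + k (L g))
    refine ⟨(v : HomEnergy h k), ?_⟩
    rw [HomEnergy.embL_coe]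
    ext j
    fin_cases j
    · change Energy.cov h k (energyMk hr (g, q 0 + k (L g))) = q 0
      rw [cov_energyMk, add_sub_cancel_right]
    · exact root_energyMk hr g _
  intro q
  have := hd q
  rwa [hcl.closure_eq] at this

/-- The homogeneous energy space is isometric to the Hilbert sum of two copies of `H`. -/
def homEquiv : HomEnergy h k ≃ₗᵢ[ℂ] PiLp 2 (fun _ : Fin 2 => H) :=
  LinearIsometryEquiv.ofSurjective
    ⟨(HomEnergy.embL h k : HomEnergy h k →ₗ[ℂ] PiLp 2 (fun _ : Fin 2 => H)), HomEnergy.norm_embL⟩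
    (HomEnergy.surjective_embL hr hC)

/-- The vector of the homogeneous energy space with given components `h₀^{1/2} u₀` and
`u₁ - k u₀`. -/
def homMk : H × H →L[ℂ] HomEnergy h k :=
  ((homEquiv hr hC).symm.toContinuousLinearEquiv :
      PiLp 2 (fun _ : Fin 2 => H) →L[ℂ] HomEnergy h k) ∘L
    ((PiLp.continuousLinearEquiv 2 ℂ (fun _ : Fin 2 => H)).symm :
      (Fin 2 → H) →L[ℂ] PiLp 2 (fun _ : Fin 2 => H)) ∘L
    ContinuousLinearMap.pi ![ContinuousLinearMap.snd ℂ H H, ContinuousLinearMap.fst ℂ H H]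

theorem embL_homMk (q : H × H) : HomEnergy.embL h k (homMk hr hC q) = WithLp.toLp 2 ![q.2, q.1] := by
  have h1 : homEquiv hr hC (homMk hr hC q) = (PiLp.continuousLinearEquiv 2 ℂ
      (fun _ : Fin 2 => H)).symm (ContinuousLinearMap.pi ![ContinuousLinearMap.snd ℂ H H,
        ContinuousLinearMap.fst ℂ H H] q) := (homEquiv hr hC).apply_symm_apply _
  refine h1.trans ?_
  ext j
  fin_cases j <;> rfl

theorem root_homMk (q : H × H) : HomEnergy.root h k (homMk hr hC q) = q.1 := by
  change (HomEnergy.embL h k (homMk hr hC q)) 1 = q.1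
  rw [embL_homMk]
  rfl

theorem cov_homMk (q : H × H) : HomEnergy.cov h k (homMk hr hC q) = q.2 := by
  change (HomEnergy.embL h k (homMk hr hC q)) 0 = q.2
  rw [embL_homMk]
  rfl

omit hr hC in
theorem HomEnergy.ext_components {u v : HomEnergy h k}
    (h1 : HomEnergy.root h k u = HomEnergy.root h k v)
    (h2 : HomEnergy.cov h k u = HomEnergy.cov h k v) : u = v := by
  have h3 : HomEnergy.embL h k u = HomEnergy.embL h k v := by
    ext j
    fin_cases j
    · exact h2
    · exact h1
  refine sub_eq_zero.1 (norm_eq_zero.1 ?_)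
  rw [← HomEnergy.norm_embL, map_sub, h3, sub_self, norm_zero]

theorem homMk_components (u : HomEnergy h k) :
    homMk hr hC (HomEnergy.root h k u, HomEnergy.cov h k u) = u :=
  HomEnergy.ext_components (root_homMk hr hC _) (cov_homMk hr hC _)

omit hC in
-- Test vectors are `φ = L f` with `h₀^{1/2} φ = C f`. Moving the selfadjoint `L` and `C` to the
-- other side leaves two equations between bounded operators.
theorem mem_homKgGraph_iff (q : HomEnergy h k × HomEnergy h k) : q ∈ homKgGraph h k ↔
    L (HomEnergy.root h k q.2 - homExt (hZero h k) k (HomEnergy.root h k q.1)) =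
      C (HomEnergy.cov h k q.1) ∧
    L (HomEnergy.cov h k q.2 - k (HomEnergy.cov h k q.1)) = C (HomEnergy.root h k q.1) := by
  have hsq := mem_sqrt_hZero hr
  have key : ∀ a b c : H, (∀ f, ⟪L f, a⟫_ℂ = ⟪L f, b⟫_ℂ + ⟪C f, c⟫_ℂ) ↔ L (a - b) = C c := by
    intro a b c
    simp only [inner_comm_of_selfAdjoint hr.selfAdjoint_L,
      inner_comm_of_selfAdjoint hr.selfAdjoint_C]
    rw [map_sub, sub_eq_iff_eq_add, add_comm]
    constructor
    · intro hf
      refine ext_inner_left ℂ fun f => ?_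
      rw [hf, inner_add_right]
    · intro e f
      rw [e, inner_add_right]
  rw [← key, ← key]
  constructor
  · intro hq
    constructor <;> intro f
    · have h1 := (hq ⟨_, hsq f⟩).1
      rwa [hr.sqrt_apply] at h1
    · have h1 := (hq ⟨_, hsq f⟩).2
      rw [hr.sqrt_apply] at h1
      rw [h1, add_comm]
  · rintro ⟨h1, h2⟩ ⟨φ, hφ⟩
    obtain ⟨f, rfl⟩ := (hr.mem_sqrt φ).1 hφ
    rw [hr.sqrt_apply]
    exact ⟨h1 f, by rw [h2 f, add_comm]⟩

omit hC in
theorem homKgGraph_single {v : HomEnergy h k} (hv : (0, v) ∈ homKgGraph h k) : v = 0 := by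
  rw [mem_homKgGraph_iff hr] at hv
  simp only [map_zero, sub_zero] at hv
  refine HomEnergy.ext_components ?_ ?_
  · rw [map_zero]; exact hr.injective _ hv.1
  · rw [map_zero]; exact hr.injective _ hv.2

variable {K : H →L[ℂ] H} (hK : homExt (hZero h k) k = K)

include hK

/-- The resolvent equation in the homogeneous energy space. -/
theorem homKg_mem_iff (z : ℂ) (a b α β : H) :
    (homMk hr hC (a, b), homMk hr hC (α, β) + z • homMk hr hC (a, b)) ∈ homKgGraph h k ↔
      L (α - (K - z • 1) a) = C b ∧ L (β - (k - z • 1) b) = C a := by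
  rw [mem_homKgGraph_iff hr, hK]
  simp only [map_add, map_smul, root_homMk, cov_homMk]
  have e : ∀ (T : H →L[ℂ] H) (c d : H), c + z • d - T d = c - (T - z • 1) d := fun T c d => by
    rw [sub_apply, smul_apply, one_apply_eq_self]
    abel
  rw [e, e]

theorem homKg_mem_zero_iff (z : ℂ) (a b : H) :
    (homMk hr hC (a, b), z • homMk hr hC (a, b)) ∈ homKgGraph h k ↔
      L ((K - z • 1) a) = -C b ∧ L ((k - z • 1) b) = -C a := by
  have h1 := homKg_mem_iff hr hC hK z a b 0 0
  have h2 : homMk hr hC ((0 : H), (0 : H)) = 0 := map_zero (homMk hr hC)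
  rw [h2, zero_add, zero_sub, zero_sub, map_neg, map_neg] at h1
  rw [h1, neg_eq_iff_eq_neg, neg_eq_iff_eq_neg]

theorem mem_pointSpectrum_homKgOp_iff {z : ℂ} : z ∈ pointSpectrum (homKgOp h k) ↔
    ∃ a b, (a ≠ 0 ∨ b ≠ 0) ∧ L ((K - z • 1) a) = -C b ∧ L ((k - z • 1) b) = -C a := by
  rw [homKgOp, mem_pointSpectrum_iff fun v => homKgGraph_single hr]
  constructor
  · rintro ⟨u, hu, hm⟩
    rw [← homMk_components hr hC u] at hm
    refine ⟨_, _, ?_, (homKg_mem_zero_iff hr hC hK z _ _).1 hm⟩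
    by_contra! h0
    refine hu (HomEnergy.ext_components ?_ ?_)
    · rw [h0.1, map_zero]
    · rw [h0.2, map_zero]
  · rintro ⟨a, b, hab, e⟩
    refine ⟨homMk hr hC (a, b), fun h0 => ?_, (homKg_mem_zero_iff hr hC hK z a b).2 e⟩
    have h1 := root_homMk hr hC (a, b)
    have h2 := cov_homMk hr hC (a, b)
    rw [h0, map_zero] at h1 h2
    rcases hab with h3 | h3
    · exact h3 h1.symm
    · exact h3 h2.symm

/-- The resolvent of the homogeneous energy Klein-Gordon operator. -/
def homResolvent (K : H →L[ℂ] H) (z : ℂ) : HomEnergy h k →L[ℂ] HomEnergy h k :=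
  homMk hr hC ∘L
    ((C.prod (-((k - z • (1 : H →L[ℂ] H)) ∘L L))) ∘L (Ring.inverse (pencil L k z) ∘L
      (L ∘L HomEnergy.cov h k - C ∘L Ring.inverse (K - z • (1 : H →L[ℂ] H)) ∘L
        HomEnergy.root h k)) +
    ContinuousLinearMap.inl ℂ H H ∘L Ring.inverse (K - z • (1 : H →L[ℂ] H)) ∘L HomEnergy.root h k)

omit hr hC hK in
theorem pencil_apply_root {S : H →ₗ.[ℂ] H} (hr : IsRoot S L C) (z : ℂ) (y : H) :
    pencil L k z y = C (C y) - L ((k - z • (1 : H →L[ℂ] H)) ((k - z • (1 : H →L[ℂ] H)) (L y))) := by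
  have h1 : pencil L k z y =
      y - L (L y + (k - z • (1 : H →L[ℂ] H)) ((k - z • (1 : H →L[ℂ] H)) (L y))) := rfl
  rw [h1, map_add]
  nth_rewrite 1 [← hr.add_apply y]
  abel

/-- Seek `a = C y + r' α`, where `r'` inverts `K - z`. Since `L (K - z) C = C (k - z) L`, the first
equation forces `b = -(k - z) L y`, and the second becomes `pencil y = L β - C r' α`. For
uniqueness, a null solution has `b = L b₁`; boundedness of `r'` gives `g` with `a = -C g` and `b =
(k - z) L g`, whence `pencil g = 0`. -/
theorem isResolventAt_homResolvent (hrel : HomRel L C k K) {z : ℂ} {r r' : H →L[ℂ] H}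
    (hr' : HomRel L C r r') (h1 : r * (k - z • 1) = 1) (h2 : (k - z • 1) * r = 1)
    (hz : IsUnit (pencil L k z)) : IsResolventAt (homKgOp h k) z (homResolvent hr hC K z) := by
  have hrelz := hrel.sub_smul hr z
  have h3 := hr'.mul_eq_one hr hC hrelz h1
  have h4 := hrelz.mul_eq_one hr hC hr' h2
  have hinv : Ring.inverse (K - z • (1 : H →L[ℂ] H)) = r' := ringInverse_eq h4 h3
  refine isResolventAt_toLinearPMap (fun v => homKgGraph_single hr) (fun f => ?_) fun u hu => ?_
  · rw [← homMk_components hr hC f]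
    set α := HomEnergy.root h k f with hα
    set β := HomEnergy.cov h k f with hβ
    set y := Ring.inverse (pencil L k z) (L β - C (r' α)) with hy
    have e1 : homResolvent hr hC K z (homMk hr hC (α, β)) =
        homMk hr hC (C y + r' α, -(k - z • (1 : H →L[ℂ] H)) (L y)) := by
      rw [homMk_components hr hC f, homResolvent, hinv]
      refine congrArg (homMk hr hC) (Prod.ext ?_ ?_)
      · rfl
      · change -(k - z • (1 : H →L[ℂ] H)) (L y) + 0 = _
        rw [add_zero]
    rw [e1, homKg_mem_iff hr hC hK]
    have e2 : ∀ v, (K - z • (1 : H →L[ℂ] H)) (r' v) = v := fun v =>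
      congrArg (fun T : H →L[ℂ] H => T v) h4
    have e3 : pencil L k z y = L β - C (r' α) :=
      congrArg (fun T : H →L[ℂ] H => T (L β - C (r' α))) (Ring.mul_inverse_cancel _ hz)
    constructor
    · rw [map_add, e2, sub_add_cancel_right, map_neg, hrelz.apply, map_neg]
    · rw [pencil_apply_root hr, sub_eq_sub_iff_add_eq_add] at e3
      rw [map_neg, sub_neg_eq_add, map_add, map_add, ← e3]
  · rw [← homMk_components hr hC u] at hu ⊢
    set a := HomEnergy.root h k u
    set b := HomEnergy.cov h k u
    obtain ⟨e1, e2⟩ := (homKg_mem_zero_iff hr hC hK z a b).1 hu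
    set b₁ := L b - C ((K - z • (1 : H →L[ℂ] H)) a) with hb₁
    have e3 : L b₁ = b := by
      rw [hb₁, map_sub, hr.comm_apply, e1, map_neg, sub_neg_eq_add, hr.add_apply]
    obtain ⟨g, hg1, hg2⟩ := hr'.exists_eq hr b₁
    have e4 : a = -C g := by
      have h5 : C b₁ = -(K - z • (1 : H →L[ℂ] H)) a := by
        refine sub_eq_zero.1 (hr.injective _ ?_)
        rw [map_sub, hr.comm_apply, e3, map_neg, e1]
        abel
      have h6 : r' ((K - z • (1 : H →L[ℂ] H)) a) = a :=
        congrArg (fun T : H →L[ℂ] H => T a) h3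
      rw [← hg2, h5, map_neg, h6, neg_neg]
    have e5 : b = (k - z • (1 : H →L[ℂ] H)) (L g) := by
      rw [← hg1, e3]
      exact (congrArg (fun T : H →L[ℂ] H => T b) h2).symm
    have e6 : pencil L k z g = 0 := by
      rw [pencil_apply_root hr, ← e5, e2, e4, map_neg, neg_neg, sub_self]
    have e7 : g = 0 := by
      have h7 := congrArg (fun T : H →L[ℂ] H => T g) (Ring.inverse_mul_cancel _ hz)
      simp only [mul_apply_eq_comp, e6, map_zero, one_apply_eq_self] at h7
      exact h7.symm
    rw [e5, e4, e7, map_zero, map_zero, map_zero, neg_zero]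
    exact map_zero (homMk hr hC)

omit hK in
theorem finMero_homResolvent {z₀ : ℂ} (hK : IsUnit (K - z₀ • (1 : H →L[ℂ] H)))
    (hP : FinMero (fun z => Ring.inverse (pencil L k z)) z₀) :
    FinMero (homResolvent hr hC K) z₀ := by
  have hlin : ∀ T : H →L[ℂ] H, AnalyticAt ℂ (fun z : ℂ => T - z • (1 : H →L[ℂ] H)) z₀ := fun T =>
    analyticAt_const.sub (analyticAt_id.smul analyticAt_const)
  have hinv : AnalyticAt ℂ (fun z : ℂ => Ring.inverse (K - z • (1 : H →L[ℂ] H))) z₀ := by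
    obtain ⟨u, hu⟩ := hK
    exact (analyticAt_inverse u).comp_of_eq (hlin K) hu.symm
  have h0 : AnalyticAt ℂ (fun z : ℂ => Ring.inverse (K - z • (1 : H →L[ℂ] H)) ∘L
      HomEnergy.root h k) z₀ := analyticAt_clm_comp hinv analyticAt_const
  have h1 : AnalyticAt ℂ (fun z : ℂ => C.prod (-((k - z • (1 : H →L[ℂ] H)) ∘L L))) z₀ := by
    have h2 : (fun z : ℂ => C.prod (-((k - z • (1 : H →L[ℂ] H)) ∘L L))) = fun z =>
        C.prod (-(k ∘L L)) + z • (ContinuousLinearMap.inr ℂ H H ∘L L) := by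
      funext z
      ext f <;> simp
      abel
    rw [h2]
    exact analyticAt_add_smul _ _ z₀
  have h3 : AnalyticAt ℂ (fun z : ℂ => L ∘L HomEnergy.cov h k -
      C ∘L Ring.inverse (K - z • (1 : H →L[ℂ] H)) ∘L HomEnergy.root h k) z₀ :=
    analyticAt_const.sub (analyticAt_clm_comp analyticAt_const h0)
  have h4 := ((hP.comp_clm h3).clm_comp h1).add
    (FinMero.of_analyticAt (analyticAt_clm_comp
      (analyticAt_const (v := ContinuousLinearMap.inl ℂ H H)) h0))
  exact h4.clm_comp (analyticAt_const (v := homMk hr hC))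

end HomogeneousOperator

/-! ### Comparison of the point spectra -/

section PointSpectra

variable {H : Type*} [NormedAddCommGroup H] [InnerProductSpace ℂ H] [CompleteSpace H]
  {S : H →ₗ.[ℂ] H} {k L C K V : H →L[ℂ] H} {ℓ : ℝ}

theorem exists_hom_of_pencil_ker (hr : IsRoot S L C) (hC : ∀ f, C f = 0 → f = 0)
    (hrel : HomRel L C k K) {z : ℂ} {g : H} (hg : g ≠ 0) (hP : pencil L k z g = 0) :
    ∃ a b, (a ≠ 0 ∨ b ≠ 0) ∧ L ((K - z • 1) a) = -C b ∧ L ((k - z • 1) b) = -C a := by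
  refine ⟨C g, -(k - z • (1 : H →L[ℂ] H)) (L g), Or.inl fun h => hg (hC g h), ?_, ?_⟩
  · rw [(hrel.sub_smul hr z).apply, map_neg, neg_neg]
  · rw [pencil_apply_root hr, sub_eq_zero] at hP
    rw [map_neg, map_neg, ← hP]

/-- Away from the gauge parameter, each end localizes homogeneous eigenvectors in the energy
space. -/
theorem EndData.exists_localized (e : EndData k L V ℓ) (hr : IsRoot S L C)
    (hC : ∀ f, C f = 0 → f = 0) (hrel : HomRel L C k K) {Y I : H →L[ℂ] H}
    (hY : V * V * L = Y * C) (hI : HomRel L C e.i I) (hik : Commute e.i k) {z : ℂ} (hz : z ≠ ℓ)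
    {a b : H} (h1 : L ((K - z • 1) a) = -C b) : ∃ η, L (I (I a)) = C η := by
  have hI2 := hI.mul hr hI
  have hcomm : I * I * (K - z • 1) = (K - z • 1) * (I * I) := by
    have hc : Commute (e.i * e.i) (k - z • 1) :=
      (hik.mul_left hik).sub_right ((Commute.one_right _).smul_right z)
    have h2 := hI2.mul hr (hrel.sub_smul hr z)
    rw [hc.eq] at h2
    exact h2.unique hr hC ((hrel.sub_smul hr z).mul hr hI2)
  -- On the range of `i`, `k - ℓ` is `κ = V² τ V²`, and the Hardy factorization `V² L = Y C`
  -- converts this decay into a bound by the homogeneous norm alone.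
  have hN : L * ((K - (ℓ : ℂ) • 1) * (I * I)) = C * (V * V * e.τ * e.i * e.i * Y) := by
    refine eq_of_mul_C hr hC ?_
    have h2 := (hrel.sub_smul hr (ℓ : ℂ)).mul hr hI2
    have h3 : (k - (ℓ : ℂ) • 1) * (e.i * e.i) = e.κ * (e.i * e.i) := by
      rw [← mul_assoc, sub_mul, e.charge, add_mul, add_sub_assoc, sub_self, add_zero, mul_assoc]
    have h4 : e.κ * (e.i * e.i) * L = V * V * e.τ * e.i * e.i * Y * C := by
      have h5 : V * V * (e.i * e.i) = e.i * e.i * (V * V) :=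
        ((e.comm_weight.mul_right e.comm_weight).mul_left
          (e.comm_weight.mul_right e.comm_weight)).symm.eq
      have h6 : e.κ * (e.i * e.i) = V * V * e.τ * (V * V * (e.i * e.i)) := by
        nth_rewrite 1 [e.charge_eq]
        simp only [mul_assoc]
      rw [h6, h5, mul_assoc _ Y C, ← hY]
      simp only [mul_assoc]
    rw [h2, h3, mul_assoc, h4]
    simp only [mul_assoc]
  set q := (K - z • (1 : H →L[ℂ] H)) a with hq
  have h2 : C (C q - L b) = q := by
    rw [map_sub, ← hr.comm_apply, ← neg_eq_iff_eq_neg.2 h1, map_neg, sub_neg_eq_add, add_comm,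
      hr.add_apply]
  set f := C q - L b with hf
  have h3 : L (I (I q)) = C (e.i (e.i (L f))) := by
    rw [← h2]
    exact hI2.apply f
  have h4 : I (I q) = (K - z • (1 : H →L[ℂ] H)) (I (I a)) :=
    congrArg (fun T : H →L[ℂ] H => T a) hcomm
  have h5 : L ((K - (ℓ : ℂ) • (1 : H →L[ℂ] H)) (I (I a))) =
      C ((V * V * e.τ * e.i * e.i * Y) a) := congrArg (fun T : H →L[ℂ] H => T a) hN
  -- `(z - ℓ) I² a = (K - ℓ) I² a - I² (K - z) a`, and `L` maps both terms into the range of `C`: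
  -- the first by decay, the second by the eigenvalue equation.
  have h6 : (z - ℓ) • L (I (I a)) =
      C ((V * V * e.τ * e.i * e.i * Y) a - e.i (e.i (L f))) := by
    rw [map_sub, ← h5, ← h3, h4, ← map_sub, ← map_smul]
    congr 1
    simp only [sub_apply, smul_apply, one_apply_eq_self]
    module
  refine ⟨(z - ℓ)⁻¹ • ((V * V * e.τ * e.i * e.i * Y) a - e.i (e.i (L f))), ?_⟩
  rw [map_smul, ← h6, smul_smul, inv_mul_cancel₀ (sub_ne_zero.2 hz), one_smul]

/-- The eigenvector comes from the energy space once `a` is in the range of `C`, and for this `L a =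
C η` suffices: by `L² + C² = 1`, then `a = C (L η + C a)`. The partition of unity assembles `η` from
the two ends. -/
theorem exists_pencil_ker_of_hom {ℓ' : ℝ} (e : EndData k L V ℓ) (e' : EndData k L V ℓ')
    (hi : e.i * e.i + e'.i * e'.i = 1) (hr : IsRoot S L C) (hC : ∀ f, C f = 0 → f = 0)
    (hrel : HomRel L C k K) {Y I I' : H →L[ℂ] H} (hY : V * V * L = Y * C)
    (hI : HomRel L C e.i I) (hI' : HomRel L C e'.i I') (hik : Commute e.i k)
    (hik' : Commute e'.i k) {z : ℂ} (hz : z ≠ ℓ) (hz' : z ≠ ℓ') {a b : H} (hab : a ≠ 0 ∨ b ≠ 0)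
    (h1 : L ((K - z • 1) a) = -C b) (h2 : L ((k - z • 1) b) = -C a) :
    ∃ g, g ≠ 0 ∧ pencil L k z g = 0 := by
  obtain ⟨η, hη⟩ := e.exists_localized hr hC hrel hY hI hik hz h1
  obtain ⟨η', hη'⟩ := e'.exists_localized hr hC hrel hY hI' hik' hz' h1
  have hone : I * I + I' * I' = 1 := by
    have h3 := (hI.mul hr hI).add (hI'.mul hr hI')
    rw [hi] at h3
    exact h3.unique hr hC (homRel_one hr)
  have h3 : L a = C (η + η') := by
    rw [map_add, ← hη, ← hη', ← map_add]
    exact congrArg L (congrArg (fun T : H →L[ℂ] H => T a) hone).symm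
  set y := L (η + η') + C a with hy
  have h4 : C y = a := by
    rw [hy, map_add, ← hr.comm_apply, ← h3, hr.add_apply]
  have h5 : b = -(k - z • (1 : H →L[ℂ] H)) (L y) := by
    refine sub_eq_zero.1 (hC _ ?_)
    rw [map_sub, map_neg, ← (hrel.sub_smul hr z).apply, h4, h1]
    abel
  refine ⟨y, ?_, ?_⟩
  · intro h0
    rw [h0, map_zero] at h4 h5
    rw [map_zero, neg_zero] at h5
    rcases hab with h | h
    · exact h h4.symm
    · exact h h5
  · rw [pencil_apply_root hr, h4, sub_eq_zero, ← neg_eq_iff_eq_neg.2 h2, h5]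
    simp only [map_neg, neg_neg]

/-- If the charge is strictly dominated, zero is not an eigenvalue of the homogeneous operator. -/
theorem hom_eq_zero_of_dominated {h : H →ₗ.[ℂ] H} (hr : IsRoot (hZero h k) L C)
    (hC : ∀ f, C f = 0 → f = 0) (hk : IsSelfAdjoint k) (hrel : HomRel L C k K)
    (hd : DominatesSq (perturb (hZero h k) (-(k * k))) k) {a b : H} (h1 : L (K a) = -C b)
    (h2 : L (k b) = -C a) : a = 0 ∧ b = 0 := by
  obtain ⟨c, hc, hd⟩ := hd
  -- Domination rearranges to `‖k u‖ ≤ θ ‖h₀^{1/2} u‖` with `θ = (1 + c)^{-1/2} < 1`, so `k L = Y C`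
  -- with `‖Y‖ ≤ θ`. The equations become `b = -Y a` and `a = -Y* b`, which only zero satisfies.
  have h1c : 1 < Real.sqrt (1 + c) := Real.lt_sqrt_of_sq_lt (by linarith)
  have hθ0 : 0 < (Real.sqrt (1 + c))⁻¹ := by positivity
  have hθ1 : (Real.sqrt (1 + c))⁻¹ < 1 := inv_lt_one_of_one_lt₀ h1c
  have hθ2 : (1 + c) * ((Real.sqrt (1 + c))⁻¹) ^ 2 = 1 := by
    rw [inv_pow, Real.sq_sqrt (by linarith), mul_inv_cancel₀ (by linarith)]
  set θ := (Real.sqrt (1 + c))⁻¹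
  have hb : ∀ g, ‖k (L g)‖ ≤ θ * ‖C g‖ := by
    intro g
    have hL := denseRange_of_selfAdjoint_of_injective hr.selfAdjoint_L hr.injective
    refine hL.induction_on (p := fun g => ‖k (L g)‖ ≤ θ * ‖C g‖) g
      (isClosed_le (by fun_prop) (by fun_prop)) fun f => ?_
    have h3 := hd ⟨L (L f), hr.mem f⟩
    have h4 : perturb (hZero h k) (-(k * k)) ⟨L (L f), hr.mem f⟩ =
        -k (k (L (L f))) + C (C f) := by
      rw [← hr.apply f (hr.mem f)]; rfl
    have h5 : (⟪L (L f), -k (k (L (L f))) + C (C f)⟫_ℂ).re =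
        -‖k (L (L f))‖ ^ 2 + ‖C (L f)‖ ^ 2 := by
      rw [inner_add_right, inner_neg_right, ← inner_comm_of_selfAdjoint hk,
        ← inner_comm_of_selfAdjoint hr.selfAdjoint_C, ← hr.comm_apply (L f),
        inner_comm_of_selfAdjoint hr.selfAdjoint_L, hr.comm_apply f, inner_self_eq_norm_sq_to_K,
        inner_self_eq_norm_sq_to_K]
      simp [← Complex.ofReal_pow]
    rw [h4, h5] at h3
    refine le_of_sq_le_sq ?_ (by positivity)
    have h6 : (1 + c) * ‖k (L (L f))‖ ^ 2 ≤ ‖C (L f)‖ ^ 2 := by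
      change c * ‖k (L (L f))‖ ^ 2 ≤ _ at h3
      linarith
    refine le_of_mul_le_mul_left ?_ (by linarith : 0 < 1 + c)
    rw [mul_pow, ← mul_assoc, hθ2, one_mul]
    exact h6
  obtain ⟨Y, hY, hYn⟩ := exists_factor_of_dense (C : H →ₗ[ℂ] H) ((k * L : H →L[ℂ] H) : H →ₗ[ℂ] H)
    (denseRange_root hr hC) hb
  have hY1 : k * L = Y * C := by
    ext f
    exact hY f
  have hY2 : L * k = C * star Y := by
    have := congrArg star hY1
    rwa [star_mul, star_mul, hk.star_eq, hr.selfAdjoint_L.star_eq, hr.selfAdjoint_C.star_eq] at this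
  have hY3 : L * K = C * Y := by
    refine eq_of_mul_C hr hC ?_
    rw [hrel, mul_assoc, hY1, mul_assoc]
  have hYle : ‖Y‖ ≤ θ := Y.opNorm_le_bound hθ0.le hYn
  have hb' : b = -Y a := by
    have h3 : L (K a) = C (Y a) := congrArg (fun T : H →L[ℂ] H => T a) hY3
    rw [h3] at h1
    exact (sub_eq_zero.1 (hC _ (by rw [map_sub, map_neg, h1, neg_neg, sub_self])))
  have ha' : a = -star Y b := by
    have h3 : L (k b) = C (star Y b) := congrArg (fun T : H →L[ℂ] H => T b) hY2
    rw [h3] at h2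
    exact (sub_eq_zero.1 (hC _ (by rw [map_sub, map_neg, h2, neg_neg, sub_self])))
  have hn1 : ‖b‖ ≤ θ * ‖a‖ := by
    rw [hb', norm_neg]
    exact hYn a
  have hn2 : ‖a‖ ≤ θ * ‖b‖ := by
    nth_rewrite 1 [ha']
    rw [norm_neg]
    refine ((star Y).le_opNorm b).trans ?_
    rw [norm_star]
    exact mul_le_mul_of_nonneg_right hYle (norm_nonneg _)
  have hb0 : ‖b‖ = 0 := by
    nlinarith [norm_nonneg a, norm_nonneg b]
  have ha0 : ‖a‖ = 0 := by
    rw [hb0, mul_zero] at hn2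
    exact le_antisymm hn2 (norm_nonneg _)
  exact ⟨norm_eq_zero.1 ha0, norm_eq_zero.1 hb0⟩

theorem HardyBound.exists_factor {x : H →ₗ.[ℂ] H} {w : ℝ → ℝ} (hh : HardyBound S x w)
    (hr : IsRoot S L C) (hC : ∀ f, C f = 0 → f = 0) : ∃ Y, weight x w 1 * L = Y * C := by
  obtain ⟨c, hc⟩ := hh 1 one_pos
  obtain ⟨Y, hY, -⟩ := exists_factor_of_dense (C : H →ₗ[ℂ] H)
    ((weight x w 1 * L : H →L[ℂ] H) : H →ₗ[ℂ] H) (denseRange_root hr hC) (c := c) fun f => by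
      have h1 := hc ⟨L f, (hr.mem_sqrt _).2 ⟨f, rfl⟩⟩
      rw [hr.sqrt_apply] at h1
      exact h1
  exact ⟨Y, by ext f; exact hY f⟩

end PointSpectra

/-! ### Assembling the theorem -/

section Conclusion

variable {H : Type*} [NormedAddCommGroup H] [InnerProductSpace ℂ H] [CompleteSpace H]

omit [CompleteSpace H] in
theorem DominatesSq.nonneg {S : H →ₗ.[ℂ] H} {κ : H →L[ℂ] H} (h : DominatesSq S κ) (u : S.domain) :
    0 ≤ (⟪(u : H), S u⟫_ℂ).re := by
  obtain ⟨c, hc, h⟩ := h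
  exact (by positivity : 0 ≤ c * ‖κ (u : H)‖ ^ 2).trans (h u)

theorem isSelfAdjoint_real_smul {B : H →L[ℂ] H} (hB : IsSelfAdjoint B) (ℓ : ℝ) :
    IsSelfAdjoint ((ℓ : ℂ) • B) := by
  rw [isSelfAdjoint_iff, star_smul, hB.star_eq]
  congr 1
  exact Complex.conj_ofReal ℓ

theorem isSelfAdjoint_mul_self {B : H →L[ℂ] H} (hB : IsSelfAdjoint B) : IsSelfAdjoint (B * B) := by
  rw [isSelfAdjoint_iff, star_mul, hB.star_eq]

/-- The cutoffs of the two ends vanish where the charges are modified. -/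
theorem cutoff_mul_eq_zero {χm χp : ℝ → ℝ} (hm : tsupport χm ⊆ Set.Iio 1)
    (hp : tsupport χp ⊆ Set.Ioi (-1)) {s t : ℝ} (hst : t + 2 ≤ s) : χm s * χp t = 0 := by
  by_contra h0
  have h1 : s < 1 := hm (subset_tsupport _ (left_ne_zero_of_mul h0))
  have h2 : -1 < t := hp (subset_tsupport _ (right_ne_zero_of_mul h0))
  linarith

/-- The end data of the two ends. -/
theorem exists_two_endData {h : H →ₗ.[ℂ] H} (hh : IsSelfAdjoint h) {k : H →L[ℂ] H}
    (hk : IsSelfAdjoint k) {L C : H →L[ℂ] H} (hr : IsRoot (hZero h k) L C)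
    {x : H →ₗ.[ℂ] H} {w : ℝ → ℝ} (hx : PositionOperator h k x w)
    {χm χp χt : ℝ → ℝ} (hχ : IsCutoffTriple χm χp χt) {ℓ R : ℝ}
    (hends : TwoEnds h k x w χm χp χt ℓ R) :
    ∃ (e₁ : EndData k L (weight x w (1 / 2)) 0) (e₂ : EndData k L (weight x w (1 / 2)) ℓ),
      e₁.i = cut x χp R 0 ∧ e₂.i = cut x χm R 0 := by
  have hxs := hx.selfAdjoint
  have hkN := commute_resolventOp hxs hx.commutes
  have hwc := hx.weight_smooth.continuous
  have hw1 := bddCont_rpow_neg hwc hx.weight_pos one_pos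
  have hw2 := bddCont_rpow_neg hwc hx.weight_pos (a := 1 / 2) (by norm_num)
  have hm := hχ.smooth_m.continuous
  have hp := hχ.smooth_p.continuous
  have bm := fun a => bddCont_cut hm hχ.mem_m R a
  have bp := fun a => bddCont_cut hp hχ.mem_p R a
  have sm : ∀ a, IsSelfAdjoint (cut x χm R a) := fun a => isSelfAdjoint_bddFun hxs (bm a)
  have sp : ∀ a, IsSelfAdjoint (cut x χp R a) := fun a => isSelfAdjoint_bddFun hxs (bp a)
  have km : ∀ a, Commute (cut x χm R a) k := fun a => commute_bddFun hxs hk hkN (bm a)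
  have kp : ∀ a, Commute (cut x χp R a) k := fun a => commute_bddFun hxs hk hkN (bp a)
  have hS₀ : IsSelfAdjoint (hZero h k) := isSelfAdjoint_perturb hh (isSelfAdjoint_mul_self hk)
  have hVV : weight x w (1 / 2) * weight x w (1 / 2) = weight x w 1 := by
    rw [weight_mul hxs hwc hx.weight_pos (by norm_num) (by norm_num)]
    norm_num
  have hκp : IsSelfAdjoint (kPlus k x χm ℓ R) :=
    hk.sub (isSelfAdjoint_real_smul (isSelfAdjoint_mul_self (sm 3)) ℓ)
  have hκm' : IsSelfAdjoint (kMinus k x χp ℓ R) :=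
    hk.add (isSelfAdjoint_real_smul (isSelfAdjoint_mul_self (sp (-3))) ℓ)
  have hκm : IsSelfAdjoint (kMinusShift k x χp ℓ R) :=
    hκm'.sub (isSelfAdjoint_real_smul (IsSelfAdjoint.one _) ℓ)
  have hSp : IsSelfAdjoint (hPlus h k x χm ℓ R) :=
    isSelfAdjoint_perturb hS₀ (isSelfAdjoint_mul_self hκp).neg
  have hSm : IsSelfAdjoint (hMinus h k x χp ℓ R) :=
    isSelfAdjoint_perturb hS₀ (isSelfAdjoint_mul_self hκm).neg
  obtain ⟨Lp, Cp, hrp⟩ := exists_isRoot hSp hends.dominates_plus.nonneg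
  obtain ⟨Lm, Cm, hrm⟩ := exists_isRoot hSm hends.dominates_minus.nonneg
  -- The shift by `3` separates the supports: in the rescaled variable one requires `t < -2`, the
  -- other `t > -1`. Hence `k` agrees with `k₊` on the range of `i₊`, and symmetrically with `k₋` on
  -- that of `i₋`.
  have hzero_p : cut x χm R 3 * cut x χp R 0 = 0 :=
    cut_mul_cut_eq_zero hxs hm hχ.mem_m hp hχ.mem_p fun t =>
      cutoff_mul_eq_zero hχ.supp_m hχ.supp_p (by linarith)
  have hzero_m : cut x χp R (-3) * cut x χm R 0 = 0 :=
    cut_mul_cut_eq_zero hxs hp hχ.mem_p hm hχ.mem_m fun t => by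
      rw [mul_comm]
      exact cutoff_mul_eq_zero hχ.supp_m hχ.supp_p (by linarith)
  have hcp : Commute (cut x χp R 0) (kPlus k x χm ℓ R) := by
    have h1 : Commute (cut x χp R 0) (cut x χm R 3) := bddFun_comm hxs (bp 0) (bm 3)
    exact (kp 0).sub_right ((h1.mul_right h1).smul_right _)
  have hcm : Commute (cut x χm R 0) (kMinusShift k x χp ℓ R) := by
    have h1 : Commute (cut x χm R 0) (cut x χp R (-3)) := bddFun_comm hxs (bm 0) (bp (-3))
    exact ((km 0).add_right ((h1.mul_right h1).smul_right _)).sub_right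
      ((Commute.one_right _).smul_right _)
  have hchp : k * cut x χp R 0 = (kPlus k x χm ℓ R + ((0 : ℝ) : ℂ) • 1) * cut x χp R 0 := by
    rw [Complex.ofReal_zero, zero_smul, add_zero, kPlus, sub_mul, smul_mul_assoc, mul_assoc,
      hzero_p, mul_zero, smul_zero, sub_zero]
  have hchm : k * cut x χm R 0 = (kMinusShift k x χp ℓ R + (ℓ : ℂ) • 1) * cut x χm R 0 := by
    rw [kMinusShift, sub_add_cancel, kMinus, add_mul, smul_mul_assoc, mul_assoc, hzero_m, mul_zero,
      smul_zero, add_zero]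
  have hW := isSelfAdjoint_bddFun hxs hw1
  have hV := isSelfAdjoint_bddFun hxs hw2
  obtain ⟨e₁, h₁⟩ := exists_endData hh (sp 0) hr hrp hW hV hVV hcp (kp 0)
    (bddFun_comm hxs (bp 0) hw2) hchp hends.compatible_plus hends.extends_plus hends.comm_plus
  obtain ⟨e₂, h₂⟩ := exists_endData hh (sm 0) hr hrm hW hV hVV hcm (km 0)
    (bddFun_comm hxs (bm 0) hw2) hchm hends.compatible_minus hends.extends_minus hends.comm_minus
  exact ⟨e₁, e₂, h₁, h₂⟩

theorem isUnit_charge_sub {k : H →L[ℂ] H} (hk : IsSelfAdjoint k) {z : ℂ} (hz : z.im ≠ 0) :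
    IsUnit (k - z • (1 : H →L[ℂ] H)) := by
  have h1 : z ∉ spectrum ℂ k := fun h => hz (hk.im_eq_zero_of_mem_spectrum h)
  rw [spectrum.notMem_iff, Algebra.algebraMap_eq_smul_one, ← IsUnit.neg_iff, neg_sub] at h1
  exact h1

end Conclusion

end KG

end

theorem mainTheorem8 {H : Type*} [NormedAddCommGroup H] [InnerProductSpace ℂ H] [CompleteSpace H]
    (h : H →ₗ.[ℂ] H) (hh : IsSelfAdjoint h) (k : H →L[ℂ] H) (hk : IsSelfAdjoint k)
    (hpos : IsPos (hZero h k)) (hreg : RegularCharge h k)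
    (x : H →ₗ.[ℂ] H) (w : ℝ → ℝ) (hx : PositionOperator h k x w)
    (χm χp χt : ℝ → ℝ) (hχ : IsCutoffTriple χm χp χt)
    (ℓ R : ℝ) (hR : 0 < R) (hends : TwoEnds h k x w χm χp χt ℓ R) :
    (∃ Z : Set ℂ, Z.Finite ∧ (∀ z ∈ Z, z.im ≠ 0) ∧
        (∀ z, z ∈ Z ↔ (starRingEnd ℂ) z ∈ Z) ∧
        {z | z ∈ opSpectrum (kgOp h k) ∧ z.im ≠ 0} = Z ∧
        {z | z ∈ opSpectrum (homKgOp h k) ∧ z.im ≠ 0} = Z ∧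
        (∀ z ∈ Z, z ∈ pointSpectrum (kgOp h k) ∧
          FiniteDimensional ℂ (eigenspace (kgOp h k) z)) ∧
        (∀ z ∈ Z, z ∈ pointSpectrum (homKgOp h k) ∧
          FiniteDimensional ℂ (eigenspace (homKgOp h k) z))) ∧
      FinMeroOn (resolventOp (kgOp h k)) {z | z.im ≠ 0} ∧
      FinMeroOn (resolventOp (homKgOp h k)) {z | z.im ≠ 0} ∧
      pointSpectrum (kgOp h k) ⊆ pointSpectrum (homKgOp h k) ∧
      (∀ z : ℂ, (z ≠ 0 ∧ z ≠ (ℓ : ℂ)) ∨ ℓ = 0 →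
        (z ∈ pointSpectrum (kgOp h k) ↔ z ∈ pointSpectrum (homKgOp h k))) := by
  have hxs := hx.selfAdjoint
  have hwc := hx.weight_smooth.continuous
  have hS₀ : IsSelfAdjoint (hZero h k) := isSelfAdjoint_perturb hh (isSelfAdjoint_mul_self hk)
  obtain ⟨L, C, hr⟩ := exists_isRoot hS₀ hpos.1
  have hC : ∀ f, C f = 0 → f = 0 := fun f hf => hr.injective_C hpos.2 hf
  have hL := hr.selfAdjoint_L
  obtain ⟨e₁, e₂, hi₁, hi₂⟩ := exists_two_endData hh hk hr hx hχ hends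
  have hm := hχ.smooth_m.continuous
  have hp := hχ.smooth_p.continuous
  have hi : e₁.i * e₁.i + e₂.i * e₂.i = 1 := by
    rw [hi₁, hi₂]
    exact cut_sq_add_sq hxs hp hχ.mem_p hm hχ.mem_m hχ.sq_add_sq R
  have hVs : IsSelfAdjoint (weight x w (1 / 2)) :=
    isSelfAdjoint_bddFun hxs (bddCont_rpow_neg hwc hx.weight_pos (by norm_num))
  have hV : ∀ u, weight x w (1 / 2) u = 0 → u = 0 := fun u =>
    weight_injective hxs hwc hx.weight_pos (by norm_num)
  -- the homogeneous extensions
  obtain ⟨ck, hck⟩ := hreg.bounded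
  have hrel := exists_homExt hr hC hck
  set K := homExt (hZero h k) k with hK
  have hres : ∀ z : ℂ, z.im ≠ 0 → ∃ r r' : H →L[ℂ] H, HomRel L C r r' ∧
      r * (k - z • 1) = 1 ∧ (k - z • 1) * r = 1 := fun z hz => by
    obtain ⟨c, hc⟩ := hreg.resolvent_bounded z hz
    have hu := isUnit_charge_sub hk hz
    rw [Algebra.algebraMap_eq_smul_one] at hc
    exact ⟨_, _, exists_homExt hr hC hc, Ring.inverse_mul_cancel _ hu,
      Ring.mul_inverse_cancel _ hu⟩
  -- The extension of `(k - z)⁻¹` inverts `K - z`, so off the real axis the homogeneous resolvent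
  -- has no singularities besides those of the inverse pencil.
  have hKu : ∀ z : ℂ, z.im ≠ 0 → IsUnit (K - z • (1 : H →L[ℂ] H)) := fun z hz => by
    obtain ⟨r, r', h1, h2, h3⟩ := hres z hz
    have h4 := hrel.sub_smul hr z
    exact ⟨⟨_, r', h4.mul_eq_one hr hC h1 h3, h1.mul_eq_one hr hC h4 h2⟩, rfl⟩
  -- resolvents
  have hkg : ∀ z : ℂ, IsUnit (pencil L k z) → IsResolventAt (kgOp h k) z (kgResolvent hr z) :=
    fun z hz => isResolventAt_kgResolvent hr hz
  have hhom : ∀ z : ℂ, z.im ≠ 0 → IsUnit (pencil L k z) →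
      IsResolventAt (homKgOp h k) z (homResolvent hr hC K z) := fun z hz hu => by
    obtain ⟨r, r', h1, h2, h3⟩ := hres z hz
    exact isResolventAt_homResolvent hr hC hK.symm hrel h1 h2 h3 hu
  have hmero := fun (z : ℂ) (hz : z.im ≠ 0) => finMero_inverse_pencil e₁ e₂ hi hL hk hz
  have him : ∀ z₀ : ℂ, z₀.im ≠ 0 → ∀ᶠ z : ℂ in 𝓝[≠] z₀, z.im ≠ 0 := fun z₀ hz₀ =>
    (Complex.continuous_im.continuousAt.eventually_ne hz₀).filter_mono nhdsWithin_le_nhds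
  have hkgm : ∀ z : ℂ, z.im ≠ 0 → FinMero (kgResolvent hr) z := fun z hz =>
    finMero_kgResolvent hr (hmero z hz).2
  have hhomm : ∀ z : ℂ, z.im ≠ 0 → FinMero (homResolvent hr hC K) z := fun z hz =>
    finMero_homResolvent hr hC (hKu z hz) (hmero z hz).2
  have hkge : ∀ z₀ : ℂ, z₀.im ≠ 0 → ∀ᶠ z in 𝓝[≠] z₀,
      IsResolventAt (kgOp h k) z (kgResolvent hr z) := fun z₀ hz₀ =>
    (hmero z₀ hz₀).1.mono fun z hz => hkg z hz
  have hhome : ∀ z₀ : ℂ, z₀.im ≠ 0 → ∀ᶠ z in 𝓝[≠] z₀,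
      IsResolventAt (homKgOp h k) z (homResolvent hr hC K z) := fun z₀ hz₀ => by
    filter_upwards [(hmero z₀ hz₀).1, him z₀ hz₀] with z h1 h2 using hhom z h2 h1
  -- point spectra
  have hsub : pointSpectrum (kgOp h k) ⊆ pointSpectrum (homKgOp h k) := by
    intro z hz
    obtain ⟨g, hg, hP⟩ := (mem_pointSpectrum_kgOp_iff hr).1 hz
    exact (mem_pointSpectrum_homKgOp_iff hr hC hK.symm).2
      (exists_hom_of_pencil_ker hr hC hrel hg hP)
  have hker : ∀ z : ℂ, z.im ≠ 0 → ¬ IsUnit (pencil L k z) → z ∈ pointSpectrum (kgOp h k) :=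
    fun z hz hu => (mem_pointSpectrum_kgOp_iff hr).2 (exists_ker_pencil e₁ e₂ hi hL hk hz hu)
  -- Both nonreal spectra are this one set, the nonreal singular points of the pencil.
  refine ⟨⟨{z | z.im ≠ 0 ∧ ¬ IsUnit (pencil L k z)}, ?_, fun z hz => hz.1, ?_, ?_, ?_, ?_, ?_⟩,
    ?_, ?_, hsub, ?_⟩
  · exact finite_singular_pencil e₁ e₂ hi hr hk hVs hV
  · intro z
    refine and_congr ?_ (not_congr (isUnit_pencil_star hL hk).symm)
    rw [Complex.conj_im, neg_ne_zero]
  · ext z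
    constructor
    · rintro ⟨hz, hz0⟩
      exact ⟨hz0, fun hu => hz ⟨_, hkg z hu⟩⟩
    · rintro ⟨hz0, hu⟩
      exact ⟨pointSpectrum_subset_opSpectrum _ (hker z hz0 hu), hz0⟩
  · ext z
    constructor
    · rintro ⟨hz, hz0⟩
      exact ⟨hz0, fun hu => hz ⟨_, hhom z hz0 hu⟩⟩
    · rintro ⟨hz0, hu⟩
      exact ⟨pointSpectrum_subset_opSpectrum _ (hsub (hker z hz0 hu)), hz0⟩
  · rintro z ⟨hz0, hu⟩
    exact ⟨hker z hz0 hu, finiteDimensional_eigenspace (hkgm z hz0) (hkge z hz0)⟩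
  · rintro z ⟨hz0, hu⟩
    exact ⟨hsub (hker z hz0 hu), finiteDimensional_eigenspace (hhomm z hz0) (hhome z hz0)⟩
  -- Finite meromorphy ignores the value at `z` itself, so the default value `0` of `resolventOp` on
  -- the spectrum is harmless.
  · intro z hz
    exact (hkgm z hz).congr ((hkge z hz).mono fun _ h => h.resolventOp_eq)
  · intro z hz
    exact (hhomm z hz).congr ((hhome z hz).mono fun _ h => h.resolventOp_eq)
  · intro z hz
    refine ⟨fun h => hsub h, fun hzm => ?_⟩
    obtain ⟨a, b, hab, h1, h2⟩ := (mem_pointSpectrum_homKgOp_iff hr hC hK.symm).1 hzm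
    by_cases hz' : z ≠ 0 ∧ z ≠ (ℓ : ℂ)
    · have hkN := commute_resolventOp hxs hx.commutes
      obtain ⟨Y, hY⟩ := hends.hardy_zero.exists_factor hr hC
      rw [← show weight x w (1 / 2) * weight x w (1 / 2) = weight x w 1 by
        rw [weight_mul hxs hwc hx.weight_pos (by norm_num) (by norm_num)]
        norm_num] at hY
      obtain ⟨c₁, hc₁⟩ := hends.hom_zero_plus
      obtain ⟨c₂, hc₂⟩ := hends.hom_zero_minus
      have hI₁ := exists_homExt hr hC hc₁
      have hI₂ := exists_homExt hr hC hc₂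
      rw [← hi₁] at hI₁
      rw [← hi₂] at hI₂
      refine (mem_pointSpectrum_kgOp_iff hr).2 (exists_pencil_ker_of_hom e₁ e₂ hi hr hC hrel hY
        hI₁ hI₂ ?_ ?_ ?_ hz'.2 hab h1 h2)
      · rw [hi₁]
        exact commute_bddFun hxs hk hkN (bddCont_cut hp hχ.mem_p R 0)
      · rw [hi₂]
        exact commute_bddFun hxs hk hkN (bddCont_cut hm hχ.mem_m R 0)
      · rw [Complex.ofReal_zero]
        exact hz'.1
    -- What remains is `ℓ = 0` and `z = 0`. Then `k₊ = k`, and the domination hypothesis at the plus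
    -- end becomes `h ≥ c k²`, which excludes the eigenvalue `0`.
    · exfalso
      have hℓ : ℓ = 0 := by tauto
      have hz0 : z = 0 := by
        by_contra h0
        exact hz' ⟨h0, by rw [hℓ, Complex.ofReal_zero]; exact h0⟩
      subst hz0
      rw [zero_smul, sub_zero] at h1 h2
      have hkp : kPlus k x χm ℓ R = k := by
        rw [kPlus, hℓ, Complex.ofReal_zero, zero_smul, sub_zero]
      have hd := hends.dominates_plus
      rw [hPlus, hkp] at hd
      obtain ⟨ha, hb⟩ := hom_eq_zero_of_dominated hr hC hk hrel hd h1 h2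
      exact hab.elim (fun h => h ha) fun h => h hb
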